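/- All automata are deterministic, complete and transition-based: an automaton over a finite non-empty alphabet $\Sigma$ has a finite set of states $Q$, an initial state $q_0\in Q$ and a transition function $\delta : Q\times\Sigma\to Q\times\Gamma$ producing an output letter at each transition. It is a parity automaton if $\Gamma$ is a finite subset of $\mathbb N$ and a word $w\in\Sigma^\omega$ is accepted if and only if the largest priority that the run over $w$ produces infinitely often is even. For a Muller condition $\mathcal F\subseteq\mathcal P(\Sigma)$ let $L_{\mathcal F}=\{w\in\Sigma^\omega : \mathit{Inf}(w)\in\mathcal F\}$, where $\mathit{Inf}(w)$ is the set of letters occurring infinitely often in $w$. The Zielonka tree of $\mathcal F$ is the tree labelled with subsets of $\Sigma$ whose root has label $\Sigma$ and in which the children of a node with label $A$ are labelled, without repetition, with the maximal non-empty subsets $B\subseteq A$ such that $B\in\mathcal F\Leftrightarrow A\notin\mathcal F$ (a node is a leaf if there is no such $B$). **Proposition 2.7.** There is an algorithm that, given any parity automaton $\mathcal A$ recognising $L_{\mathcal F}$ for some Muller condition $\mathcal F\subseteq\mathcal P(\Sigma)$ (with $\mathcal F$ itself not part of the input), builds in polynomial time a minimal parity automaton recognising $L_{\mathcal F}$,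 that is, one with the least number of states among all parity automata recognising $L_{\mathcal F}$. The algorithm first builds the Zielonka tree of $\mathcal F$ in time $\mathcal O(d^2c^2n^4)$, where $n=|Q|$ is the number of states of $\mathcal A$, $c=|\Sigma|$, and $d$ is the number of priorities appearing on the transitions of $\mathcal A$. Time is the number of steps of a random access machine on natural numbers with unit-cost addition, truncated subtraction, halving, zero test and (indirect) memory access; "polynomial" means polynomial in the number $nc$ of transitions of $\mathcal A$. -/

import Mathlib

namespace MullerParity

open Filter

/-! ## Words, Muller languages and parity automata -/

/-- The set of letters that appear infinitely often in an infinite word. -/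
def infSet {X : Type*} (w : ℕ → X) : Set X :=
  {x | ∃ᶠ i in atTop, w i = x}

/-- The language `L_F` of a Muller condition `F`, a family of sets of letters. -/
def mullerLanguage {S : Type*} (F : Set (Set S)) : Set (ℕ → S) :=
  {w | infSet w ∈ F}

/-- A deterministic, complete, transition-based parity automaton with set of states `Q` and input
alphabet `S`. A transition produces a priority in `ℕ`; for finite `Q` and `S` only finitely many
priorities are produced (see `priorities`). -/
structure ParityAutomaton (Q S : Type*) where
  init : Q
  δ : Q → S → Q × ℕ

namespace ParityAutomaton

variable {Q S : Type*}

/-- The state before the `i`-th letter in the run over `w`. -/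
def runState (A : ParityAutomaton Q S) (w : ℕ → S) : ℕ → Q
  | 0 => A.init
  | i + 1 => (A.δ (runState A w i) (w i)).1

/-- The infinite word of priorities produced by the run over `w`. -/
def output (A : ParityAutomaton Q S) (w : ℕ → S) (i : ℕ) : ℕ :=
  (A.δ (A.runState w i) (w i)).2

/-- The words such that the maximal priority produced infinitely often exists and is even. -/
def language (A : ParityAutomaton Q S) : Set (ℕ → S) :=
  {w | ∃ p, IsGreatest (infSet (A.output w)) p ∧ Even p}

/-- The set of priorities that appear on the transitions. -/
def priorities [Fintype Q] [Fintype S] (A : ParityAutomaton Q S) : Finset ℕ :=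
  Finset.univ.image fun e : Q × S => (A.δ e.1 e.2).2

/-- `A` recognises `L`, and no parity automaton recognising `L` has fewer states. -/
def IsMinimalFor [Fintype Q] (A : ParityAutomaton Q S) (L : Set (ℕ → S)) : Prop :=
  A.language = L ∧
    ∀ (Q' : Type) [Fintype Q'] (B : ParityAutomaton Q' S),
      B.language = L → Fintype.card Q ≤ Fintype.card Q'

end ParityAutomaton

/-! ## Zielonka trees -/

/-- Finite ordered trees whose nodes are labelled with subsets of `S`;
a leaf is a node with `k = 0` children. -/
inductive LabelledTree (S : Type*) where
  | node (A : Set S) (k : ℕ) (children : Fin k → LabelledTree S) : LabelledTree S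

/-- The label of the root. -/
def LabelledTree.label {S : Type*} : LabelledTree S → Set S
  | .node A _ _ => A

/-- The maximal non-empty subsets `B` of `A` such that `B ∈ F` if and only if `A ∉ F`. -/
def maxAlternating {S : Type*} (F : Set (Set S)) (A : Set S) : Set (Set S) :=
  {B | Maximal (fun X : Set S => X.Nonempty ∧ X ⊆ A ∧ (X ∈ F ↔ A ∉ F)) B}

/-- At every node of the tree, with label `A` say, the labels of the children are, without
repetition, the maximal non-empty subsets of `A` that alternate with `A` with respect to `F`.
(Below the child with label `A'` only subsets of `A'` are tested for membership in `F`, so that `F`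
may be kept instead of being restricted to the subsets of `A'`.) -/
def LabelledTree.Alternates {S : Type*} (F : Set (Set S)) : LabelledTree S → Prop
  | .node A _ ts =>
      (Function.Injective fun i => (ts i).label) ∧
      (Set.range fun i => (ts i).label) = maxAlternating F A ∧
      ∀ i, (ts i).Alternates F

/-- `T` is the Zielonka tree of the Muller condition `F` over the alphabet `S`, for some order of
the children of each node. -/
def IsZielonkaTree {S : Type*} (F : Set (Set S)) (T : LabelledTree S) : Prop :=
  T.label = Set.univ ∧ T.Alternates F

/-! ## Random access machines

Structured programs over finitely many scalar registers and finitely many unbounded arrays of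
natural numbers, with uniform cost: every access to a register or to an array cell, every constant
and every arithmetical operation, assignment or test takes one step. The operations are addition,
truncated subtraction and halving. There is no multiplication: a step lengthens the largest number
in memory by a bounded number of bits only, so that polynomially many steps are polynomial time in
the sense of Turing machines. -/

/-- The memory: the contents of the registers and of the arrays. -/
@[ext]
structure Store where
  var : ℕ → ℕ
  arr : ℕ → ℕ → ℕ

/-- Arithmetical expressions; `get a e` reads the array `a` at the index `e`. -/
inductive Expr where
  | const (k : ℕ) : Expr
  | var (x : ℕ) : Expr
  | get (a : ℕ) (e : Expr) : Expr
  | add (e f : Expr) : Expr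
  | sub (e f : Expr) : Expr
  | half (e : Expr) : Expr

namespace Expr

/-- The value of an expression. -/
def eval (s : Store) : Expr → ℕ
  | const k => k
  | var x => s.var x
  | get a e => s.arr a (e.eval s)
  | add e f => e.eval s + f.eval s
  | sub e f => e.eval s - f.eval s
  | half e => e.eval s / 2

/-- The number of steps of the evaluation of an expression. -/
def cost : Expr → ℕ
  | const _ => 1
  | var _ => 1
  | get _ e => e.cost + 1
  | add e f => e.cost + f.cost + 1
  | sub e f => e.cost + f.cost + 1
  | half e => e.cost + 1

end Expr

/-- Programs. A test `e` succeeds if the value of `e` is not `0`. -/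
inductive Prog where
  | skip : Prog
  | assign (x : ℕ) (e : Expr) : Prog
  | write (a : ℕ) (e f : Expr) : Prog
  | seq (P R : Prog) : Prog
  | ite (e : Expr) (P R : Prog) : Prog
  | while (e : Expr) (P : Prog) : Prog

/-- `Exec P s t s'`: started on the memory `s`, the program `P` halts after exactly `t` steps with
the memory `s'`. -/
inductive Exec : Prog → Store → ℕ → Store → Prop
  | skip (s : Store) : Exec .skip s 1 s
  | assign (s : Store) (x : ℕ) (e : Expr) :
      Exec (.assign x e) s (e.cost + 1) ⟨Function.update s.var x (e.eval s), s.arr⟩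
  | write (s : Store) (a : ℕ) (e f : Expr) :
      Exec (.write a e f) s (e.cost + f.cost + 1)
        ⟨s.var, Function.update s.arr a (Function.update (s.arr a) (e.eval s) (f.eval s))⟩
  | seq {P R : Prog} {s s' s'' : Store} {t t' : ℕ} :
      Exec P s t s' → Exec R s' t' s'' → Exec (.seq P R) s (t + t') s''
  | ite_true {e : Expr} {P R : Prog} {s s' : Store} {t : ℕ} :
      e.eval s ≠ 0 → Exec P s t s' → Exec (.ite e P R) s (e.cost + 1 + t) s'
  | ite_false {e : Expr} {P R : Prog} {s s' : Store} {t : ℕ} :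
      e.eval s = 0 → Exec R s t s' → Exec (.ite e P R) s (e.cost + 1 + t) s'
  | while_true {e : Expr} {P : Prog} {s s' s'' : Store} {t t' : ℕ} :
      e.eval s ≠ 0 → Exec P s t s' → Exec (.while e P) s' t' s'' →
      Exec (.while e P) s (e.cost + 1 + t + t') s''
  | while_false {e : Expr} {P : Prog} {s : Store} :
      e.eval s = 0 → Exec (.while e P) s (e.cost + 1) s

/-! ## Representation of automata and trees in memory -/

/-- The memory `s` holds the automaton `A` with states `0, …, n - 1` and letters `0, …, c - 1`:
registers 0, 1, 2 hold `n`, `c` and the initial state; at index `q * c + a`, the arrays 0 and 1 hold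
the target and the priority of the transition from `q` under `a`. -/
def HoldsAutomaton {n c : ℕ} (s : Store) (A : ParityAutomaton (Fin n) (Fin c)) : Prop :=
  s.var 0 = n ∧ s.var 1 = c ∧ s.var 2 = A.init ∧
    ∀ (q : Fin n) (a : Fin c),
      s.arr 0 (q * c + a) = (A.δ q a).1 ∧ s.arr 1 (q * c + a) = (A.δ q a).2

/-- The initial memory on input `A`: it holds `A`, and everything else is `0`. -/
def inputStore {n c : ℕ} (A : ParityAutomaton (Fin n) (Fin c)) : Store where
  var x := if x = 0 then n else if x = 1 then c else if x = 2 then A.init else 0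
  arr k i :=
    if h : i < n * c then
      let e := finProdFinEquiv.symm (⟨i, h⟩ : Fin (n * c))
      if k = 0 then (A.δ e.1 e.2).1 else if k = 1 then (A.δ e.1 e.2).2 else 0
    else 0

theorem holdsAutomaton_inputStore {n c : ℕ} (A : ParityAutomaton (Fin n) (Fin c)) :
    HoldsAutomaton (inputStore A) A := by
  refine ⟨rfl, rfl, rfl, fun q a => ?_⟩
  have key : (q * c + a : ℕ) = (finProdFinEquiv (q, a) : Fin (n * c)) := by
    simp [mul_comm, add_comm]
  rw [key]
  simp only [inputStore, Fin.is_lt, dite_true, Fin.eta, Equiv.symm_apply_apply]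
  simp

/-- The subtree rooted at the memory node `v` is `T`. The memory nodes are `0, …, N - 1`. The array
2 holds the parent of each node except node 0, and the array 3 holds at index `v * c + a` the bit
that tells whether the letter `a` belongs to the label of `v`. -/
def HoldsSubtree {c : ℕ} (s : Store) (N : ℕ) : ℕ → LabelledTree (Fin c) → Prop
  | v, .node A k ts =>
      (∀ a : Fin c, s.arr 3 (v * c + a) = A.indicator (fun _ => 1) a) ∧
      ∃ child : Fin k → ℕ, Function.Injective child ∧
        Set.range child = {w | 0 < w ∧ w < N ∧ s.arr 2 w = v} ∧
        ∀ i, HoldsSubtree s N (child i) (ts i)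

/-- The memory `s` holds the labelled tree `T`: register 3 holds the number of nodes, the root is
node 0, and the parent of every other node has a smaller number. -/
def HoldsTree {c : ℕ} (s : Store) (T : LabelledTree (Fin c)) : Prop :=
  0 < s.var 3 ∧ (∀ w, 0 < w → w < s.var 3 → s.arr 2 w < w) ∧ HoldsSubtree s (s.var 3) 0 T

end MullerParity

/-!
Why the theorem holds. Let `A` recognise `L_F`. For a set `X` of letters call a state `x` *terminal*
(`Terminal`) if the states reached from `x` by words over `X` form a strongly connected set; every
state reaches one (`exists_terminal`). Some run stays in this component and takes exactly its
transitions infinitely often, so that `X ∈ F` if and only if the greatest priority in the component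
is even (`Terminal.mem_iff_even`): the automaton answers membership in `F`.

*Children.* Let `x` be terminal for `X`, let `p` be the greatest priority of its component, and let
`q` have the other parity. Restrict the component to the priorities up to `q`. The letters of a
strongly connected component of this graph that contains the priority `q` form an alternating subset
of `X` (`sccLetters_mem_iff`), and every maximal alternating subset arises in this way
(`exists_sccLetters_eq`). Hence the children of `X` in the Zielonka tree are the maximal ones among
at most `d * n` candidates. The candidates are treated by decreasing size; one is kept unless it is
contained in a child found before (`mem_maxAlternating_of_handled`), so that the inclusion tests
involve at most `n` children.

*Size.* Terminal states for the nodes of the tree can be chosen so that the components are nested as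
the nodes are (`exists_isNested`). The components of two siblings are disjoint, for otherwise their
union would be strongly connected with a greatest priority taken from one of them, against
maximality (`Terminal.eq_of_common_reach`). So nodes whose components share a state are comparable
(`IsNested.below_or_below`), and the greatest priority strictly decreases along each branch
(`IsNested.top_lt`). This bounds the number of nodes by `n * d` (`IsNested.le_card_mul`), and the
number of leaves by the number of states of any automaton that recognises `L_F` (`card_leaves_le`).
A node costs `O(d * c ^ 2 * n ^ 3)` steps, since each of the `c` sizes, `d` priorities and `n`
states calls for a search in the graph and inclusion tests in `O(c * n ^ 2)` steps; the total is
`O(d ^ 2 * c ^ 2 * n ^ 4)` (`wp_zielonkaProg`).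

*Minimal automaton.* The states are the leaves. Under a letter `a`, go from the leaf up to the
lowest node `u` whose label contains `a`, output the greatest priority of the component of `u`, move to the
next child of `u` in a cyclic order, and down to a leaf (`TreeStep`). The topmost node that is used
infinitely often decides acceptance, which gives `L_F` (`language_eq_of_treeStep`); by the bound
on the number of leaves the automaton is minimal (`wp_minimalProg`).

The programs are verified by means of `wp P s R`: started on the memory `s`, the program `P` halts,
and its running time and final memory satisfy `R`. The frame lemma `wp_agree` says that a program
changes only the registers and arrays that occur as targets in its text.
-/

namespace MullerParity

open Filter

/-! ### Runs that visit exactly a strongly connected set of transitions infinitely often -/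

theorem infSet_comp {X Y : Type*} [Finite X] (e : ℕ → X) (f : X → Y) :
    infSet (f ∘ e) = f '' infSet e := by
  ext y
  constructor
  · intro hy
    by_contra hcon
    have h : ∀ x, ∀ᶠ i in atTop, f x = y → e i ≠ x := by
      intro x
      by_cases hx : f x = y
      · have hx' : x ∉ infSet e := fun h => hcon ⟨x, h, hx⟩
        exact (not_frequently.1 hx').mono fun i hi _ => hi
      · exact Eventually.of_forall fun i hi => absurd hi hx
    obtain ⟨i, hi, hi'⟩ := (hy.and_eventually (eventually_all.2 h)).exists
    exact hi' (e i) hi rfl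
  · rintro ⟨x, hx, rfl⟩
    exact hx.mono fun i hi => congrArg f hi

theorem infSet_add {X : Type*} (e : ℕ → X) (k : ℕ) : infSet (fun i => e (i + k)) = infSet e := by
  ext x
  have h : (∃ᶠ i in map (fun i => i + k) atTop, e i = x) ↔ ∃ᶠ i in atTop, e (i + k) = x :=
    frequently_map
  rw [map_add_atTop_eq_nat] at h
  exact h.symm

theorem infSet_nonempty {X : Type*} [Finite X] (e : ℕ → X) : (infSet e).Nonempty := by
  by_contra hcon
  have h : ∀ x, ∀ᶠ i in atTop, e i ≠ x := fun x =>
    not_frequently.1 fun hx => hcon ⟨x, hx⟩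
  obtain ⟨i, hi⟩ := (eventually_all.2 h).exists
  exact hi _ rfl

theorem eventually_mem_infSet {X : Type*} [Finite X] (e : ℕ → X) :
    ∀ᶠ i in atTop, e i ∈ infSet e := by
  have h : ∀ x, ∀ᶠ i in atTop, x ∉ infSet e → e i ≠ x := by
    intro x
    by_cases hx : x ∈ infSet e
    · exact Eventually.of_forall fun i hi => absurd hx hi
    · exact (not_frequently.1 hx).mono fun i hi _ => hi
  refine (eventually_all.2 h).mono fun i hi => ?_
  by_contra hcon
  exact hi _ hcon rfl

theorem maximal_of_mem {S : Type*} {F : Set (Set S)} {X B : Set S}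
    (h : B ∈ maxAlternating F X) :
    Maximal (fun Y : Set S => Y.Nonempty ∧ Y ⊆ X ∧ (Y ∈ F ↔ X ∉ F)) B := h

namespace ParityAutomaton

variable {Q S : Type*} (A : ParityAutomaton Q S)

/-- The transitions taken by the run over `w`, each given by its source and its letter. -/
def trace (w : ℕ → S) (i : ℕ) : Q × S := (A.runState w i, w i)

/-- There is a transition from `x` to `y` among those that satisfy `ok`. -/
def Step (ok : Q → S → Prop) (x y : Q) : Prop := ∃ a, ok x a ∧ (A.δ x a).1 = y

/-- There is a path from `x` to `y` along transitions that satisfy `ok`. -/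
def Reach (ok : Q → S → Prop) : Q → Q → Prop := Relation.ReflTransGen (A.Step ok)

/-- The state reached by reading a finite word. -/
def walk (q : Q) (u : List S) : Q := u.foldl (fun q a => (A.δ q a).1) q

/-- The transitions taken while reading a finite word. -/
def edges : Q → List S → List (Q × S)
  | _, [] => []
  | q, a :: u => (q, a) :: edges (A.δ q a).1 u

variable {A}

theorem walk_append (q : Q) (u v : List S) : A.walk q (u ++ v) = A.walk (A.walk q u) v := by
  simp [walk]

theorem edges_append (q : Q) (u v : List S) :
    A.edges q (u ++ v) = A.edges q u ++ A.edges (A.walk q u) v := by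
  induction u generalizing q with
  | nil => simp [edges, walk]
  | cons a u ih =>
    simp only [List.cons_append, edges, ih]
    rfl

theorem mem_edges {q : Q} {u : List S} {e : Q × S} :
    e ∈ A.edges q u ↔ ∃ (j : ℕ) (h : j < u.length), (A.walk q (u.take j), u[j]) = e := by
  induction u generalizing q with
  | nil => simp [edges]
  | cons a u ih =>
    simp only [edges, List.mem_cons, ih]
    constructor
    · rintro (rfl | ⟨j, h, rfl⟩)
      · exact ⟨0, by simp, rfl⟩
      · exact ⟨j + 1, by simpa using h, rfl⟩
    · rintro ⟨j, h, rfl⟩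
      cases j with
      | zero => exact Or.inl rfl
      | succ j => exact Or.inr ⟨j, by simpa using h, rfl⟩

theorem Reach.exists_walk {ok : Q → S → Prop} {x y : Q} (h : A.Reach ok x y) :
    ∃ u, A.walk x u = y ∧ ∀ e ∈ A.edges x u, ok e.1 e.2 := by
  induction h with
  | refl => exact ⟨[], rfl, by simp [edges]⟩
  | tail _ h ih =>
    obtain ⟨u, rfl, hu⟩ := ih
    obtain ⟨a, ha, rfl⟩ := h
    refine ⟨u ++ [a], by rw [walk_append]; rfl, fun e he => ?_⟩
    rw [edges_append, List.mem_append] at he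
    rcases he with he | he
    · exact hu e he
    · simp only [edges, List.mem_singleton] at he
      subst he
      exact ha

theorem Reach.mono {ok ok' : Q → S → Prop} (h : ∀ x a, ok x a → ok' x a) {x y : Q}
    (hr : A.Reach ok x y) : A.Reach ok' x y :=
  Relation.ReflTransGen.mono (r := A.Step ok) (fun _ _ ⟨a, ha, e⟩ => ⟨a, h _ _ ha, e⟩) _ _ hr

theorem Reach.trans {ok : Q → S → Prop} {x y z : Q} (h : A.Reach ok x y) (h' : A.Reach ok y z) :
    A.Reach ok x z := Relation.ReflTransGen.trans h h'

theorem Reach.refl {ok : Q → S → Prop} (x : Q) : A.Reach ok x x := Relation.ReflTransGen.refl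

theorem Reach.step {ok : Q → S → Prop} {x y : Q} {a : S} (h : A.Reach ok x y) (ha : ok y a) :
    A.Reach ok x (A.δ y a).1 := Relation.ReflTransGen.tail h ⟨a, ha, rfl⟩

variable (A) in
/-- The automaton with another initial state. -/
def startAt (q : Q) : ParityAutomaton Q S := ⟨q, A.δ⟩

theorem exists_trace_shift {x y : Q} (h : A.Reach (fun _ _ => True) x y) (w : ℕ → S) :
    ∃ w' k, ∀ i, (A.startAt x).trace w' (i + k) = (A.startAt y).trace w i := by
  induction h using Relation.ReflTransGen.head_induction_on with
  | refl => exact ⟨w, 0, fun i => rfl⟩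
  | @head x x' hx _ ih =>
    obtain ⟨w', k, hw⟩ := ih
    obtain ⟨a, -, rfl⟩ := hx
    refine ⟨fun i => i.casesOn a w', k + 1, fun i => ?_⟩
    rw [← hw i]
    have hrun : ∀ i, (A.startAt x).runState (fun i => i.casesOn a w') (i + 1) =
        (A.startAt (A.δ x a).1).runState w' i := by
      intro i
      induction i with
      | zero => rfl
      | succ i ih =>
        rw [runState, ih]
        rfl
    simp only [trace, ← add_assoc, hrun]

/-- Repeating a closed walk for ever takes exactly the transitions of that walk infinitely
often. -/
theorem exists_infSet_trace_eq_edges {q : Q} {u : List S} (hu : u ≠ []) (hq : A.walk q u = q) :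
    ∃ w, infSet ((A.startAt q).trace w) = {e | e ∈ A.edges q u} := by
  have hl : 0 < u.length := List.length_pos_iff.2 hu
  let w : ℕ → S := fun i => u[i % u.length]'(Nat.mod_lt _ hl)
  have hrun : ∀ i, (A.startAt q).runState w i = A.walk q (u.take (i % u.length)) := by
    intro i
    induction i with
    | zero => simp [runState, startAt, walk]
    | succ i ih =>
      have hi := Nat.mod_lt i hl
      have h1 : (A.startAt q).runState w (i + 1) =
          A.walk q (u.take (i % u.length) ++ [u[i % u.length]]) := by
        rw [walk_append, ← ih]
        rfl
      rw [h1, List.take_append_getElem, Nat.add_mod]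
      rcases Nat.lt_or_ge (i % u.length + 1) u.length with h | h
      · have : 1 % u.length = 1 := Nat.mod_eq_of_lt (by omega)
        rw [this, Nat.mod_eq_of_lt h]
      · have h2 : i % u.length + 1 = u.length := by omega
        have h3 : (i % u.length + 1 % u.length) % u.length = 0 := by
          rw [Nat.mod_add_mod, Nat.add_mod_mod, ← Nat.mod_add_mod, h2, Nat.mod_self]
        rw [h2, h3, List.take_length, hq]
        rfl
  refine ⟨w, ?_⟩
  let g : ℕ → Q × S := fun j => (A.walk q (u.take (j % u.length)),
    u[j % u.length]'(Nat.mod_lt _ hl))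
  have ht : (A.startAt q).trace w = g := by
    funext i
    simp only [trace, hrun, g, w]
  rw [ht]
  ext e
  rw [Set.mem_ofPred_eq, mem_edges]
  constructor
  · intro he
    obtain ⟨i, hi⟩ := Frequently.exists he
    exact ⟨i % u.length, Nat.mod_lt _ hl, hi⟩
  · rintro ⟨j, hj, rfl⟩
    refine frequently_atTop.2 fun a => ⟨j + u.length * a, ?_, ?_⟩
    · nlinarith
    · have : (j + u.length * a) % u.length = j := by
        rw [Nat.add_mul_mod_self_left, Nat.mod_eq_of_lt hj]
      simp only [g, this]

/-- A non-empty reachable set `E` of transitions that is strongly connected, as witnessed by paths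
inside `E` between a fixed state `x` and each transition of `E`, is the set of transitions that some
run takes infinitely often. -/
theorem exists_infSet_trace_eq [Finite Q] [Finite S] {E : Set (Q × S)} {x : Q}
    (hx : A.Reach (fun _ _ => True) A.init x) (hne : E.Nonempty)
    (hE : ∀ e ∈ E, A.Reach (fun q a => (q, a) ∈ E) x e.1)
    (hE' : ∀ e ∈ E, A.Reach (fun q a => (q, a) ∈ E) (A.δ e.1 e.2).1 x) :
    ∃ w, infSet (A.trace w) = E := by
  have key : ∃ u, A.walk x u = x ∧ ∀ e, e ∈ A.edges x u ↔ e ∈ E := by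
    have hind : ∀ E' ⊆ E, ∃ u, A.walk x u = x ∧ (∀ e ∈ A.edges x u, e ∈ E) ∧
        ∀ e ∈ E', e ∈ A.edges x u := by
      intro E'
      induction E', Set.toFinite E' using Set.Finite.induction_on with
      | empty => exact fun _ => ⟨[], rfl, by simp [edges], by simp⟩
      | @insert e E' _ _ ih =>
        intro hsub
        obtain ⟨u, hu, hu', hu''⟩ := ih ((Set.subset_insert _ _).trans hsub)
        have he : e ∈ E := hsub (Set.mem_insert _ _)
        obtain ⟨v, hv, hv'⟩ := (hE e he).exists_walk
        obtain ⟨v', hv2, hv2'⟩ := (hE' e he).exists_walk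
        have hcons : ∀ q a, (q, a) = e → A.walk q (a :: v') = x := by
          rintro q a rfl; exact hv2
        refine ⟨u ++ (v ++ (e.2 :: v')), ?_, ?_, ?_⟩
        · rw [walk_append, walk_append, hu, hv, hcons _ _ rfl]
        · intro f hf
          simp only [edges_append, hu, hv, edges, List.mem_append, List.mem_cons] at hf
          rcases hf with hf | hf | hf | hf
          · exact hu' f hf
          · exact hv' f hf
          · rw [hf]; exact he
          · exact hv2' f hf
        · intro f hf
          simp only [edges_append, hu, hv, edges, List.mem_append, List.mem_cons]
          rcases hf with rfl | hf
          · exact Or.inr (Or.inr (Or.inl rfl))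
          · exact Or.inl (hu'' f hf)
    obtain ⟨u, h1, h2, h3⟩ := hind E subset_rfl
    exact ⟨u, h1, fun e => ⟨h2 e, h3 e⟩⟩
  obtain ⟨u, hu, huE⟩ := key
  have hu0 : u ≠ [] := by
    rintro rfl
    obtain ⟨e, he⟩ := hne
    exact absurd ((huE e).2 he) (by simp [edges])
  obtain ⟨w, hw⟩ := exists_infSet_trace_eq_edges hu0 hu
  obtain ⟨w', k, hk⟩ := exists_trace_shift hx w
  refine ⟨w', ?_⟩
  have h2 : (A.startAt A.init).trace w' = A.trace w' := rfl
  rw [← infSet_add _ k, ← h2, funext hk, hw]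
  ext e
  exact huE e

/-! ### Strongly connected components and the Muller condition -/

/-- The priority of a transition. -/
abbrev prio (A : ParityAutomaton Q S) (e : Q × S) : ℕ := (A.δ e.1 e.2).2

/-- The letters of a reachable strongly connected set of transitions form a set in `F` if and only
if the greatest priority of the set is even. -/
theorem mem_iff_even [Finite Q] [Finite S] {F : Set (Set S)} (hF : A.language = mullerLanguage F)
    {E : Set (Q × S)} {x : Q}
    (hx : A.Reach (fun _ _ => True) A.init x)
    (hE : ∀ e ∈ E, A.Reach (fun q a => (q, a) ∈ E) x e.1)
    (hE' : ∀ e ∈ E, A.Reach (fun q a => (q, a) ∈ E) (A.δ e.1 e.2).1 x)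
    {p : ℕ} (hp : IsGreatest (A.prio '' E) p) : Prod.snd '' E ∈ F ↔ Even p := by
  have hne : E.Nonempty := by
    obtain ⟨e, he, -⟩ := hp.1
    exact ⟨e, he⟩
  obtain ⟨w, hw⟩ := exists_infSet_trace_eq hx hne hE hE'
  have h1 : infSet w = Prod.snd '' E := by
    rw [← hw, ← infSet_comp]; rfl
  have h2 : infSet (A.output w) = A.prio '' E := by
    rw [← hw, ← infSet_comp]; rfl
  have h3 : w ∈ A.language ↔ w ∈ mullerLanguage F := by rw [hF]
  simp only [language, mullerLanguage, Set.mem_ofPred_eq, h1, h2] at h3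
  rw [← h3]
  constructor
  · rintro ⟨p', hp', he⟩
    rwa [hp.unique hp']
  · exact fun he => ⟨p, hp, he⟩

variable (A) in
/-- The transitions of the strongly connected component of `x` in the graph of the transitions that
satisfy `ok`. -/
def sccEdges (ok : Q → S → Prop) (x : Q) : Set (Q × S) :=
  {e | ok e.1 e.2 ∧ A.Reach ok x e.1 ∧ A.Reach ok (A.δ e.1 e.2).1 x}

theorem Reach.sccEdges {ok : Q → S → Prop} {x y z : Q} (hxy : A.Reach ok x y)
    (hyz : A.Reach ok y z) (hzx : A.Reach ok z x) :
    A.Reach (fun q a => (q, a) ∈ A.sccEdges ok x) y z := by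
  induction hyz with
  | refl => exact Reach.refl _
  | tail h1 h2 ih =>
    obtain ⟨a, ha, rfl⟩ := h2
    have h3 := Relation.ReflTransGen.head (r := A.Step ok) ⟨a, ha, rfl⟩ hzx
    exact (ih h3).step ⟨ha, hxy.trans h1, hzx⟩

theorem mem_iff_even_sccEdges [Finite Q] [Finite S] {F : Set (Set S)}
    (hF : A.language = mullerLanguage F) {ok : Q → S → Prop} {x : Q}
    (hx : A.Reach (fun _ _ => True) A.init x)
    {p : ℕ} (hp : IsGreatest (A.prio '' A.sccEdges ok x) p) :
    Prod.snd '' A.sccEdges ok x ∈ F ↔ Even p := by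
  refine mem_iff_even hF hx ?_ ?_ hp
  · exact fun e he => Reach.sccEdges (Reach.refl _) he.2.1
      (Relation.ReflTransGen.head (r := A.Step ok) ⟨_, he.1, rfl⟩ he.2.2)
  · exact fun e he => Reach.sccEdges (he.2.1.step he.1) he.2.2 (Reach.refl _)

variable (A) in
/-- Reachability by words over a set `X` of letters. -/
abbrev ReachIn (X : Set S) : Q → Q → Prop := A.Reach fun _ a => a ∈ X

variable (A) in
/-- Every state reached from `x` by a word over `X` leads back to `x` by such a word: the states
reached in this way form a strongly connected set closed under the letters of `X`. -/
def Terminal (X : Set S) (x : Q) : Prop := ∀ y, A.ReachIn X x y → A.ReachIn X y x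

variable (A) in
/-- The transitions with a letter in `X` from the states reached from `x` by words over `X`. -/
def edgesIn (X : Set S) (x : Q) : Set (Q × S) := {e | e.2 ∈ X ∧ A.ReachIn X x e.1}

theorem ReachIn.mono {X Y : Set S} (h : X ⊆ Y) {x y : Q} (hr : A.ReachIn X x y) :
    A.ReachIn Y x y := Reach.mono (fun _ _ ha => h ha) hr

theorem Reach.top {ok : Q → S → Prop} {x y : Q} (hr : A.Reach ok x y) :
    A.Reach (fun _ _ => True) x y := Reach.mono (fun _ _ _ => trivial) hr

theorem Terminal.sccEdges_eq {X : Set S} {x : Q} (h : A.Terminal X x) :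
    A.sccEdges (fun _ a => a ∈ X) x = A.edgesIn X x := by
  ext e
  constructor
  · exact fun he => ⟨he.1, he.2.1⟩
  · exact fun he => ⟨he.1, he.2, h _ (he.2.step he.1)⟩

theorem Terminal.of_reach {X : Set S} {x y : Q} (h : A.Terminal X x) (hy : A.ReachIn X x y) :
    A.Terminal X y := fun z hz => (h z (hy.trans hz)).trans hy

theorem snd_image_edgesIn (X : Set S) (x : Q) : Prod.snd '' A.edgesIn X x = X := by
  ext a
  constructor
  · rintro ⟨e, he, rfl⟩
    exact he.1
  · exact fun ha => ⟨(x, a), ⟨ha, Reach.refl _⟩, rfl⟩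

theorem exists_terminal [Finite Q] (X : Set S) (x : Q) :
    ∃ y, A.ReachIn X x y ∧ A.Terminal X y := by
  -- a reached state from which the least number of states is reached
  obtain ⟨y, hy, hmin⟩ := Set.exists_min_image {y | A.ReachIn X x y}
    (fun y => {z | A.ReachIn X y z}.ncard) (Set.toFinite _) ⟨x, Reach.refl _⟩
  refine ⟨y, hy, fun z hz => ?_⟩
  have hsub : {t | A.ReachIn X z t} ⊆ {t | A.ReachIn X y t} := fun t ht => hz.trans ht
  have := Set.eq_of_subset_of_ncard_le hsub (hmin z (Reach.trans hy hz))
  have hy' : y ∈ {t | A.ReachIn X y t} := Reach.refl _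
  rw [← this] at hy'
  exact hy'

theorem exists_isGreatest [Finite Q] [Finite S] {X : Set S} (hX : X.Nonempty) (x : Q) :
    ∃ p, IsGreatest (A.prio '' A.edgesIn X x) p := by
  obtain ⟨a, ha⟩ := hX
  obtain ⟨e, he, hmax⟩ := Set.exists_max_image (A.edgesIn X x) A.prio (Set.toFinite _)
    ⟨(x, a), ha, Reach.refl _⟩
  exact ⟨A.prio e, ⟨e, he, rfl⟩, by rintro _ ⟨f, hf, rfl⟩; exact hmax f hf⟩

theorem Terminal.mem_iff_even [Finite Q] [Finite S] {F : Set (Set S)}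
    (hF : A.language = mullerLanguage F) {X : Set S} {x : Q} (h : A.Terminal X x)
    (hx : A.Reach (fun _ _ => True) A.init x) {p : ℕ}
    (hp : IsGreatest (A.prio '' A.edgesIn X x) p) : X ∈ F ↔ Even p := by
  rw [← h.sccEdges_eq] at hp
  rw [← mem_iff_even_sccEdges hF hx hp, h.sccEdges_eq, snd_image_edgesIn]

/-- If the terminal components for `B` and `B'` share a state, their union is strongly connected and
its greatest priority is the greatest priority of one of them. -/
theorem Terminal.union_mem_iff [Finite Q] [Finite S] {F : Set (Set S)}
    (hF : A.language = mullerLanguage F) {B B' : Set S} {x x' y : Q} (h : A.Terminal B x)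
    (h' : A.Terminal B' x') (hx : A.Reach (fun _ _ => True) A.init x)
    (hy : A.ReachIn B x y) (hy' : A.ReachIn B' x' y) (hB : B.Nonempty) (hB' : B'.Nonempty)
    (hiff : B ∈ F ↔ B' ∈ F) : B ∪ B' ∈ F ↔ B ∈ F := by
  have hyr : A.Reach (fun _ _ => True) A.init y := hx.trans hy.top
  have ht := h.of_reach hy
  have ht' := h'.of_reach hy'
  obtain ⟨p, hp⟩ := A.exists_isGreatest hB y
  obtain ⟨p', hp'⟩ := A.exists_isGreatest hB' y
  have h1 := ht.mem_iff_even hF hyr hp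
  have h2 := ht'.mem_iff_even hF hyr hp'
  have hgr : IsGreatest (A.prio '' (A.edgesIn B y ∪ A.edgesIn B' y)) (max p p') := by
    rw [Set.image_union]
    exact hp.union hp'
  have h3 := ParityAutomaton.mem_iff_even hF hyr (E := A.edgesIn B y ∪ A.edgesIn B' y) ?_ ?_ hgr
  · rw [Set.image_union, snd_image_edgesIn, snd_image_edgesIn] at h3
    rw [h3]
    rcases max_choice p p' with h | h <;> rw [h] <;> tauto
  · rintro e (he | he)
    · refine Reach.mono (fun q a hq => Or.inl ?_)
        (Reach.sccEdges (Reach.refl _) he.2 (ht _ he.2))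
      rw [← ht.sccEdges_eq]; exact hq
    · refine Reach.mono (fun q a hq => Or.inr ?_)
        (Reach.sccEdges (Reach.refl _) he.2 (ht' _ he.2))
      rw [← ht'.sccEdges_eq]; exact hq
  · rintro e (he | he)
    · refine Reach.mono (fun q a hq => Or.inl ?_)
        (Reach.sccEdges (he.2.step he.1) (ht _ (he.2.step he.1)) (Reach.refl _))
      rw [← ht.sccEdges_eq]; exact hq
    · refine Reach.mono (fun q a hq => Or.inr ?_)
        (Reach.sccEdges (he.2.step he.1) (ht' _ (he.2.step he.1)) (Reach.refl _))
      rw [← ht'.sccEdges_eq]; exact hq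

/-- The terminal components for two different children of a node of the Zielonka tree are
disjoint. -/
theorem Terminal.eq_of_common_reach [Finite Q] [Finite S] {F : Set (Set S)}
    (hF : A.language = mullerLanguage F) {X B B' : Set S} (hB : B ∈ maxAlternating F X)
    (hB' : B' ∈ maxAlternating F X) {x x' y : Q} (h : A.Terminal B x) (h' : A.Terminal B' x')
    (hx : A.Reach (fun _ _ => True) A.init x) (hy : A.ReachIn B x y) (hy' : A.ReachIn B' x' y) :
    B = B' := by
  have hm := maximal_of_mem hB
  have hm' := maximal_of_mem hB'
  have hiff : B ∈ F ↔ B' ∈ F := hm.prop.2.2.trans hm'.prop.2.2.symm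
  have hu := Terminal.union_mem_iff hF h h' hx hy hy' hm.prop.1 hm'.prop.1 hiff
  have hP : (B ∪ B').Nonempty ∧ B ∪ B' ⊆ X ∧ (B ∪ B' ∈ F ↔ X ∉ F) :=
    ⟨hm.prop.1.inl, Set.union_subset hm.prop.2.1 hm'.prop.2.1, hu.trans hm.prop.2.2⟩
  have e1 := hm.eq_of_subset hP Set.subset_union_left
  have e2 := hm'.eq_of_subset hP Set.subset_union_right
  rw [e1, ← e2]

/-! ### The children of a node of the Zielonka tree, found in the automaton -/

variable (A) in
/-- The transitions with a letter in `X` and a priority of at most `q`. -/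
def okUpTo (X : Set S) (q : ℕ) (x : Q) (a : S) : Prop := a ∈ X ∧ (A.δ x a).2 ≤ q

variable (A) in
/-- The letters of the strongly connected component of `x` in the graph of the transitions with a
letter in `X` and a priority of at most `q`. -/
def sccLetters (X : Set S) (q : ℕ) (x : Q) : Set S := Prod.snd '' A.sccEdges (A.okUpTo X q) x

/-- A component of the transitions of priority at most `q` that has a transition of priority `q`
gives a set of letters whose status is the parity of `q`. -/
theorem sccLetters_mem_iff [Finite Q] [Finite S] {F : Set (Set S)}
    (hF : A.language = mullerLanguage F) {X : Set S} {x : Q} {q : ℕ}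
    (hx : A.Reach (fun _ _ => True) A.init x)
    (hq : q ∈ A.prio '' A.sccEdges (A.okUpTo X q) x) : A.sccLetters X q x ∈ F ↔ Even q :=
  mem_iff_even_sccEdges hF hx ⟨hq, by rintro _ ⟨e, he, rfl⟩; exact he.1.2⟩

theorem sccLetters_subset (X : Set S) (q : ℕ) (x : Q) : A.sccLetters X q x ⊆ X := by
  rintro _ ⟨e, he, rfl⟩
  exact he.1.1

theorem sccLetters_nonempty {X : Set S} {x : Q} {q : ℕ}
    (hq : q ∈ A.prio '' A.sccEdges (A.okUpTo X q) x) : (A.sccLetters X q x).Nonempty := by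
  obtain ⟨e, he, -⟩ := hq
  exact ⟨e.2, e, he, rfl⟩

/-- Every maximal alternating subset of `X` is the set of letters of such a component inside the
terminal component of `x` for `X`. -/
theorem exists_sccLetters_eq [Finite Q] [Finite S] {F : Set (Set S)}
    (hF : A.language = mullerLanguage F) {X B : Set S} {x : Q} {p : ℕ}
    (hx : A.Reach (fun _ _ => True) A.init x) (ht : A.Terminal X x)
    (hp : IsGreatest (A.prio '' A.edgesIn X x) p) (hB : B ∈ maxAlternating F X) :
    ∃ y q, A.ReachIn X x y ∧ (Even q ↔ ¬ Even p) ∧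
      q ∈ A.prio '' A.sccEdges (A.okUpTo X q) y ∧ A.sccLetters X q y = B := by
  obtain ⟨y, hy, hty⟩ := A.exists_terminal B x
  obtain ⟨q, hq⟩ := A.exists_isGreatest (maximal_of_mem hB).prop.1 y
  have hyr := hx.trans hy.top
  have hBq := hty.mem_iff_even hF hyr hq
  have hXp := ht.mem_iff_even hF hx hp
  have hsub : A.edgesIn B y ⊆ A.sccEdges (A.okUpTo X q) y := by
    have hle : ∀ e ∈ A.edgesIn B y, A.prio e ≤ q := fun e he => hq.2 ⟨e, he, rfl⟩
    have hmono : ∀ {s t}, A.Reach (fun u a => (u, a) ∈ A.sccEdges (fun _ a => a ∈ B) y) s t →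
        A.Reach (A.okUpTo X q) s t := by
      intro s t h
      refine h.mono fun u a hu => ?_
      rw [hty.sccEdges_eq] at hu
      exact ⟨(maximal_of_mem hB).prop.2.1 hu.1, hle _ hu⟩
    intro e he
    refine ⟨⟨(maximal_of_mem hB).prop.2.1 he.1, hle e he⟩, hmono ?_, hmono ?_⟩
    · exact Reach.sccEdges (Reach.refl _) he.2 (hty _ he.2)
    · exact Reach.sccEdges (he.2.step he.1) (hty _ (he.2.step he.1)) (Reach.refl _)
  have hq' : q ∈ A.prio '' A.sccEdges (A.okUpTo X q) y := Set.image_mono hsub hq.1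
  refine ⟨y, q, hy.mono (maximal_of_mem hB).prop.2.1, ?_, hq', ?_⟩
  · rw [← hBq, ← hXp]; exact (maximal_of_mem hB).prop.2.2
  · refine ((maximal_of_mem hB).eq_of_subset
      ⟨sccLetters_nonempty hq', sccLetters_subset _ _ _, ?_⟩ ?_).symm
    · rw [sccLetters_mem_iff hF hyr hq', ← hBq]; exact (maximal_of_mem hB).prop.2.2
    · rw [← snd_image_edgesIn (A := A) B y]
      exact Set.image_mono hsub

theorem card_maxAlternating_le [Fintype Q] [Finite S] {F : Set (Set S)}
    (hF : A.language = mullerLanguage F) (X : Set S) :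
    (maxAlternating F X).ncard ≤ Fintype.card Q := by
  choose f hf hf' using fun B : Set S => A.exists_terminal B A.init
  rw [← Nat.card_eq_fintype_card, ← Set.ncard_univ]
  refine Set.ncard_le_ncard_of_injOn f (fun _ _ => Set.mem_univ _) ?_ (Set.toFinite _)
  intro B hB B' hB' he
  exact Terminal.eq_of_common_reach hF hB hB' (hf' B) (hf' B') (hf B).top (Reach.refl _)
    (by rw [he]; exact Reach.refl _)

end ParityAutomaton

/-! ### Trees given by a parent function -/

/-- `v` is the node `u` or one of its descendants, for the parent function `par`. -/
def Below (par : ℕ → ℕ) (v u : ℕ) : Prop := ∃ k, par^[k] v = u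

namespace Below

variable {par : ℕ → ℕ} {u v w : ℕ}

theorem refl (v : ℕ) : Below par v v := ⟨0, rfl⟩

theorem trans : Below par u v → Below par v w → Below par u w := by
  rintro ⟨k, rfl⟩ ⟨l, rfl⟩
  exact ⟨l + k, Function.iterate_add_apply _ _ _ _⟩

theorem parent (v : ℕ) : Below par v (par v) := ⟨1, rfl⟩

theorem total_of_below (h : Below par w u) (h' : Below par w v) :
    Below par u v ∨ Below par v u := by
  obtain ⟨k, rfl⟩ := h
  obtain ⟨l, rfl⟩ := h'
  rcases le_total k l with h | h
  · exact Or.inl ⟨l - k, by rw [← Function.iterate_add_apply, Nat.sub_add_cancel h]⟩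
  · exact Or.inr ⟨k - l, by rw [← Function.iterate_add_apply, Nat.sub_add_cancel h]⟩

end Below

variable {S : Type*}

/-- The nodes `0, …, N - 1`, with parents `par` and labels `lab`, form a tree with root `0` that is
an upper part of the Zielonka tree of `F`: the children of a node carry different maximal
alternating subsets of its label, perhaps not all of them. -/
structure IsUpperTree (F : Set (Set S)) (N : ℕ) (par : ℕ → ℕ) (lab : ℕ → Set S) : Prop where
  pos : 0 < N
  par_zero : par 0 = 0
  par_lt : ∀ w, 0 < w → w < N → par w < w
  root : lab 0 = Set.univ
  inj : ∀ v w, 0 < v → v < N → 0 < w → w < N → par v = par w → lab v = lab w → v = w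
  mem : ∀ w, 0 < w → w < N → lab w ∈ maxAlternating F (lab (par w))

/-- Every maximal alternating subset of the label of `v` is the label of a child of `v`. -/
def AllChildren (F : Set (Set S)) (N : ℕ) (par : ℕ → ℕ) (lab : ℕ → Set S) (v : ℕ) : Prop :=
  ∀ B ∈ maxAlternating F (lab v), ∃ w, 0 < w ∧ w < N ∧ par w = v ∧ lab w = B

namespace IsUpperTree

variable {F : Set (Set S)} {N : ℕ} {par : ℕ → ℕ} {lab : ℕ → Set S}

theorem par_le (h : IsUpperTree F N par lab) {w : ℕ} (hw : w < N) : par w ≤ w := by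
  rcases Nat.eq_zero_or_pos w with rfl | h0
  · exact h.par_zero.le
  · exact (h.par_lt w h0 hw).le

theorem lab_subset (h : IsUpperTree F N par lab) {w : ℕ} (hw : w < N) :
    lab w ⊆ lab (par w) := by
  rcases Nat.eq_zero_or_pos w with rfl | h0
  · rw [h.par_zero]
  · exact (maximal_of_mem (h.mem w h0 hw)).prop.2.1

theorem lab_nonempty (h : IsUpperTree F N par lab) [Nonempty S] {w : ℕ} (hw : w < N) :
    (lab w).Nonempty := by
  rcases Nat.eq_zero_or_pos w with rfl | h0
  · rw [h.root]; exact Set.univ_nonempty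
  · exact (maximal_of_mem (h.mem w h0 hw)).prop.1

theorem iterate_le (h : IsUpperTree F N par lab) {w : ℕ} (hw : w < N) (k : ℕ) :
    par^[k] w ≤ w := by
  induction k with
  | zero => exact le_rfl
  | succ k ih =>
    rw [Function.iterate_succ_apply']
    exact (h.par_le (ih.trans_lt hw)).trans ih

theorem le_of_below (h : IsUpperTree F N par lab) {u w : ℕ} (hw : w < N) (hb : Below par w u) :
    u ≤ w := by
  obtain ⟨k, rfl⟩ := hb
  exact h.iterate_le hw k

theorem lab_subset_of_below (h : IsUpperTree F N par lab) {u w : ℕ} (hw : w < N)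
    (hb : Below par w u) : lab w ⊆ lab u := by
  obtain ⟨k, rfl⟩ := hb
  induction k with
  | zero => exact subset_rfl
  | succ k ih =>
    rw [Function.iterate_succ_apply']
    exact ih.trans (h.lab_subset ((h.iterate_le hw k).trans_lt hw))

/-- A proper descendant of `u` is at or below a child of `u`. -/
theorem exists_child (h : IsUpperTree F N par lab) {u w : ℕ} (hw : w < N) (hb : Below par w u)
    (hne : w ≠ u) : ∃ y, 0 < y ∧ y < N ∧ Below par w y ∧ par y = u := by
  classical
  obtain ⟨k, hk, hmin⟩ : ∃ k, par^[k] w = u ∧ ∀ l < k, par^[l] w ≠ u :=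
    ⟨Nat.find hb, Nat.find_spec hb, fun l hl => Nat.find_min hb hl⟩
  cases k with
  | zero => exact absurd hk hne
  | succ k =>
    rw [Function.iterate_succ_apply'] at hk
    refine ⟨par^[k] w, ?_, (h.iterate_le hw k).trans_lt hw, ⟨k, rfl⟩, hk⟩
    rcases Nat.eq_zero_or_pos (par^[k] w) with h0 | h0
    · rw [h0, h.par_zero] at hk
      exact absurd (h0.trans hk) (hmin k (Nat.lt_succ_self k))
    · exact h0

/-- A node at or below two children of the same node determines the child. -/
theorem child_unique (h : IsUpperTree F N par lab) {w y y' : ℕ} (hw : w < N)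
    (hy0 : 0 < y) (hy0' : 0 < y') (hp : par y = par y')
    (h1 : Below par w y) (h2 : Below par w y') : y = y' := by
  have key : ∀ {y y' : ℕ}, 0 < y → 0 < y' → par y = par y' → y < N → Below par y y' → y = y' := by
    intro y y' hy0 hy0' hp hyN hb
    by_contra hne
    have hlt := h.le_of_below hyN hb
    obtain ⟨k, hk⟩ := hb
    cases k with
    | zero => exact hne hk
    | succ k =>
      rw [Function.iterate_succ_apply, hp] at hk
      have h3 := h.par_lt y' hy0' (hlt.trans_lt hyN)
      have h4 := h.iterate_le (h3.trans (hlt.trans_lt hyN)) k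
      omega
  have hyN := (h.le_of_below hw h1).trans_lt hw
  have hyN' := (h.le_of_below hw h2).trans_lt hw
  rcases h1.total_of_below h2 with hb | hb
  · exact key hy0 hy0' hp hyN hb
  · exact (key hy0' hy0 hp.symm hyN' hb).symm

end IsUpperTree

/-! ### Nested terminal components -/

open ParityAutomaton

variable {Q : Type*}

/-- Each node `v < i` of the tree is assigned a state `r v` that is terminal for the label of `v`,
in such a way that the terminal components are nested as the nodes are. -/
structure IsNested (A : ParityAutomaton Q S) (par : ℕ → ℕ) (lab : ℕ → Set S) (r : ℕ → Q)
    (i : ℕ) : Prop where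
  reach : ∀ v < i, A.Reach (fun _ _ => True) A.init (r v)
  terminal : ∀ v < i, A.Terminal (lab v) (r v)
  nested : ∀ v < i, 0 < v → A.ReachIn (lab (par v)) (r (par v)) (r v)

section Nested

variable {F : Set (Set S)} {N i : ℕ} {par : ℕ → ℕ} {lab : ℕ → Set S} {A : ParityAutomaton Q S}
  {r : ℕ → Q}

theorem IsNested.reachIn_of_below (h : IsUpperTree F N par lab) (hr : IsNested A par lab r i)
    (hi : i ≤ N) {u w : ℕ} (hw : w < i) (hb : Below par w u) : A.ReachIn (lab u) (r u) (r w) := by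
  obtain ⟨k, rfl⟩ := hb
  induction k with
  | zero => exact Reach.refl _
  | succ k ih =>
    have hlt : par^[k] w < i := (h.iterate_le (hw.trans_le hi) k).trans_lt hw
    rw [Function.iterate_succ_apply']
    rcases Nat.eq_zero_or_pos (par^[k] w) with h0 | h0
    · rw [h0] at ih ⊢
      rw [h.par_zero]; exact ih
    · exact (hr.nested _ hlt h0).trans (ih.mono (h.lab_subset (hlt.trans_le hi)))

/-- Two nodes whose components share a state are comparable. -/
theorem IsNested.below_or_below [Finite Q] [Finite S] (hF : A.language = mullerLanguage F)
    (h : IsUpperTree F N par lab) (hr : IsNested A par lab r i) (hi : i ≤ N) {x : Q} {u w : ℕ}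
    (hu : u < i) (hw : w < i) (hux : A.ReachIn (lab u) (r u) x)
    (hwx : A.ReachIn (lab w) (r w) x) : Below par u w ∨ Below par w u := by
  have key : ∀ m u w, u + w ≤ m → w < u → u < i → A.ReachIn (lab u) (r u) x →
      A.ReachIn (lab w) (r w) x → Below par u w ∨ Below par w u := by
    intro m
    induction m with
    | zero => intro u w h1 h2; omega
    | succ m ih =>
      intro u w hm hwu hu hux hwx
      have hu0 : 0 < u := by omega
      have hp := h.par_lt u hu0 (hu.trans_le hi)
      have hpx : A.ReachIn (lab (par u)) (r (par u)) x :=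
        (hr.nested u hu hu0).trans (hux.mono (h.lab_subset (hu.trans_le hi)))
      have h1 : Below par (par u) w ∨ Below par w (par u) := by
        rcases lt_trichotomy w (par u) with hlt | rfl | hlt
        · exact ih _ _ (by omega) hlt (hp.trans hu) hpx hwx
        · exact Or.inl (Below.refl _)
        · exact (ih _ _ (by omega) hlt (hwu.trans hu) hwx hpx).symm
      rcases h1 with h1 | h1
      · exact Or.inl ((Below.parent u).trans h1)
      · by_cases hne : w = par u
        · exact Or.inl (hne ▸ Below.parent u)
        · obtain ⟨y, hy0, hyN, hby, hpy⟩ := h.exists_child ((hwu.trans hu).trans_le hi) h1 hne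
          have hyi : y < i :=
            (h.le_of_below ((hwu.trans hu).trans_le hi) hby).trans_lt (hwu.trans hu)
          have hyx : A.ReachIn (lab y) (r y) x :=
            (hr.reachIn_of_below h hi (hwu.trans hu) hby).trans
              (hwx.mono (h.lab_subset_of_below ((hwu.trans hu).trans_le hi) hby))
          have hm1 := h.mem y hy0 hyN
          rw [hpy] at hm1
          have hlab := Terminal.eq_of_common_reach hF hm1 (h.mem u hu0 (hu.trans_le hi))
            (hr.terminal y hyi) (hr.terminal u hu) (hr.reach y hyi) hyx hux
          have := h.inj y u hy0 hyN hu0 (hu.trans_le hi) hpy hlab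
          exact Or.inr (this ▸ hby)
  rcases lt_trichotomy u w with hlt | rfl | hlt
  · exact (key _ w u le_rfl hlt hw hwx hux).symm
  · exact Or.inl (Below.refl _)
  · exact key _ u w le_rfl hlt hu hux hwx

/-- The greatest priority of the component strictly decreases from a node to a child: the parities
differ, and the component of the child is contained in that of the node. -/
theorem IsNested.top_lt [Finite Q] [Finite S] (hF : A.language = mullerLanguage F)
    (h : IsUpperTree F N par lab) (hr : IsNested A par lab r i) (hi : i ≤ N) {p : ℕ → ℕ}
    (hp : ∀ v < i, IsGreatest (A.prio '' A.edgesIn (lab v) (r v)) (p v)) {w : ℕ} (hw : w < i)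
    (hw0 : 0 < w) : p w < p (par w) := by
  have hpar := (h.par_lt w hw0 (hw.trans_le hi)).trans hw
  have hsub : A.edgesIn (lab w) (r w) ⊆ A.edgesIn (lab (par w)) (r (par w)) := fun e he =>
    ⟨h.lab_subset (hw.trans_le hi) he.1,
      (hr.nested w hw hw0).trans (he.2.mono (h.lab_subset (hw.trans_le hi)))⟩
  refine lt_of_le_of_ne ((hp _ hpar).2 (Set.image_mono hsub (hp w hw).1)) fun heq => ?_
  have h1 := (hr.terminal w hw).mem_iff_even hF (hr.reach w hw) (hp w hw)
  have h2 := (hr.terminal _ hpar).mem_iff_even hF (hr.reach _ hpar) (hp _ hpar)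
  have h3 := (maximal_of_mem (h.mem w hw0 (hw.trans_le hi))).prop.2.2
  rw [heq, ← h2] at h1
  tauto

theorem IsNested.top_lt_of_below [Finite Q] [Finite S] (hF : A.language = mullerLanguage F)
    (h : IsUpperTree F N par lab) (hr : IsNested A par lab r i) (hi : i ≤ N) {p : ℕ → ℕ}
    (hp : ∀ v < i, IsGreatest (A.prio '' A.edgesIn (lab v) (r v)) (p v)) {u w : ℕ} (hw : w < i)
    (hb : Below par w u) (hne : w ≠ u) : p w < p u := by
  have key : ∀ k, p (par^[k] w) = p w ∧ par^[k] w = w ∨ p w < p (par^[k] w) := by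
    intro k
    induction k with
    | zero => exact Or.inl ⟨rfl, rfl⟩
    | succ k ih =>
      have hlt : par^[k] w < i := (h.iterate_le (hw.trans_le hi) k).trans_lt hw
      rw [Function.iterate_succ_apply']
      rcases Nat.eq_zero_or_pos (par^[k] w) with h0 | h0
      · rw [h0] at ih ⊢
        rw [h.par_zero]; exact ih
      · have := hr.top_lt hF h hi hp hlt h0
        rcases ih with ih | ih
        · exact Or.inr (ih.1 ▸ this)
        · exact Or.inr (ih.trans this)
  obtain ⟨k, rfl⟩ := hb
  rcases key k with h1 | h1
  · exact absurd h1.2.symm hne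
  · exact h1

/-- Nodes with the same state have comparable components, hence different greatest priorities; so
there are at most as many nodes as pairs of a state and a priority. -/
theorem IsNested.le_card_mul [Fintype Q] [Fintype S] (hF : A.language = mullerLanguage F)
    (h : IsUpperTree F N par lab) (hr : IsNested A par lab r i) (hi : i ≤ N) {p : ℕ → ℕ}
    (hp : ∀ v < i, IsGreatest (A.prio '' A.edgesIn (lab v) (r v)) (p v)) :
    i ≤ Fintype.card Q * A.priorities.card := by
  classical
  rw [← Finset.card_univ, ← Finset.card_product, ← Finset.card_range i]
  refine Finset.card_le_card_of_injOn (fun v => (r v, p v)) ?_ ?_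
  · intro v hv
    have hv' : v < i := Finset.mem_range.1 (Finset.mem_coe.1 hv)
    obtain ⟨e, he, hep⟩ := (hp v hv').1
    refine Finset.mem_coe.2 (Finset.mem_product.2 ⟨Finset.mem_univ _, ?_⟩)
    exact Finset.mem_image.2 ⟨e, Finset.mem_univ _, hep⟩
  · intro u hu w hw he
    have hu' : u < i := Finset.mem_range.1 (Finset.mem_coe.1 hu)
    have hw' : w < i := Finset.mem_range.1 (Finset.mem_coe.1 hw)
    simp only [Prod.mk.injEq] at he
    by_contra hne
    rcases hr.below_or_below hF h hi hu' hw' (x := r u) (Reach.refl _)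
      (by rw [he.1]; exact Reach.refl _) with hb | hb
    · exact absurd he.2 (hr.top_lt_of_below hF h hi hp hu' hb hne).ne
    · exact absurd he.2 (hr.top_lt_of_below hF h hi hp hw' hb (Ne.symm hne)).ne'

theorem exists_isNested [Finite Q] (A : ParityAutomaton Q S) (h : IsUpperTree F N par lab) :
    ∃ r, IsNested A par lab r N := by
  suffices hs : ∀ i ≤ N, ∃ r, IsNested A par lab r i from hs N le_rfl
  intro i
  induction i with
  | zero =>
    exact fun _ => ⟨fun _ => A.init, by simp, by simp, by simp⟩
  | succ i ih =>
    intro hi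
    obtain ⟨r, hr⟩ := ih (by omega)
    let x := if i = 0 then A.init else r (par i)
    obtain ⟨y, hy, hty⟩ := A.exists_terminal (lab i) x
    have hne : ∀ v < i, Function.update r i y v = r v := fun v hv =>
      Function.update_of_ne hv.ne _ _
    have heq : Function.update r i y i = y := Function.update_self _ _ _
    have hpar : 0 < i → par i < i := fun h0 => h.par_lt i h0 (by omega)
    refine ⟨Function.update r i y, fun v hv => ?_, fun v hv => ?_, fun v hv h0 => ?_⟩ <;>
      rcases Nat.lt_succ_iff_lt_or_eq.1 hv with hv | rfl
    · rw [hne v hv]; exact hr.reach v hv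
    · rw [heq]
      refine Reach.trans ?_ hy.top
      rcases Nat.eq_zero_or_pos v with h0 | h0
      · simp only [x, h0, if_true]; exact Reach.refl _
      · simp only [x, h0.ne', if_false]; exact hr.reach _ (hpar h0)
    · rw [hne v hv]; exact hr.terminal v hv
    · rw [heq]; exact hty
    · rw [hne v hv, hne _ ((h.par_lt v h0 (by omega)).trans hv)]; exact hr.nested v hv h0
    · rw [heq, hne _ (hpar h0)]
      simp only [x, h0.ne', if_false] at hy
      exact hy.mono (h.lab_subset (by omega))

/-- `v` is a node without children. -/
def IsLeaf (N : ℕ) (par : ℕ → ℕ) (v : ℕ) : Prop := v < N ∧ ∀ w, 0 < w → w < N → par w ≠ v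

/-- A parity automaton for `L_F` has at least as many states as the Zielonka tree has leaves: the
terminal components of different leaves are disjoint. -/
theorem card_leaves_le [Fintype Q] [Finite S] (hF : A.language = mullerLanguage F)
    (h : IsUpperTree F N par lab) : {v | IsLeaf N par v}.ncard ≤ Fintype.card Q := by
  obtain ⟨r, hr⟩ := exists_isNested A h
  rw [← Nat.card_eq_fintype_card, ← Set.ncard_univ]
  refine Set.ncard_le_ncard_of_injOn r (fun _ _ => Set.mem_univ _) ?_ (Set.toFinite _)
  intro u hu w hw he
  have key : ∀ u w, IsLeaf N par u → IsLeaf N par w → Below par u w → u = w := by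
    intro u w hu hw hb
    by_contra hne
    obtain ⟨y, hy0, hyN, -, hpy⟩ := h.exists_child hu.1 hb hne
    exact hw.2 y hy0 hyN hpy
  rcases hr.below_or_below hF h le_rfl hu.1 hw.1 (x := r u) (Reach.refl _)
    (by rw [he]; exact Reach.refl _) with hb | hb
  · exact key _ _ hu hw hb
  · exact (key _ _ hw hu hb).symm

end Nested

/-! ### The automaton of the Zielonka tree -/

/-- The relation between a transition of the automaton of a Zielonka tree and the tree: from the
leaf `l`, under the letter `a`, to the leaf `l'` with priority `q`. The support of the transition is
the lowest node `u` above `l` whose label contains `a`. If `u` is not `l`, then `l'` is below the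
child `next x` of `u`, where `x` is the child of `u` above `l`. -/
def TreeStep (N : ℕ) (par : ℕ → ℕ) (lab : ℕ → Set S) (p next : ℕ → ℕ) (l : ℕ) (a : S) (l' q : ℕ) :
    Prop :=
  ∃ u, Below par l u ∧ a ∈ lab u ∧ (∀ v, Below par l v → a ∈ lab v → Below par u v) ∧ q = p u ∧
    ((l = u ∧ l' = l) ∨ ∃ x, 0 < x ∧ x < N ∧ par x = u ∧ Below par l x ∧
      0 < next x ∧ next x < N ∧ par (next x) = u ∧ Below par l' (next x))

section TreeAutomaton

variable {F : Set (Set S)} {N : ℕ} {par : ℕ → ℕ} {lab : ℕ → Set S} {p next : ℕ → ℕ}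
  {B : ParityAutomaton Q S} {leaf : Q → ℕ}

/-- An automaton whose states stand for the leaves of the Zielonka tree and whose transitions
follow `TreeStep` recognises the Muller language. The topmost support that occurs infinitely often
decides: its label contains the letters that occur infinitely often, and no child has this property
because all children are visited in turn. -/
theorem language_eq_of_treeStep [Finite S] (h : IsUpperTree F N par lab)
    (hall : ∀ v < N, AllChildren F N par lab v)
    (hp : ∀ v < N, (Even (p v) ↔ lab v ∈ F)) (hlt : ∀ w, 0 < w → w < N → p w < p (par w))
    (hcyc : ∀ x z, 0 < x → x < N → 0 < z → z < N → par x = par z → ∃ k, next^[k] x = z)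
    (hleaf : ∀ q, IsLeaf N par (leaf q))
    (hstep : ∀ q a, TreeStep N par lab p next (leaf q) a (leaf (B.δ q a).1) (B.δ q a).2) :
    B.language = mullerLanguage F := by
  ext w
  let ℓ : ℕ → ℕ := fun i => leaf (B.runState w i)
  have hℓ : ∀ i, ℓ i < N := fun i => (hleaf _).1
  choose u hu1 hu2 hu3 hu4 hu5 using fun i => hstep (B.runState w i) (w i)
  have hu1 : ∀ i, Below par (ℓ i) (u i) := hu1
  have hout : B.output w = fun i => p (u i) := funext hu4
  have hnext : ∀ i, leaf (B.δ (B.runState w i) (w i)).1 = ℓ (i + 1) := fun i => rfl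
  have huN : ∀ i, u i < N := fun i => (h.le_of_below (hℓ i) (hu1 i)).trans_lt (hℓ i)
  have hfin : Finite (Set.Iio N) := Set.finite_Iio N
  -- the topmost of the supports that occur infinitely often is the least one
  let u' : ℕ → Set.Iio N := fun i => ⟨u i, huN i⟩
  obtain ⟨v, hvU, hvmin⟩ := Set.exists_min_image (infSet u') (fun x => (x : ℕ)) (Set.toFinite _)
    (infSet_nonempty u')
  have hvf : ∃ᶠ i in atTop, u i = v := hvU.mono fun i hi => congrArg Subtype.val hi
  have hvN : (v : ℕ) < N := v.2
  obtain ⟨i₀, hi₀⟩ := eventually_atTop.1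
    ((eventually_mem_infSet u').and (eventually_mem_infSet w))
  obtain ⟨i₁, hi₁, huv⟩ := frequently_atTop.1 hvf i₀
  have hsucc : ∀ i, Below par (ℓ (i + 1)) (u i) := by
    intro i
    rcases hu5 i with ⟨h1, h2⟩ | ⟨x, -, -, -, -, -, -, h5, h6⟩
    · rw [hnext] at h2
      rw [h2]; exact hu1 i
    · rw [hnext] at h6
      rw [← h5]; exact h6.trans (Below.parent _)
  -- from `i₁` on, the run stays below `v`
  have hunder : ∀ i, i₁ ≤ i → Below par (ℓ i) v ∧ Below par (u i) v := by
    have hu_of : ∀ i, i₁ ≤ i → Below par (ℓ i) v → Below par (u i) v := by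
      intro i hi hb
      rcases (hu1 i).total_of_below hb with h1 | h1
      · exact h1
      · have h2 := hvmin _ (hi₀ i (hi₁.trans hi)).1
        have h3 := h.le_of_below hvN h1
        have h4 : u i = v := le_antisymm h3 h2
        rw [h4]; exact Below.refl _
    intro i hi
    induction i, hi using Nat.le_induction with
    | base => exact ⟨huv ▸ hu1 i₁, by rw [huv]; exact Below.refl _⟩
    | succ i hi ih =>
      have h1 := (hsucc i).trans ih.2
      exact ⟨h1, hu_of _ (by omega) h1⟩
  have hpmono : ∀ k x, x < N → p x ≤ p (par^[k] x) := by
    intro k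
    induction k with
    | zero => exact fun x _ => le_rfl
    | succ k ih =>
      intro x hx
      rw [Function.iterate_succ_apply]
      rcases Nat.eq_zero_or_pos x with rfl | h0
      · rw [h.par_zero]; exact ih 0 hx
      · exact (hlt x h0 hx).le.trans (ih _ ((h.par_lt x h0 hx).trans hx))
  have hgr : IsGreatest (infSet (B.output w)) (p v) := by
    rw [hout]
    refine ⟨hvf.mono fun i hi => congrArg p hi, ?_⟩
    intro q hq
    obtain ⟨i, hi, hiq⟩ := frequently_atTop.1 hq i₁
    obtain ⟨k, hk⟩ := (hunder i hi).2
    rw [← hiq, ← hk]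
    exact hpmono k _ (huN i)
  have hlang : w ∈ B.language ↔ lab v ∈ F := by
    rw [← hp v hvN]
    constructor
    · rintro ⟨q, hq, he⟩
      rwa [hgr.unique hq]
    · exact fun he => ⟨_, hgr, he⟩
  rw [hlang]
  change lab v ∈ F ↔ infSet w ∈ F
  have hsub : infSet w ⊆ lab v := by
    intro a ha
    obtain ⟨i, hi, rfl⟩ := frequently_atTop.1 ha i₁
    exact h.lab_subset_of_below (huN i) (hunder i hi).2 (hu2 i)
  by_contra hcon
  have halt : (infSet w).Nonempty ∧ infSet w ⊆ lab v ∧ (infSet w ∈ F ↔ lab v ∉ F) :=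
    ⟨infSet_nonempty w, hsub, by tauto⟩
  obtain ⟨X, hX, hXmax⟩ := Finite.exists_le_maximal
    (p := fun Y : Set S => Y.Nonempty ∧ Y ⊆ lab v ∧ (Y ∈ F ↔ lab v ∉ F)) halt
  obtain ⟨z, hz0, hzN, hzv, hzX⟩ := hall v hvN X hXmax
  -- the run cannot enter the subtree of `z` after `i₁`, as it would stay there for ever
  have hnever : ∀ i, i₁ ≤ i → ¬ Below par (ℓ i) z := by
    intro i hi hb
    have hfor : ∀ j, i ≤ j → Below par (ℓ j) z ∧ Below par (u j) z := by
      have hu_of : ∀ j, i ≤ j → Below par (ℓ j) z → Below par (u j) z := fun j hj hb =>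
        hu3 j z hb (hzX ▸ hX (hi₀ j (by omega)).2)
      intro j hj
      induction j, hj using Nat.le_induction with
      | base => exact ⟨hb, hu_of i le_rfl hb⟩
      | succ j hj ih =>
        have h1 := (hsucc j).trans ih.2
        exact ⟨h1, hu_of _ (by omega) h1⟩
    obtain ⟨j, hj, hjv⟩ := frequently_atTop.1 hvf i
    have h1 := h.le_of_below (huN j) (hfor j hj).2
    have h2 := h.par_lt z hz0 hzN
    omega
  -- but the children of `v` are entered in turn
  have hturn : ∀ k x i, 0 < x → x < N → par x = v → next^[k] x = z → i₁ ≤ i →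
      ¬ Below par (ℓ i) x := by
    intro k
    induction k with
    | zero => rintro x i - - - rfl hi; exact hnever i hi
    | succ k ih =>
      intro x i hx0 hxN hxv hk hi hb
      rw [Function.iterate_succ_apply] at hk
      have hall' : ∀ j, i ≤ j → Below par (ℓ j) x := by
        intro j hj
        induction j, hj using Nat.le_induction with
        | base => exact hb
        | succ j hj ihj =>
          by_cases hjv : u j = v
          · exfalso
            rcases hu5 j with ⟨h1, h2⟩ | ⟨x', h1, h2, h3, h4, h5, h6, h7, h8⟩
            · exact (hleaf (B.runState w j)).2 x hx0 hxN (by rw [h1, hjv, hxv])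
            · have : x' = x := h.child_unique (hℓ j) h1 hx0 (by rw [h3, hjv, hxv]) h4 ihj
              subst this
              exact ih (next x') (j + 1) h5 h6 (by rw [h7, hjv]) hk (by omega) h8
          · obtain ⟨y, hy0, hyN, hby, hpy⟩ := h.exists_child (huN j) (hunder j (by omega)).2 hjv
            have : y = x :=
              h.child_unique (hℓ j) hy0 hx0 (by rw [hpy, hxv]) ((hu1 j).trans hby) ihj
            subst this
            exact (hsucc j).trans hby
      obtain ⟨j, hj, hjv⟩ := frequently_atTop.1 hvf i
      rcases hu5 j with ⟨h1, h2⟩ | ⟨x', h1, h2, h3, h4, h5, h6, h7, h8⟩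
      · exact (hleaf (B.runState w j)).2 x hx0 hxN (by rw [h1, hjv, hxv])
      · have : x' = x := h.child_unique (hℓ j) h1 hx0 (by rw [h3, hjv, hxv]) h4 (hall' j hj)
        subst this
        exact ih (next x') (j + 1) h5 h6 (by rw [h7, hjv]) hk (by omega) h8
  have hne : ℓ i₁ ≠ v := fun he =>
    (hleaf (B.runState w i₁)).2 z hz0 hzN (by rw [hzv]; exact he.symm)
  obtain ⟨y, hy0, hyN, hby, hpy⟩ := h.exists_child (hℓ i₁) (hunder i₁ le_rfl).1 hne
  obtain ⟨k, hk⟩ := hcyc y z hy0 hyN hz0 hzN (by rw [hpy, hzv])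
  exact hturn k y i₁ hy0 hyN hpy hk le_rfl hby

end TreeAutomaton

/-! ### From the parent function to the labelled tree -/

theorem exists_holdsSubtree {c N : ℕ} {F : Set (Set (Fin c))} {s : Store}
    {lab : ℕ → Set (Fin c)} (h : IsUpperTree F N (s.arr 2) lab)
    (hall : ∀ v < N, AllChildren F N (s.arr 2) lab v)
    (hlab : ∀ v < N, ∀ a : Fin c, s.arr 3 (v * c + a) = (lab v).indicator (fun _ => 1) a)
    {v : ℕ} (hv : v < N) :
    ∃ T : LabelledTree (Fin c), T.label = lab v ∧ T.Alternates F ∧ HoldsSubtree s N v T := by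
  suffices hs : ∀ m v, v < N → N ≤ v + m → ∃ T : LabelledTree (Fin c),
      T.label = lab v ∧ T.Alternates F ∧ HoldsSubtree s N v T from hs N v hv (by omega)
  intro m
  induction m with
  | zero => intro v h1 h2; omega
  | succ m ih =>
    intro v hv hm
    have hfin : {w | 0 < w ∧ w < N ∧ s.arr 2 w = v}.Finite :=
      (Set.finite_Iio N).subset fun w hw => hw.2.1
    have : Finite {w | 0 < w ∧ w < N ∧ s.arr 2 w = v} := hfin
    obtain ⟨k, ⟨e⟩⟩ := Finite.exists_equiv_fin {w | 0 < w ∧ w < N ∧ s.arr 2 w = v}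
    have hw : ∀ i : Fin k, 0 < (e.symm i : ℕ) ∧ (e.symm i : ℕ) < N ∧ s.arr 2 (e.symm i) = v :=
      fun i => (e.symm i).2
    have hT : ∀ i : Fin k, ∃ T : LabelledTree (Fin c),
        T.label = lab (e.symm i) ∧ T.Alternates F ∧ HoldsSubtree s N (e.symm i) T := by
      intro i
      have h1 := h.par_lt _ (hw i).1 (hw i).2.1
      rw [(hw i).2.2] at h1
      exact ih _ (hw i).2.1 (by omega)
    choose T hT1 hT2 hT3 using hT
    refine ⟨.node (lab v) k T, rfl, ⟨?_, ?_, hT2⟩, ?_, ?_⟩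
    · intro i j hij
      simp only [hT1] at hij
      have := h.inj _ _ (hw i).1 (hw i).2.1 (hw j).1 (hw j).2.1
        ((hw i).2.2.trans (hw j).2.2.symm) hij
      exact e.symm.injective (Subtype.ext this)
    · ext X
      simp only [Set.mem_range, hT1]
      constructor
      · rintro ⟨i, rfl⟩
        have := h.mem _ (hw i).1 (hw i).2.1
        rwa [(hw i).2.2] at this
      · intro hX
        obtain ⟨w, h1, h2, h3, h4⟩ := hall v hv X hX
        exact ⟨e ⟨w, h1, h2, h3⟩, by simpa using h4⟩
    · exact hlab v hv
    · refine ⟨fun i => e.symm i, fun i j hij => e.symm.injective (Subtype.ext hij), ?_, hT3⟩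
      ext w
      constructor
      · rintro ⟨i, rfl⟩
        exact hw i
      · exact fun hw' => ⟨e ⟨w, hw'⟩, by simp⟩

theorem exists_isZielonkaTree {c : ℕ} {F : Set (Set (Fin c))} {s : Store}
    {lab : ℕ → Set (Fin c)} (h : IsUpperTree F (s.var 3) (s.arr 2) lab)
    (hall : ∀ v < s.var 3, AllChildren F (s.var 3) (s.arr 2) lab v)
    (hlab : ∀ v < s.var 3, ∀ a : Fin c,
      s.arr 3 (v * c + a) = (lab v).indicator (fun _ => 1) a) :
    ∃ T : LabelledTree (Fin c), IsZielonkaTree F T ∧ HoldsTree s T := by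
  obtain ⟨T, hT1, hT2, hT3⟩ := exists_holdsSubtree h hall hlab h.pos
  exact ⟨T, ⟨hT1.trans h.root, hT2⟩, h.pos, h.par_lt, hT3⟩

/-! ### A calculus for the random access machine -/

/-- Assignment to a register. -/
def Store.setVar (s : Store) (x k : ℕ) : Store := ⟨Function.update s.var x k, s.arr⟩

/-- Assignment to an array cell. -/
def Store.setArr (s : Store) (a i k : ℕ) : Store :=
  ⟨s.var, Function.update s.arr a (Function.update (s.arr a) i k)⟩

namespace Store

theorem setVar_var (s : Store) (x k y : ℕ) :
    (s.setVar x k).var y = if y = x then k else s.var y := by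
  simp [setVar, Function.update_apply]

theorem setVar_arr (s : Store) (x k : ℕ) : (s.setVar x k).arr = s.arr := rfl

theorem setArr_var (s : Store) (a i k : ℕ) : (s.setArr a i k).var = s.var := rfl

theorem setArr_arr (s : Store) (a i k b j : ℕ) :
    (s.setArr a i k).arr b j = if b = a ∧ j = i then k else s.arr b j := by
  by_cases hb : b = a
  · subst hb
    simp [setArr, Function.update_apply]
  · simp [setArr, hb]

theorem setArr_arr_of_ne (s : Store) {a b : ℕ} (i k : ℕ) (h : b ≠ a) :
    (s.setArr a i k).arr b = s.arr b := by
  simp [setArr, h]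

end Store

/-- Started on `s`, the program `P` halts, and its running time and final memory satisfy `R`. -/
def wp (P : Prog) (s : Store) (R : ℕ → Store → Prop) : Prop := ∃ t s', Exec P s t s' ∧ R t s'

section wp

variable {P P' : Prog} {s : Store} {R R' : ℕ → Store → Prop} {e f : Expr}

theorem wp_mono (h : wp P s R) (h' : ∀ t s', R t s' → R' t s') : wp P s R' := by
  obtain ⟨t, s', he, hr⟩ := h
  exact ⟨t, s', he, h' t s' hr⟩

theorem wp_skip : wp .skip s R ↔ R 1 s := by
  constructor
  · rintro ⟨t, s', ⟨⟩, h⟩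
    exact h
  · exact fun h => ⟨_, _, .skip s, h⟩

theorem wp_assign {x : ℕ} : wp (.assign x e) s R ↔ R (e.cost + 1) (s.setVar x (e.eval s)) := by
  constructor
  · rintro ⟨t, s', ⟨⟩, h⟩
    exact h
  · exact fun h => ⟨_, _, .assign s x e, h⟩

theorem wp_write {a : ℕ} :
    wp (.write a e f) s R ↔ R (e.cost + f.cost + 1) (s.setArr a (e.eval s) (f.eval s)) := by
  constructor
  · rintro ⟨t, s', ⟨⟩, h⟩
    exact h
  · exact fun h => ⟨_, _, .write s a e f, h⟩

theorem wp_seq :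
    wp (.seq P P') s R ↔ wp P s fun t s' => wp P' s' fun t' s'' => R (t + t') s'' := by
  constructor
  · rintro ⟨t, s', he, h⟩
    cases he with
    | seq h1 h2 => exact ⟨_, _, h1, _, _, h2, h⟩
  · rintro ⟨t, s', h1, t', s'', h2, h⟩
    exact ⟨_, _, .seq h1 h2, h⟩

theorem wp_ite :
    wp (.ite e P P') s R ↔
      (e.eval s ≠ 0 → wp P s fun t s' => R (e.cost + 1 + t) s') ∧
      (e.eval s = 0 → wp P' s fun t s' => R (e.cost + 1 + t) s') := by
  constructor
  · rintro ⟨t, s', he, h⟩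
    cases he with
    | ite_true h0 h1 => exact ⟨fun _ => ⟨_, _, h1, h⟩, fun h2 => absurd h2 h0⟩
    | ite_false h0 h1 => exact ⟨fun h2 => absurd h0 h2, fun _ => ⟨_, _, h1, h⟩⟩
  · rintro ⟨h1, h2⟩
    by_cases h0 : e.eval s = 0
    · obtain ⟨t, s', he, h⟩ := h2 h0
      exact ⟨_, _, .ite_false h0 he, h⟩
    · obtain ⟨t, s', he, h⟩ := h1 h0
      exact ⟨_, _, .ite_true h0 he, h⟩

/-- A loop whose `i`-th round is entered under the invariant `I i`, which bounds `i`. -/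
theorem wp_while {I : ℕ → Store → Prop} (B T : ℕ) (h0 : I 0 s) (hB : ∀ i s, I i s → i ≤ B)
    (hstep : ∀ i s, I i s → e.eval s ≠ 0 → wp P s fun t s' => t ≤ T ∧ I (i + 1) s')
    (hpost : ∀ i s t, I i s → e.eval s = 0 → t ≤ i * (T + e.cost + 1) + e.cost + 1 → R t s) :
    wp (.while e P) s R := by
  have key : ∀ m i s, I i s → B < i + m →
      ∃ t s' j, Exec (.while e P) s t s' ∧ I j s' ∧ e.eval s' = 0 ∧
        t + i * (T + e.cost + 1) ≤ j * (T + e.cost + 1) + e.cost + 1 := by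
    intro m
    induction m with
    | zero => intro i s hi hm; exact absurd (hB i s hi) (by omega)
    | succ m ih =>
      intro i s hi hm
      by_cases hz : e.eval s = 0
      · exact ⟨_, _, i, .while_false hz, hi, hz, by omega⟩
      · obtain ⟨t, s', he, ht, hi'⟩ := hstep i s hi hz
        obtain ⟨t', s'', j, he', hj, hz', ht'⟩ := ih (i + 1) s' hi' (by omega)
        refine ⟨_, _, j, .while_true hz he he', hj, hz', ?_⟩
        rw [Nat.add_mul, Nat.one_mul] at ht'
        omega
  obtain ⟨t, s', j, he, hj, hz, ht⟩ := key (B + 1) 0 s h0 (by omega)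
  exact ⟨t, s', he, hpost j s' t hj hz (by omega)⟩

end wp

/-- The registers that a program may change. -/
def Prog.vars : Prog → List ℕ
  | skip => []
  | assign x _ => [x]
  | write _ _ _ => []
  | seq P R => P.vars ++ R.vars
  | ite _ P R => P.vars ++ R.vars
  | .while _ P => P.vars

/-- The arrays that a program may change. -/
def Prog.arrs : Prog → List ℕ
  | skip => []
  | assign _ _ => []
  | write a _ _ => [a]
  | seq P R => P.arrs ++ R.arrs
  | ite _ P R => P.arrs ++ R.arrs
  | .while _ P => P.arrs

/-- The memories `s` and `s'` agree, except perhaps on the registers `V` and on the arrays `U`. -/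
structure Agree (V U : List ℕ) (s s' : Store) : Prop where
  var : ∀ x, x ∉ V → s'.var x = s.var x
  arr : ∀ a, a ∉ U → s'.arr a = s.arr a

theorem Agree.refl (V U : List ℕ) (s : Store) : Agree V U s s := ⟨fun _ _ => rfl, fun _ _ => rfl⟩

theorem Agree.trans {V U : List ℕ} {s s' s'' : Store} (h : Agree V U s s')
    (h' : Agree V U s' s'') : Agree V U s s'' :=
  ⟨fun x hx => (h'.var x hx).trans (h.var x hx), fun a ha => (h'.arr a ha).trans (h.arr a ha)⟩

theorem Agree.mono {V U V' U' : List ℕ} {s s' : Store} (h : Agree V U s s') (hV : V ⊆ V')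
    (hU : U ⊆ U') : Agree V' U' s s' :=
  ⟨fun x hx => h.var x fun hx' => hx (hV hx'), fun a ha => h.arr a fun ha' => ha (hU ha')⟩

theorem Agree.setVar {V U : List ℕ} {s s' : Store} (h : Agree V U s s') {x : ℕ} (hx : x ∈ V)
    (k : ℕ) : Agree V U s (s'.setVar x k) := by
  refine ⟨fun y hy => ?_, h.arr⟩
  rw [Store.setVar_var, if_neg (by rintro rfl; exact hy hx), h.var y hy]

theorem Exec.agree {P : Prog} {s s' : Store} {t : ℕ} (h : Exec P s t s') :
    Agree P.vars P.arrs s s' := by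
  induction h with
  | skip s => exact .refl _ _ _
  | assign s x e =>
    exact ⟨fun y hy => Function.update_of_ne (by simpa [Prog.vars] using hy) _ _, fun _ _ => rfl⟩
  | write s a e f =>
    exact ⟨fun _ _ => rfl, fun b hb => Function.update_of_ne (by simpa [Prog.arrs] using hb) _ _⟩
  | seq _ _ ih ih' =>
    exact (ih.mono (List.subset_append_left _ _) (List.subset_append_left _ _)).trans
      (ih'.mono (List.subset_append_right _ _) (List.subset_append_right _ _))
  | ite_true _ _ ih =>
    exact ih.mono (List.subset_append_left _ _) (List.subset_append_left _ _)
  | ite_false _ _ ih =>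
    exact ih.mono (List.subset_append_right _ _) (List.subset_append_right _ _)
  | while_true _ _ _ ih ih' => exact ih.trans ih'
  | while_false _ => exact .refl _ _ _

theorem wp_agree {P : Prog} {s : Store} {R : ℕ → Store → Prop} (h : wp P s R) :
    wp P s fun t s' => R t s' ∧ Agree P.vars P.arrs s s' := by
  obtain ⟨t, s', he, hr⟩ := h
  exact ⟨t, s', he, hr, he.agree⟩

/-- The loop in which the register `x` runs through the numbers below the value of the
register `y`. -/
def Prog.for (x y : ℕ) (P : Prog) : Prog :=
  .seq (.assign x (.const 0))
    (.while (.sub (.var y) (.var x)) (.seq P (.assign x (.add (.var x) (.const 1)))))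

theorem wp_for {x y m : ℕ} {P : Prog} {s : Store} {R : ℕ → Store → Prop} (T : ℕ)
    (I : ℕ → Store → Prop) (hx : x ∉ P.vars) (hy : y ∉ x :: P.vars) (hm : s.var y = m)
    (h0 : I 0 (s.setVar x 0))
    (hstep : ∀ i s', i < m → s'.var x = i → Agree (x :: P.vars) P.arrs s s' → I i s' →
      wp P s' fun t s'' => t ≤ T ∧ I (i + 1) (s''.setVar x (i + 1)))
    (hpost : ∀ t s', t ≤ m * (T + 8) + 6 → Agree (x :: P.vars) P.arrs s s' → I m s' → R t s') :
    wp (Prog.for x y P) s R := by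
  have hxy : y ≠ x := by rintro rfl; simp at hy
  rw [Prog.for, wp_seq, wp_assign]
  refine wp_while (I := fun i s' => i ≤ m ∧ s'.var x = i ∧ Agree (x :: P.vars) P.arrs s s' ∧ I i s')
    m (T + 4) ?_ (fun i s' h => h.1) ?_ ?_
  · exact ⟨Nat.zero_le _, by simp [Store.setVar_var, Expr.eval],
      (Agree.refl _ _ _).setVar (by simp) _, h0⟩
  · rintro i s' ⟨hi, hxi, hag, hI⟩ hne
    simp only [Expr.eval, hxi, hag.var y hy, hm] at hne
    rw [wp_seq]
    refine wp_mono (wp_agree (hstep i s' (by omega) hxi hag hI)) ?_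
    rintro t s'' ⟨⟨ht, hI'⟩, hag'⟩
    rw [wp_assign]
    have hx' : s''.var x = i := by rw [hag'.var x hx, hxi]
    simp only [Expr.eval, Expr.cost, hx']
    refine ⟨by omega, by omega, by simp [Store.setVar_var], ?_, hI'⟩
    exact (hag.trans (hag'.mono (by simp) (by simp))).setVar (by simp) _
  · rintro i s' t ⟨hi, hxi, hag, hI⟩ hz ht
    simp only [Expr.eval, hxi, hag.var y hy, hm] at hz
    have : i = m := by omega
    subst this
    simp only [Expr.cost] at ht ⊢
    refine hpost _ _ ?_ hag hI
    have : T + 4 + (1 + 1 + 1) + 1 = T + 8 := by omega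
    rw [this] at ht
    omega

/-! ### The preprocessed automaton in memory -/

/-- `P`, executed if the value of `e` is not `0`. -/
def Prog.when (e : Expr) (P : Prog) : Prog := .ite e P .skip

theorem wp_when {e : Expr} {P : Prog} {s : Store} {R : ℕ → Store → Prop} :
    wp (.when e P) s R ↔
      (e.eval s ≠ 0 → wp P s fun t s' => R (e.cost + 1 + t) s') ∧
      (e.eval s = 0 → R (e.cost + 1 + 1) s) := by
  rw [Prog.when, wp_ite]
  simp only [wp_skip]

infixr:65 " ;; " => Prog.seq

/-- An expression whose value is `0` if and only if those of `e` and `f` are equal. -/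
def Expr.dist (e f : Expr) : Expr := .add (.sub e f) (.sub f e)

theorem Expr.eval_dist (e f : Expr) (s : Store) : (dist e f).eval s = 0 ↔ e.eval s = f.eval s := by
  simp only [dist, eval]
  omega

theorem Expr.cost_dist (e f : Expr) : (dist e f).cost = 2 * e.cost + 2 * f.cost + 3 := by
  simp only [dist, cost]
  omega

/-- The parity of the value of `e`. -/
def Expr.parity (e : Expr) : Expr := .sub e (.add (.half e) (.half e))

theorem Expr.eval_parity (e : Expr) (s : Store) : (parity e).eval s = 0 ↔ Even (e.eval s) := by
  simp only [parity, eval, Nat.even_iff]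
  omega

theorem Expr.cost_parity (e : Expr) : (parity e).cost = 3 * e.cost + 4 := by
  simp only [parity, cost]
  omega

/-! The registers: number of states, letters, tree nodes, transitions and priorities; the initial
state; the current node `v`, with `v * c`; `N * c` for the number `N` of nodes. -/

notation "vStates" => (0 : ℕ)
notation "vLetters" => (1 : ℕ)
notation "vInit" => (2 : ℕ)
notation "vNodes" => (3 : ℕ)
notation "vEdges" => (4 : ℕ)
notation "vPrios" => (5 : ℕ)
notation "vNode" => (6 : ℕ)
notation "vRow" => (7 : ℕ)
notation "vNewRow" => (8 : ℕ)

/-! Loop counters for states, letters, transitions, priorities, rounds, sizes and children. -/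

notation "xQ" => (9 : ℕ)
notation "xA" => (10 : ℕ)
notation "xE" => (11 : ℕ)
notation "xJ" => (12 : ℕ)
notation "xI" => (13 : ℕ)
notation "xS" => (14 : ℕ)
notation "xY" => (15 : ℕ)
notation "xK" => (16 : ℕ)
notation "xT" => (17 : ℕ)

/-! Auxiliary registers: flags, the start of a search, the priority of the current node and the
priority under consideration, a size, the first child of the current node with its row, the number
of its children, and the row of the child under consideration. -/

notation "vFlag" => (18 : ℕ)
notation "vFlagAux" => (19 : ℕ)
notation "vStart" => (20 : ℕ)
notation "vTop" => (21 : ℕ)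
notation "vPrio" => (22 : ℕ)
notation "vSize" => (23 : ℕ)
notation "vChild" => (24 : ℕ)
notation "vChildRow" => (25 : ℕ)
notation "vCount" => (26 : ℕ)
notation "vTestRow" => (27 : ℕ)

/-! The arrays: target and priority, source and letter of each transition; parent, label, state and
priority of each tree node; the transitions admitted in a search; three sets of states; the list of
priorities; a set of letters. -/

notation "aTgt" => (0 : ℕ)
notation "aPrio" => (1 : ℕ)
notation "aPar" => (2 : ℕ)
notation "aLab" => (3 : ℕ)
notation "aSrc" => (4 : ℕ)
notation "aLet" => (5 : ℕ)
notation "aOk" => (6 : ℕ)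
notation "aComp" => (7 : ℕ)
notation "aFwd" => (8 : ℕ)
notation "aBwd" => (9 : ℕ)
notation "aList" => (10 : ℕ)
notation "aState" => (11 : ℕ)
notation "aTop" => (12 : ℕ)
notation "aSet" => (13 : ℕ)

variable {n c : ℕ}

theorem edge_lt (q : Fin n) (a : Fin c) : (q : ℕ) * c + a < n * c := by
  have h1 : ((q : ℕ) + 1) * c ≤ n * c := Nat.mul_le_mul_right c q.2
  have h2 := a.2
  rw [Nat.add_mul, Nat.one_mul] at h1
  omega

theorem exists_edge {e : ℕ} (he : e < n * c) : ∃ (q : Fin n) (a : Fin c), (q : ℕ) * c + a = e := by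
  have hc : 0 < c := Nat.pos_of_ne_zero (by rintro rfl; simp at he)
  refine ⟨⟨e / c, Nat.div_lt_of_lt_mul (by rwa [mul_comm])⟩, ⟨e % c, Nat.mod_lt _ hc⟩, ?_⟩
  exact Nat.div_add_mod' e c

theorem row_inj {v v' : ℕ} {a a' : ℕ} (ha : a < c) (ha' : a' < c) :
    v * c + a = v' * c + a' ↔ v = v' ∧ a = a' := by
  constructor
  · intro h
    have h1 := congrArg (· / c) h
    have h2 := congrArg (· % c) h
    have hc : 0 < c := by omega
    simp only [Nat.mul_comm _ c, Nat.mul_add_div hc, Nat.div_eq_of_lt ha, Nat.div_eq_of_lt ha',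
      Nat.mul_add_mod, Nat.mod_eq_of_lt ha, Nat.mod_eq_of_lt ha'] at h1 h2
    exact ⟨by omega, h2⟩
  · rintro ⟨rfl, rfl⟩
    rfl

theorem edge_inj {q q' : Fin n} {a a' : Fin c} :
    (q : ℕ) * c + a = (q' : ℕ) * c + a' ↔ q = q' ∧ a = a' := by
  rw [row_inj a.2 a'.2, Fin.ext_iff, Fin.ext_iff]

/-- The memory holds the automaton `A`, with the sources and the letters of the transitions and a
list of the priorities. -/
structure HoldsGraph (A : ParityAutomaton (Fin n) (Fin c)) (s : Store) : Prop where
  states : s.var vStates = n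
  letters : s.var vLetters = c
  edges : s.var vEdges = n * c
  prios : s.var vPrios = A.priorities.card
  tgt : ∀ (q : Fin n) (a : Fin c), s.arr aTgt (q * c + a) = (A.δ q a).1
  prio : ∀ (q : Fin n) (a : Fin c), s.arr aPrio (q * c + a) = (A.δ q a).2
  src : ∀ (q : Fin n) (a : Fin c), s.arr aSrc (q * c + a) = q
  letter : ∀ (q : Fin n) (a : Fin c), s.arr aLet (q * c + a) = a
  mem_list : ∀ k, k ∈ A.priorities ↔ ∃ j < A.priorities.card, s.arr aList j = k

theorem HoldsGraph.of_agree {A : ParityAutomaton (Fin n) (Fin c)} {s s' : Store}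
    (h : HoldsGraph A s) {V U : List ℕ} (hs : Agree V U s s')
    (hV : ∀ x ∈ [vStates, vLetters, vEdges, vPrios], x ∉ V)
    (hU : ∀ a ∈ [aTgt, aPrio, aSrc, aLet, aList], a ∉ U) : HoldsGraph A s' := by
  simp only [List.mem_cons, List.not_mem_nil, or_false, forall_eq_or_imp, forall_eq] at hV hU
  obtain ⟨h0, h1, h4, h5⟩ := hV
  obtain ⟨k0, k1, k4, k5, k10⟩ := hU
  constructor
  · rw [hs.var _ h0, h.states]
  · rw [hs.var _ h1, h.letters]
  · rw [hs.var _ h4, h.edges]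
  · rw [hs.var _ h5, h.prios]
  · rw [hs.arr _ k0]; exact h.tgt
  · rw [hs.arr _ k1]; exact h.prio
  · rw [hs.arr _ k4]; exact h.src
  · rw [hs.arr _ k5]; exact h.letter
  · rw [hs.arr _ k10]; exact h.mem_list

/-- The set of the numbers below `m` at which the array `a` is not `0`. -/
def Store.setAt (s : Store) (a m : ℕ) : Set (Fin m) := {y | s.arr a y ≠ 0}

theorem Store.mem_setAt {s : Store} {a m : ℕ} {y : Fin m} :
    y ∈ s.setAt a m ↔ s.arr a y ≠ 0 := Iff.rfl

/-! ### Searching a graph -/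

/-- Computes in the array `o` the set of the states reachable from the state in `vStart`, along the
admitted transitions, which lead from the states in the array `f` to those in the array `t`. -/
def searchProg (f t o : ℕ) : Prog :=
  .for xY vStates (.write o (.var xY) (.const 0)) ;;
  .write o (.var vStart) (.const 1) ;;
  .for xI vStates (.for xE vEdges
    (.when (.get aOk (.var xE)) (.when (.get o (.get f (.var xE)))
      (.write o (.get t (.var xE)) (.const 1)))))

theorem wp_searchProg {A : ParityAutomaton (Fin n) (Fin c)} {s : Store} (hc : 0 < c)
    (hG : HoldsGraph A s) {ok : Fin n → Fin c → Prop}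
    (hok : ∀ (q : Fin n) (a : Fin c), s.arr aOk (q * c + a) ≠ 0 ↔ ok q a) {x : Fin n}
    (hx : s.var vStart = x) {af at' o : ℕ} {f t : Fin n → Fin c → Fin n}
    (hf : ∀ (q : Fin n) (a : Fin c), s.arr af (q * c + a) = f q a)
    (ht : ∀ (q : Fin n) (a : Fin c), s.arr at' (q * c + a) = t q a)
    (hfo : af ≠ o) (hto : at' ≠ o) (hoko : aOk ≠ o) :
    wp (searchProg af at' o) s fun τ s' => τ ≤ 60 * (n * (n * c)) ∧
      ∀ y : Fin n, s'.arr o y ≠ 0 ↔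
        Relation.ReflTransGen (fun u v => ∃ q a, ok q a ∧ f q a = u ∧ t q a = v) x y := by
  set R := Relation.ReflTransGen (fun u v : Fin n => ∃ q a, ok q a ∧ f q a = u ∧ t q a = v) x
    with hR
  have hn : 0 < n := x.pos
  rw [searchProg, wp_seq]
  refine wp_for 3 (fun i s' => ∀ y < i, s'.arr o y = 0) (by simp [Prog.vars])
    (by simp [Prog.vars]) hG.states (by simp) ?_ ?_
  · intro i s' hi hxi _ hI
    simp only [wp_write, Expr.eval, Expr.cost, hxi]
    refine ⟨le_rfl, fun y hy => ?_⟩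
    rw [Store.setVar_arr, Store.setArr_arr]
    split_ifs with h
    · rfl
    · exact hI y (by simp at h; omega)
  intro t1 s1 ht1 hag1 hz
  have hv1 : ∀ v, v ≠ xY → s1.var v = s.var v := fun v hv => hag1.var v (by simp [Prog.vars, hv])
  have ha1 : ∀ b, b ≠ o → s1.arr b = s.arr b := fun b hb => hag1.arr b (by simp [Prog.arrs, hb])
  rw [wp_seq, wp_write]
  simp only [Expr.eval, Expr.cost]
  set s2 := s1.setArr o (s1.var vStart) 1 with hs2
  have hv2 : ∀ v, v ≠ xY → s2.var v = s.var v := fun v hv => hv1 v hv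
  have ha2 : ∀ b, b ≠ o → s2.arr b = s.arr b := fun b hb => by
    rw [hs2, Store.setArr_arr_of_ne _ _ _ hb, ha1 b hb]
  have h2 : s2.setAt o n = {x} := by
    ext y
    rw [Store.mem_setAt, hs2, Store.setArr_arr, hv1 _ (by simp), hx]
    by_cases hy : y = x
    · simp [hy]
    · have : (y : ℕ) ≠ x := fun h => hy (Fin.ext h)
      simp [hy, this, hz y y.2]
  refine wp_for (n * c * 19 + 6) (fun i s' => x ∈ s'.setAt o n ∧ s'.setAt o n ⊆ {y | R y} ∧
    (s'.setAt o n = {y | R y} ∨ i + 1 ≤ (s'.setAt o n).ncard)) 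
      (by simp [Prog.vars, Prog.when, Prog.for]) (by simp [Prog.vars, Prog.when, Prog.for])
    ((hv2 _ (by simp)).trans hG.states) ?_ ?_ ?_
  · change x ∈ s2.setAt o n ∧ s2.setAt o n ⊆ _ ∧ (_ ∨ _ ≤ (s2.setAt o n).ncard)
    rw [h2]
    refine ⟨rfl, ?_, Or.inr (by simp)⟩
    rintro _ rfl
    exact Relation.ReflTransGen.refl
  · rintro i s3 hi hxi hag3 ⟨hx3, hsub3, hor3⟩
    have hv3 : ∀ v, v ∉ [xY, xI, xE] → s3.var v = s.var v := fun v hv => by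
      simp at hv
      rw [hag3.var v (by simp [Prog.vars, Prog.when, Prog.for, hv]), hv2 v hv.1]
    have ha3 : ∀ b, b ≠ o → s3.arr b = s.arr b := fun b hb => by
      rw [hag3.arr b (by simp [Prog.arrs, Prog.when, Prog.for, hb]), ha2 b hb]
    refine wp_for 11 (fun e s' => s3.setAt o n ⊆ s'.setAt o n ∧ s'.setAt o n ⊆ {y | R y} ∧
      ∀ (q : Fin n) (a : Fin c), (q : ℕ) * c + a < e → ok q a → f q a ∈ s3.setAt o n →
        t q a ∈ s'.setAt o n)
      (by simp [Prog.vars, Prog.when])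
      (by simp [Prog.vars, Prog.when]) ((hv3 _ (by simp)).trans hG.edges)
      ⟨subset_rfl, hsub3, by simp⟩ ?_ ?_
    · rintro e s4 he hxe hag4 ⟨hI1, hI2, hI3⟩
      obtain ⟨q, a, rfl⟩ := exists_edge he
      have ha4 : ∀ b, b ≠ o → s4.arr b = s.arr b := fun b hb => by
        rw [hag4.arr b (by simp [Prog.arrs, Prog.when, hb]), ha3 b hb]
      simp only [wp_when, wp_write, Expr.eval, Expr.cost, hxe, ha4 _ hfo, ha4 _ hto, ha4 _ hoko,
        hf, ht]
      have hstep : ∀ s' : Store, s4.setAt o n ⊆ s'.setAt o n → s'.setAt o n ⊆ {y | R y} →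
          (ok q a → f q a ∈ s4.setAt o n → t q a ∈ s'.setAt o n) →
          s3.setAt o n ⊆ s'.setAt o n ∧ s'.setAt o n ⊆ {y | R y} ∧
          ∀ (q' : Fin n) (a' : Fin c), (q' : ℕ) * c + a' < (q : ℕ) * c + a + 1 → ok q' a' →
            f q' a' ∈ s3.setAt o n → t q' a' ∈ s'.setAt o n := by
        intro s' h1 h2 h3
        refine ⟨hI1.trans h1, h2, fun q' a' hlt hk hm => ?_⟩
        rcases Nat.lt_succ_iff_lt_or_eq.1 hlt with hlt | heq
        · exact h1 (hI3 q' a' hlt hk hm)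
        · obtain ⟨rfl, rfl⟩ := edge_inj.1 heq
          exact h3 hk (hI1 hm)
      refine ⟨fun h1 => ⟨fun h2 => ⟨by omega, ?_⟩, fun h2 => ⟨by omega, ?_⟩⟩,
        fun h1 => ⟨by omega, ?_⟩⟩
      · have hset : ((s4.setArr o (t q a) 1).setVar xE (q * c + a + 1)).setAt o n =
            insert (t q a) (s4.setAt o n) := by
          ext y
          rw [Set.mem_insert_iff, Store.mem_setAt, Store.mem_setAt, Store.setVar_arr,
            Store.setArr_arr]
          by_cases hy : y = t q a
          · simp [hy]
          · have : (y : ℕ) ≠ t q a := fun h => hy (Fin.ext h)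
            simp [hy, this]
        refine hstep _ ?_ ?_ ?_
        · rw [hset]; exact Set.subset_insert _ _
        · rw [hset]
          refine Set.insert_subset ?_ hI2
          have h3 : R (f q a) := hI2 h2
          exact h3.tail ⟨q, a, (hok q a).1 h1, rfl, rfl⟩
        · rw [hset]; exact fun _ _ => Set.mem_insert _ _
      · exact hstep _ subset_rfl hI2 fun _ h3 => absurd h2 h3
      · exact hstep _ subset_rfl hI2 fun h3 => absurd h1 ((hok q a).2 h3)
    · rintro τ s4 hτ hag4 ⟨hI1, hI2, hI3⟩
      refine ⟨by linarith, hI1 hx3, hI2, ?_⟩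
      change s4.setAt o n = _ ∨ i + 1 + 1 ≤ (s4.setAt o n).ncard
      by_cases heq : s4.setAt o n = s3.setAt o n
      · -- a round that adds nothing shows that the set is closed
        left
        refine hI2.antisymm fun y (hy : R y) => ?_
        induction hy with
        | refl => exact hI1 hx3
        | tail _ hst ih =>
          obtain ⟨q, a, h1, rfl, rfl⟩ := hst
          exact hI3 q a (edge_lt q a) h1 (heq ▸ ih)
      · rcases hor3 with h3 | h3
        · exact absurd (hI2.antisymm (h3 ▸ hI1)) (h3 ▸ heq)
        · right
          have := Set.ncard_lt_ncard (hI1.ssubset_of_ne (Ne.symm heq)) (Set.toFinite _)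
          omega
  · rintro τ s3 hτ hag3 ⟨hx3, hsub3, hor3⟩
    refine ⟨?_, fun y => ?_⟩
    · have h1 : 1 ≤ n * c := Nat.mul_pos hn hc
      have h2 : n ≤ n * (n * c) := Nat.le_mul_of_pos_right n h1
      have h3 : n * (n * c * 19 + 6 + 8) = 19 * (n * (n * c)) + 14 * n := by ring
      omega
    · rcases hor3 with h3 | h3
      · rw [← Store.mem_setAt, h3]
        exact Iff.rfl
      · exfalso
        have h4 : (s3.setAt o n).ncard ≤ n := by
          have := Set.ncard_le_ncard (Set.subset_univ (s3.setAt o n)) (Set.toFinite _)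
          rwa [Set.ncard_univ, Nat.card_eq_fintype_card, Fintype.card_fin] at this
        omega

theorem wp_search_fwd {A : ParityAutomaton (Fin n) (Fin c)} {s : Store} (hc : 0 < c)
    (hG : HoldsGraph A s) {ok : Fin n → Fin c → Prop}
    (hok : ∀ (q : Fin n) (a : Fin c), s.arr aOk (q * c + a) ≠ 0 ↔ ok q a) {x : Fin n}
    (hx : s.var vStart = x) {o : ℕ} (ho : o ∉ [aSrc, aTgt, aOk]) :
    wp (searchProg aSrc aTgt o) s fun τ s' => τ ≤ 60 * (n * (n * c)) ∧
      ∀ y : Fin n, s'.arr o y ≠ 0 ↔ A.Reach ok x y := by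
  simp only [List.mem_cons, List.not_mem_nil, or_false, not_or] at ho
  refine wp_mono (wp_searchProg hc hG hok hx (f := fun q _ => q) (t := fun q a => (A.δ q a).1)
    hG.src hG.tgt (Ne.symm ho.1) (Ne.symm ho.2.1) (Ne.symm ho.2.2)) ?_
  rintro τ s' ⟨h1, h2⟩
  refine ⟨h1, fun y => ?_⟩
  rw [h2 y, Reach]
  have : (fun u v : Fin n => ∃ q a, ok q a ∧ q = u ∧ (A.δ q a).1 = v) = A.Step ok := by
    funext u v
    exact propext ⟨fun ⟨q, a, h1, h2, h3⟩ => ⟨a, h2 ▸ h1, h2 ▸ h3⟩,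
      fun ⟨a, h1, h2⟩ => ⟨u, a, h1, rfl, h2⟩⟩
  rw [this]

theorem wp_search_bwd {A : ParityAutomaton (Fin n) (Fin c)} {s : Store} (hc : 0 < c)
    (hG : HoldsGraph A s) {ok : Fin n → Fin c → Prop}
    (hok : ∀ (q : Fin n) (a : Fin c), s.arr aOk (q * c + a) ≠ 0 ↔ ok q a) {x : Fin n}
    (hx : s.var vStart = x) {o : ℕ} (ho : o ∉ [aSrc, aTgt, aOk]) :
    wp (searchProg aTgt aSrc o) s fun τ s' => τ ≤ 60 * (n * (n * c)) ∧
      ∀ y : Fin n, s'.arr o y ≠ 0 ↔ A.Reach ok y x := by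
  simp only [List.mem_cons, List.not_mem_nil, or_false, not_or] at ho
  refine wp_mono (wp_searchProg hc hG hok hx (f := fun q a => (A.δ q a).1) (t := fun q _ => q)
    hG.tgt hG.src (Ne.symm ho.2.1) (Ne.symm ho.1) (Ne.symm ho.2.2)) ?_
  rintro τ s' ⟨h1, h2⟩
  refine ⟨h1, fun y => ?_⟩
  rw [h2 y, Reach, ← Relation.reflTransGen_swap]
  have : (fun u v : Fin n => ∃ q a, ok q a ∧ (A.δ q a).1 = u ∧ q = v) =
      Function.swap (A.Step ok) := by
    funext u v
    exact propext ⟨fun ⟨q, a, h1, h2, h3⟩ => ⟨a, h3 ▸ h1, h3 ▸ h2⟩,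
      fun ⟨a, h1, h2⟩ => ⟨v, a, h1, h2, rfl⟩⟩
  rw [this]

/-! ### Preprocessing -/

/-- Lists the transitions and the priorities, and creates the root of the tree; for the root, the
search for a terminal component starts in the initial state. -/
def prepProg : Prog :=
  .for xQ vStates (.for xA vLetters (
    .write aSrc (.var vEdges) (.var xQ) ;;
    .write aLet (.var vEdges) (.var xA) ;;
    .assign vEdges (.add (.var vEdges) (.const 1)))) ;;
  .for xE vEdges (
    .assign vFlag (.const 0) ;;
    .for xJ vPrios (
      .ite (.dist (.get aList (.var xJ)) (.get aPrio (.var xE))) .skip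
        (.assign vFlag (.const 1))) ;;
    .ite (.var vFlag) .skip (
      .write aList (.var vPrios) (.get aPrio (.var xE)) ;;
      .assign vPrios (.add (.var vPrios) (.const 1)))) ;;
  .for xA vLetters (.write aLab (.var xA) (.const 1)) ;;
  .assign vNodes (.const 1) ;;
  .assign vNewRow (.var vLetters) ;;
  .write aState (.const 0) (.var vInit)

theorem card_priorities_pos (A : ParityAutomaton (Fin n) (Fin c)) (hc : 0 < c) :
    0 < A.priorities.card :=
  Finset.card_pos.2 ⟨_, Finset.mem_image_of_mem _ (Finset.mem_univ (A.init, (⟨0, hc⟩ : Fin c)))⟩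

theorem mem_priorities (A : ParityAutomaton (Fin n) (Fin c)) (q : Fin n) (a : Fin c) :
    (A.δ q a).2 ∈ A.priorities := Finset.mem_image_of_mem _ (Finset.mem_univ (q, a))

theorem wp_prepProg (A : ParityAutomaton (Fin n) (Fin c)) (hc : 0 < c) :
    wp prepProg (inputStore A) fun t s' => t ≤ 200 * (A.priorities.card * (n * c)) ∧
      HoldsGraph A s' ∧ s'.var vNode = 0 ∧ s'.var vRow = 0 ∧ s'.var vNodes = 1 ∧
      s'.var vNewRow = c ∧ s'.arr aPar 0 = 0 ∧ (∀ a < c, s'.arr aLab a = 1) ∧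
      s'.arr aState 0 = A.init := by
  obtain ⟨hin, hic, hii, hid⟩ := holdsAutomaton_inputStore A
  have hn : 0 < n := A.init.pos
  have hd := card_priorities_pos A hc
  set d := A.priorities.card with hd'
  have hv0 : ∀ x, 2 < x → (inputStore A).var x = 0 := by
    intro x hx
    have h0 : x ≠ 0 := by omega
    have h1 : x ≠ 1 := by omega
    have h2 : x ≠ 2 := by omega
    simp [inputStore, h0, h1, h2]
  have ha0 : (inputStore A).arr aPar 0 = 0 := by
    simp [inputStore]
  rw [prepProg, wp_seq]
  refine wp_for (c * 18 + 6) (fun i s' => s'.var vEdges = i * c ∧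
      ∀ (q : Fin n) (a : Fin c), (q : ℕ) * c + a < i * c →
        s'.arr aSrc (q * c + a) = q ∧ s'.arr aLet (q * c + a) = a)
    (by decide) (by decide) hin (by simp [Store.setVar_var, hv0]) ?_ ?_
  · rintro i s1 hi hxi hag1 ⟨hM, hI⟩
    refine wp_for 10 (fun j s' => s'.var vEdges = i * c + j ∧
        ∀ (q : Fin n) (a : Fin c), (q : ℕ) * c + a < i * c + j →
          s'.arr aSrc (q * c + a) = q ∧ s'.arr aLet (q * c + a) = a)
      (by decide) (by decide) ((hag1.var _ (by decide)).trans hic)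
      (by simpa [Store.setVar_var, Store.setVar_arr] using ⟨hM, hI⟩) ?_ ?_
    · rintro j s2 hj hxj hag2 ⟨hM2, hI2⟩
      have hxi2 : s2.var xQ = i := by rw [hag2.var _ (by decide), hxi]
      simp only [wp_seq, wp_write, wp_assign, Expr.eval, Expr.cost, Store.setArr_var, hxi2, hM2,
        hxj]
      refine ⟨by omega, by simp [Store.setVar_var]; omega, fun q a hlt => ?_⟩
      simp only [Store.setVar_arr, Store.setArr_arr]
      rcases lt_or_eq_of_le (show (q : ℕ) * c + a ≤ i * c + j by omega) with hlt | heq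
      · have hne : ¬ ((q : ℕ) * c + a = i * c + j) := by omega
        simpa [hne] using hI2 q a hlt
      · rw [row_inj a.2 hj] at heq
        simp [heq.1, heq.2]
    · rintro t s2 ht hag2 ⟨hM2, hI2⟩
      refine ⟨ht, ?_, ?_⟩
      · simp only [Store.setVar_var]
        simp [hM2, Nat.add_mul]
      · simpa [Store.setVar_arr, Nat.add_mul] using hI2
  rintro t1 s1 ht1 hag1 ⟨hM1, hI1⟩
  rw [wp_seq]
  have hprio1 : ∀ (q : Fin n) (a : Fin c), s1.arr aPrio (q * c + a) = (A.δ q a).2 := fun q a => by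
    rw [hag1.arr _ (by decide), (hid q a).2]
  have hle : ∀ (D : ℕ) (f : ℕ → ℕ), (∀ j < D, f j ∈ A.priorities) →
      (∀ j < D, ∀ k < D, f j = f k → j = k) → D ≤ d := by
    intro D f h1 h2
    rw [← Finset.card_range D]
    refine Finset.card_le_card_of_injOn f (fun j hj => ?_) fun j hj k hk h => ?_
    · exact h1 j (by simpa using hj)
    · exact h2 j (by simpa using hj) k (by simpa using hk) h
  refine wp_for (d * 22 + 24) (fun e s' =>
      (∀ j < s'.var vPrios, s'.arr aList j ∈ A.priorities) ∧
      (∀ j < s'.var vPrios, ∀ k < s'.var vPrios, s'.arr aList j = s'.arr aList k → j = k) ∧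
      ∀ (q : Fin n) (a : Fin c), (q : ℕ) * c + a < e →
        ∃ j < s'.var vPrios, s'.arr aList j = (A.δ q a).2)
    (by decide) (by decide) hM1 ?_ ?_ ?_
  · have : s1.var vPrios = 0 := by rw [hag1.var _ (by decide), hv0 _ (by decide)]
    simp [Store.setVar_var, this]
  · rintro e s2 he hxe hag2 ⟨hI1, hI2, hI3⟩
    obtain ⟨q, a, rfl⟩ := exists_edge he
    have hD := hle _ _ hI1 hI2
    rw [wp_seq, wp_assign, wp_seq]
    have hp2 : s2.arr aPrio (q * c + a) = (A.δ q a).2 := by rw [hag2.arr _ (by decide), hprio1]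
    refine wp_for 14 (fun j s' => s'.var vFlag ≠ 0 ↔ ∃ k < j, s2.arr aList k = (A.δ q a).2)
      (by decide) (by decide) (m := s2.var vPrios) (by simp [Store.setVar_var])
      (by simp [Store.setVar_var, Expr.eval]) ?_ ?_
    · intro j s3 hj hxj hag3 hI
      have hxe3 : s3.var xE = q * c + a := by
        rw [hag3.var _ (by decide), Store.setVar_var]; simpa using hxe
      have hl3 : s3.arr aList = s2.arr aList := hag3.arr _ (by decide)
      have hp3 : s3.arr aPrio (q * c + a) = (A.δ q a).2 := by
        rw [hag3.arr _ (by decide)]; exact hp2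
      have hstep : (∃ k < j + 1, s2.arr aList k = (A.δ q a).2) ↔
          (∃ k < j, s2.arr aList k = (A.δ q a).2) ∨ s2.arr aList j = (A.δ q a).2 := by
        constructor
        · rintro ⟨k, hk, h⟩
          rcases Nat.lt_succ_iff_lt_or_eq.1 hk with hk | rfl
          · exact Or.inl ⟨k, hk, h⟩
          · exact Or.inr h
        · rintro (⟨k, hk, h⟩ | h)
          · exact ⟨k, by omega, h⟩
          · exact ⟨j, by omega, h⟩
      simp only [wp_ite, wp_skip, wp_assign, ne_eq, Expr.eval_dist, Expr.cost, Expr.cost_dist,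
        Expr.eval, hxj, hxe3, hl3, hp3, hstep]
      refine ⟨fun hne => ⟨by omega, ?_⟩, fun heq => ⟨by omega, ?_⟩⟩
      · simp only [Store.setVar_var]
        simpa [hne] using hI
      · simp [Store.setVar_var, heq]
    · intro t s3 ht hag3 hI
      have ht' : t ≤ d * 22 + 6 := ht.trans (by nlinarith)
      have hxe3 : s3.var xE = q * c + a := by
        rw [hag3.var _ (by decide), Store.setVar_var]; simpa using hxe
      have hl3 : s3.arr aList = s2.arr aList := hag3.arr _ (by decide)
      have hp3 : s3.arr aPrio (q * c + a) = (A.δ q a).2 := by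
        rw [hag3.arr _ (by decide)]; exact hp2
      have hv3 : s3.var vPrios = s2.var vPrios := by
        rw [hag3.var _ (by decide), Store.setVar_var]; simp
      simp only [wp_ite, wp_seq, wp_write, wp_skip, wp_assign, Expr.cost, Expr.eval, hxe3, hl3,
        hp3, hv3, Store.setVar_var, Store.setArr_var, Store.setVar_arr, Store.setArr_arr]
      refine ⟨fun hne => ⟨by omega, ?_⟩, fun heq => ⟨by omega, ?_⟩⟩
      · simp only [Nat.reduceEqDiff, if_false]
        refine ⟨hI1, hI2, fun q' a' hlt => ?_⟩
        rcases Nat.lt_succ_iff_lt_or_eq.1 hlt with hlt | heq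
        · exact hI3 q' a' hlt
        · obtain ⟨rfl, rfl⟩ := edge_inj.1 heq
          exact hI.1 hne
      · have hnew : ∀ k < s2.var vPrios, s2.arr aList k ≠ (A.δ q a).2 := by
          intro k hk h
          exact hI.2 ⟨k, hk, h⟩ heq
        simp only [Nat.reduceEqDiff, if_false, if_true, true_and]
        refine ⟨fun j hj => ?_, fun j hj k hk h => ?_, fun q' a' hlt => ?_⟩
        · split_ifs with h
          · exact mem_priorities A q a
          · exact hI1 j (by omega)
        · split_ifs at h with h1 h2 h2
          · omega
          · exact absurd h.symm (hnew k (by omega))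
          · exact absurd h (hnew j (by omega))
          · exact hI2 j (by omega) k (by omega) h
        · rcases Nat.lt_succ_iff_lt_or_eq.1 hlt with hlt | heq
          · obtain ⟨j, hj, h⟩ := hI3 q' a' hlt
            exact ⟨j, by omega, by rw [if_neg (by omega)]; exact h⟩
          · obtain ⟨rfl, rfl⟩ := edge_inj.1 heq
            exact ⟨s2.var vPrios, by omega, if_pos rfl⟩
  rintro t2 s2 ht2 hag2 ⟨hJ1, hJ2, hJ3⟩
  rw [wp_seq]
  refine wp_for 3 (fun i s' => ∀ a < i, s'.arr aLab a = 1)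
    (by decide) (by decide) (m := c)
    (by rw [hag2.var _ (by decide), hag1.var _ (by decide), hic]) (by simp) ?_ ?_
  · intro i s3 hi hxi hag3 hI
    simp only [wp_write, Expr.eval, Expr.cost, hxi, Store.setVar_arr, Store.setArr_arr]
    refine ⟨by omega, fun a ha => ?_⟩
    split_ifs with h
    · rfl
    · exact hI a (by simp at h; omega)
  intro t3 s3 ht3 hag3 hL
  simp only [wp_seq, wp_assign, wp_write, Expr.eval, Expr.cost, Store.setVar_var,
    Store.setArr_var, Nat.reduceEqDiff, if_false]
  have hv : ∀ x, x ∉ prepProg.vars → s3.var x = (inputStore A).var x := by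
    intro x hx
    have h : Agree prepProg.vars prepProg.arrs (inputStore A) s3 :=
      ((hag1.mono (by decide) (by decide)).trans (hag2.mono (by decide) (by decide))).trans
        (hag3.mono (by decide) (by decide))
    exact h.var x hx
  have har : ∀ x, x ∉ [aSrc, aLet, aList, aLab] → s3.arr x = (inputStore A).arr x := by
    intro x hx
    have h : Agree prepProg.vars [aSrc, aLet, aList, aLab] (inputStore A) s3 :=
      ((hag1.mono (by decide) (by decide)).trans (hag2.mono (by decide) (by decide))).trans
        (hag3.mono (by decide) (by decide))
    exact h.arr x hx
  have hD3 : s3.var vPrios = s2.var vPrios := hag3.var _ (by decide)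
  have hl3 : s3.arr aList = s2.arr aList := hag3.arr _ (by decide)
  have hDd : s2.var vPrios = d := by
    refine le_antisymm (hle _ _ hJ1 hJ2) ?_
    have hsub : A.priorities ⊆ (Finset.range (s2.var vPrios)).image (s2.arr aList) := by
      intro k hk
      obtain ⟨⟨q, a⟩, -, rfl⟩ := Finset.mem_image.1 hk
      obtain ⟨j, hj, h⟩ := hJ3 q a (edge_lt q a)
      exact Finset.mem_image.2 ⟨j, Finset.mem_range.2 hj, h⟩
    exact (Finset.card_le_card hsub).trans (Finset.card_image_le.trans (Finset.card_range _).le)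
  refine ⟨?_, ⟨?_, ?_, ?_, ?_, ?_, ?_, ?_, ?_, ?_⟩, ?_, ?_, ?_, ?_, ?_, ?_, ?_⟩
  · have h1 : n * (c * 18 + 6 + 8) + 6 ≤ 38 * (n * c) := by nlinarith
    have h2 : n * c * (d * 22 + 24 + 8) + 6 ≤ 60 * (d * (n * c)) := by
      have : 1 ≤ n * c := Nat.mul_pos hn hc
      nlinarith
    have h3 : n * c ≤ d * (n * c) := Nat.le_mul_of_pos_left _ hd
    have h4 : c ≤ n * c := Nat.le_mul_of_pos_left _ hn
    omega
  · simp [Store.setArr_var, Store.setVar_var, hv vStates (by decide), hin]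
  · simp [Store.setArr_var, Store.setVar_var, hv vLetters (by decide), hic]
  · simp [Store.setArr_var, Store.setVar_var, hag3.var vEdges (by decide),
      hag2.var vEdges (by decide), hM1]
  · simp [Store.setArr_var, Store.setVar_var, hD3, hDd, hd']
  · intro q a
    rw [Store.setArr_arr_of_ne _ _ _ (by decide)]
    simp [Store.setVar_arr, har aTgt (by decide), (hid q a).1]
  · intro q a
    rw [Store.setArr_arr_of_ne _ _ _ (by decide)]
    simp [Store.setVar_arr, har aPrio (by decide), (hid q a).2]
  · intro q a
    rw [Store.setArr_arr_of_ne _ _ _ (by decide)]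
    simp [Store.setVar_arr, hag3.arr aSrc (by decide), hag2.arr aSrc (by decide),
      (hI1 q a (edge_lt q a)).1]
  · intro q a
    rw [Store.setArr_arr_of_ne _ _ _ (by decide)]
    simp [Store.setVar_arr, hag3.arr aLet (by decide), hag2.arr aLet (by decide),
      (hI1 q a (edge_lt q a)).2]
  · intro k
    rw [Store.setArr_arr_of_ne _ _ _ (by decide)]
    simp only [Store.setVar_arr, hl3]
    rw [hDd] at hJ1 hJ3
    constructor
    · intro hk
      obtain ⟨⟨q, a⟩, -, rfl⟩ := Finset.mem_image.1 hk
      exact hJ3 q a (edge_lt q a)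
    · rintro ⟨j, hj, rfl⟩
      exact hJ1 j hj
  · simp [hv vNode (by decide), hv0]
  · simp [hv vRow (by decide), hv0]
  · simp
  · simp [hv vLetters (by decide), hic]
  · rw [Store.setArr_arr_of_ne _ _ _ (by decide)]
    simp [Store.setVar_arr, har aPar (by decide), ha0]
  · rw [Store.setArr_arr_of_ne _ _ _ (by decide)]
    exact hL
  · simp [Store.setArr_arr, hv vInit (by decide), hii]

/-! ### The component of a node -/

/-- The label of the node `v`. -/
def Store.label (s : Store) (c v : ℕ) : Set (Fin c) := {a | s.arr aLab (v * c + a) ≠ 0}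

theorem Store.mem_label {s : Store} {v : ℕ} {a : Fin c} :
    a ∈ s.label c v ↔ s.arr aLab (v * c + a) ≠ 0 := Iff.rfl

/-- Admits the transitions with a letter in the label of the current node. -/
def lettersProg : Prog :=
  .for xE vEdges (.write aOk (.var xE) (.get aLab (.add (.var vRow) (.get aLet (.var xE)))))

theorem wp_lettersProg {A : ParityAutomaton (Fin n) (Fin c)} {s : Store} (hG : HoldsGraph A s)
    {v : ℕ} (hv : s.var vRow = v * c) :
    wp lettersProg s fun t s' => t ≤ n * c * 15 + 6 ∧
      ∀ (q : Fin n) (a : Fin c), s'.arr aOk (q * c + a) ≠ 0 ↔ a ∈ s.label c v := by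
  refine wp_for 7 (fun e s' => ∀ (q : Fin n) (a : Fin c), (q : ℕ) * c + a < e →
    (s'.arr aOk (q * c + a) ≠ 0 ↔ a ∈ s.label c v)) (by decide) (by decide) hG.edges (by simp) ?_ ?_
  · intro e s1 he hxe hag hI
    obtain ⟨q, a, rfl⟩ := exists_edge he
    have h1 : s1.arr aLet (q * c + a) = a := by rw [hag.arr _ (by decide), hG.letter]
    have h2 : s1.arr aLab = s.arr aLab := hag.arr _ (by decide)
    have h3 : s1.var vRow = v * c := by rw [hag.var _ (by decide), hv]
    simp only [wp_write, Expr.eval, Expr.cost, hxe, h1, h2, h3, Store.setVar_arr,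
      Store.setArr_arr, true_and]
    refine ⟨le_rfl, fun q' a' hlt => ?_⟩
    rcases Nat.lt_succ_iff_lt_or_eq.1 hlt with hlt | heq
    · rw [if_neg (by omega)]
      exact hI q' a' hlt
    · obtain ⟨rfl, rfl⟩ := edge_inj.1 heq
      rw [if_pos rfl]
      exact Iff.rfl
  · exact fun t s' ht _ hI => ⟨ht, fun q a => hI q a (edge_lt q a)⟩

/-- Admits the transitions with a letter in the label of the current node and a priority of at most
`vPrio`. -/
def limitProg : Prog :=
  .for xE vEdges (
    .ite (.get aLab (.add (.var vRow) (.get aLet (.var xE))))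
      (.ite (.sub (.get aPrio (.var xE)) (.var vPrio)) (.write aOk (.var xE) (.const 0))
        (.write aOk (.var xE) (.const 1)))
      (.write aOk (.var xE) (.const 0)))

theorem wp_limitProg {A : ParityAutomaton (Fin n) (Fin c)} {s : Store} (hG : HoldsGraph A s)
    {v : ℕ} (hv : s.var vRow = v * c) :
    wp limitProg s fun t s' => t ≤ n * c * 22 + 6 ∧
      ∀ (q : Fin n) (a : Fin c), s'.arr aOk (q * c + a) ≠ 0 ↔
        A.okUpTo (s.label c v) (s.var vPrio) q a := by
  refine wp_for 14 (fun e s' => ∀ (q : Fin n) (a : Fin c), (q : ℕ) * c + a < e →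
    (s'.arr aOk (q * c + a) ≠ 0 ↔ A.okUpTo (s.label c v) (s.var vPrio) q a))
    (by decide) (by decide) hG.edges (by simp) ?_ ?_
  · intro e s1 he hxe hag hI
    obtain ⟨q, a, rfl⟩ := exists_edge he
    have h1 : s1.arr aLet (q * c + a) = a := by rw [hag.arr _ (by decide), hG.letter]
    have h2 : s1.arr aLab = s.arr aLab := hag.arr _ (by decide)
    have h3 : s1.var vRow = v * c := by rw [hag.var _ (by decide), hv]
    have h4 : s1.arr aPrio (q * c + a) = (A.δ q a).2 := by rw [hag.arr _ (by decide), hG.prio]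
    have h5 : s1.var vPrio = s.var vPrio := hag.var _ (by decide)
    have key : ∀ k, (k ≠ 0 ↔ A.okUpTo (s.label c v) (s.var vPrio) q a) →
        ∀ (q' : Fin n) (a' : Fin c), (q' : ℕ) * c + a' < (q : ℕ) * c + a + 1 →
        ((if (q' : ℕ) * c + a' = (q : ℕ) * c + a then k else s1.arr aOk (q' * c + a')) ≠ 0 ↔
          A.okUpTo (s.label c v) (s.var vPrio) q' a') := by
      intro k hk q' a' hlt
      rcases Nat.lt_succ_iff_lt_or_eq.1 hlt with hlt | heq
      · rw [if_neg (by omega)]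
        exact hI q' a' hlt
      · obtain ⟨rfl, rfl⟩ := edge_inj.1 heq
        rw [if_pos rfl]
        exact hk
    simp only [wp_ite, wp_write, Expr.eval, Expr.cost, hxe, h1, h2, h3, h4, h5, Store.setVar_arr,
      Store.setArr_arr, true_and]
    refine ⟨fun hl => ⟨fun hp => ⟨by omega, key 0 ?_⟩, fun hp => ⟨by omega, key 1 ?_⟩⟩,
      fun hl => ⟨by omega, key 0 ?_⟩⟩
    · exact iff_of_false (by simp) fun h => hp (Nat.sub_eq_zero_of_le h.2)
    · exact iff_of_true (by simp) ⟨hl, Nat.sub_eq_zero_iff_le.1 hp⟩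
    · exact iff_of_false (by simp) fun h => h.1 hl
  · exact fun t s' ht _ hI => ⟨ht, fun q a => hI q a (edge_lt q a)⟩

/-- Computes the states reachable from the state in `xS` and those from which it is reachable. -/
def sccProg : Prog :=
  .assign vStart (.var xS) ;;
  searchProg aSrc aTgt aFwd ;;
  searchProg aTgt aSrc aBwd

theorem wp_sccProg {A : ParityAutomaton (Fin n) (Fin c)} {s : Store} (hc : 0 < c)
    (hG : HoldsGraph A s) {ok : Fin n → Fin c → Prop}
    (hok : ∀ (q : Fin n) (a : Fin c), s.arr aOk (q * c + a) ≠ 0 ↔ ok q a) {x : Fin n}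
    (hx : s.var xS = x) :
    wp sccProg s fun t s' => t ≤ 120 * (n * (n * c)) + 2 ∧
      (∀ y : Fin n, s'.arr aFwd y ≠ 0 ↔ A.Reach ok x y) ∧
      ∀ y : Fin n, s'.arr aBwd y ≠ 0 ↔ A.Reach ok y x := by
  rw [sccProg, wp_seq, wp_assign, wp_seq]
  simp only [Expr.eval, Expr.cost, hx]
  have hag1 : Agree sccProg.vars sccProg.arrs s (s.setVar vStart x) :=
    (Agree.refl _ _ s).setVar (by decide) _
  refine wp_mono (wp_agree (wp_search_fwd hc (x := x) (o := aFwd)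
    (hG.of_agree hag1 (by decide) (by decide)) (hok) (by simp [Store.setVar_var])
    (by decide))) ?_
  rintro t2 s2 ⟨⟨ht2, hfwd⟩, hag2⟩
  have hag2' : Agree sccProg.vars sccProg.arrs s s2 :=
    hag1.trans (hag2.mono (by decide) (by decide))
  refine wp_mono (wp_agree (wp_search_bwd hc (x := x) (o := aBwd)
    (hG.of_agree hag2' (by decide) (by decide)) (ok := ok)
    (by rw [hag2'.arr _ (by decide)]; exact hok)
    (by rw [hag2.var _ (by decide)]; simp [Store.setVar_var]) (by decide))) ?_
  rintro t3 s3 ⟨⟨ht3, hbwd⟩, hag3⟩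
  refine ⟨by omega, ?_, hbwd⟩
  rw [hag3.arr _ (by decide)]
  exact hfwd

/-- Tests whether the set in the array `aFwd` is contained in that in the array `aBwd`. -/
def subsetProg : Prog :=
  .assign vFlag (.const 1) ;;
  .for xY vStates (.when (.get aFwd (.var xY))
    (.ite (.get aBwd (.var xY)) .skip (.assign vFlag (.const 0))))

theorem wp_subsetProg {s : Store} (hn : s.var vStates = n) :
    wp subsetProg s fun t s' => t ≤ n * 16 + 8 ∧
      (s'.var vFlag ≠ 0 ↔ ∀ y < n, s.arr aFwd y ≠ 0 → s.arr aBwd y ≠ 0) := by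
  rw [subsetProg, wp_seq, wp_assign]
  simp only [Expr.eval, Expr.cost]
  refine wp_for 8 (fun j s' => s'.var vFlag ≠ 0 ↔ ∀ y < j, s.arr aFwd y ≠ 0 → s.arr aBwd y ≠ 0)
    (by decide) (by decide) (m := n) (by rw [Store.setVar_var, if_neg (by decide), hn])
    (by simp [Store.setVar_var]) ?_ ?_
  · intro j s1 hj hxj hag hI
    have hf : s1.arr aFwd j = s.arr aFwd j := by rw [hag.arr _ (by decide), Store.setVar_arr]
    have hb : s1.arr aBwd j = s.arr aBwd j := by rw [hag.arr _ (by decide), Store.setVar_arr]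
    have hsplit : (∀ y < j + 1, s.arr aFwd y ≠ 0 → s.arr aBwd y ≠ 0) ↔
        s1.var vFlag ≠ 0 ∧ (s.arr aFwd j ≠ 0 → s.arr aBwd j ≠ 0) := by
      rw [hI]
      exact Nat.forall_lt_succ_right
    simp only [wp_when, wp_ite, wp_skip, wp_assign, Expr.eval, Expr.cost, hxj, Store.setVar_var,
      hsplit, hf, hb, Nat.reduceEqDiff, if_false, if_true]
    refine ⟨fun h1 => ⟨fun h2 => ⟨by omega, ?_⟩, fun h2 => ⟨by omega, ?_⟩⟩,
      fun h1 => ⟨by omega, ?_⟩⟩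
    · exact ⟨fun h => ⟨h, fun _ => h2⟩, fun h => h.1⟩
    · exact ⟨fun h => absurd rfl h, fun h => absurd h2 (h.2 h1)⟩
    · exact ⟨fun h => ⟨h, fun h3 => absurd h1 h3⟩, fun h => h.1⟩
  · exact fun t s' ht _ hI => ⟨by omega, hI⟩

/-- Among the states in the array `aComp`, stores one that is terminal for the admitted
transitions as the state of the current node: the states reached from it lead back to it. -/
def terminalProg : Prog :=
  .for xS vStates (.when (.get aComp (.var xS)) (
    sccProg ;;
    subsetProg ;;
    .when (.var vFlag) (.write aState (.var vNode) (.var xS))))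

theorem wp_terminalProg {A : ParityAutomaton (Fin n) (Fin c)} {s : Store} (hc : 0 < c)
    (hG : HoldsGraph A s) {X : Set (Fin c)}
    (hok : ∀ (q : Fin n) (a : Fin c), s.arr aOk (q * c + a) ≠ 0 ↔ a ∈ X) {x : Fin n}
    (hx : ∀ y : Fin n, s.arr aComp y ≠ 0 ↔ A.ReachIn X x y) :
    wp terminalProg s fun t s' => t ≤ 200 * (n * (n * (n * c))) ∧
      (∀ u, u ≠ s.var vNode → s'.arr aState u = s.arr aState u) ∧
      ∃ y : Fin n, s'.arr aState (s.var vNode) = y ∧ A.ReachIn X x y ∧ A.Terminal X y := by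
  have hn : 0 < n := x.pos
  have h1 : 1 ≤ n * c := Nat.mul_pos hn hc
  have h2 : n ≤ n * (n * c) := Nat.le_mul_of_pos_right n h1
  refine wp_for (120 * (n * (n * c)) + n * 16 + 24) (fun i s' =>
    (∀ u, u ≠ s.var vNode → s'.arr aState u = s.arr aState u) ∧
    ((∃ y : Fin n, s'.arr aState (s.var vNode) = y ∧ A.ReachIn X x y ∧ A.Terminal X y) ∨
      ∀ y : Fin n, (y : ℕ) < i → A.ReachIn X x y → ¬ A.Terminal X y))
    (by decide) (by decide) hG.states (by simp [Store.setVar_arr]) ?_ ?_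
  · rintro i s1 hi hxi hag1 ⟨hI1, hI2⟩
    have hG1 : HoldsGraph A s1 := hG.of_agree hag1 (by decide) (by decide)
    have hok1 : ∀ (q : Fin n) (a : Fin c), s1.arr aOk (q * c + a) ≠ 0 ↔ a ∈ X := by
      rw [hag1.arr _ (by decide)]; exact hok
    have hx1 : s1.arr aComp i ≠ 0 ↔ A.ReachIn X x ⟨i, hi⟩ := by
      rw [hag1.arr _ (by decide)]; exact hx ⟨i, hi⟩
    have hnode1 : s1.var vNode = s.var vNode := hag1.var _ (by decide)
    have hstep : ¬ (A.ReachIn X x ⟨i, hi⟩ ∧ A.Terminal X ⟨i, hi⟩) →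
        (∃ y : Fin n, s1.arr aState (s.var vNode) = y ∧ A.ReachIn X x y ∧ A.Terminal X y) ∨
          ∀ y : Fin n, (y : ℕ) < i + 1 → A.ReachIn X x y → ¬ A.Terminal X y := by
      intro hno
      refine hI2.imp_right fun h y hy hr ht => ?_
      rcases Nat.lt_succ_iff_lt_or_eq.1 hy with hlt | rfl
      · exact h y hlt hr ht
      · exact hno ⟨hr, ht⟩
    rw [wp_when]
    simp only [Expr.eval, Expr.cost, hxi]
    refine ⟨fun hcomp => ?_, fun hcomp => ⟨by omega, hI1, hstep ?_⟩⟩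
    swap
    · exact fun h => hx1.2 h.1 hcomp
    rw [wp_seq]
    refine wp_mono (wp_agree (wp_sccProg hc hG1 hok1 (x := ⟨i, hi⟩) hxi)) ?_
    rintro t2 s2 ⟨⟨ht2, hfwd, hbwd⟩, hag2⟩
    rw [wp_seq]
    refine wp_mono (wp_agree (wp_subsetProg (n := n) ((hag2.var _ (by decide)).trans
      hG1.states))) ?_
    rintro t3 s3 ⟨⟨ht3, hsub⟩, hag3⟩
    have hI' : s3.var vFlag ≠ 0 ↔ A.Terminal X ⟨i, hi⟩ := by
      rw [hsub]
      exact ⟨fun h y hy => (hbwd y).1 (h y y.2 ((hfwd y).2 hy)),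
        fun h y hy hf => (hbwd ⟨y, hy⟩).2 (h ⟨y, hy⟩ ((hfwd ⟨y, hy⟩).1 hf))⟩
    have hst3 : s3.arr aState = s1.arr aState := by
      rw [hag3.arr _ (by decide), hag2.arr _ (by decide)]
    have hn3 : s3.var vNode = s.var vNode := by
      rw [hag3.var _ (by decide), hag2.var _ (by decide), hnode1]
    have hS3 : s3.var xS = i := by
      rw [hag3.var _ (by decide), hag2.var _ (by decide), hxi]
    simp only [wp_when, wp_write, Expr.eval, Expr.cost, hn3, hS3, Store.setVar_arr,
      Store.setArr_arr]
    refine ⟨fun hf => ⟨by omega, fun u hu => ?_, Or.inl ⟨⟨i, hi⟩, by simp, hx1.1 hcomp,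
      hI'.1 hf⟩⟩, fun hf => ⟨by omega, fun u hu => ?_, ?_⟩⟩
    · rw [if_neg (by simp [hu]), hst3, hI1 u hu]
    · rw [hst3, hI1 u hu]
    · rw [hst3]
      exact hstep fun h => hI'.2 h.2 hf
  · rintro t s' ht hag ⟨hI1, hI2⟩
    refine ⟨?_, hI1, ?_⟩
    · have h3 : n * (n * c) ≤ n * (n * (n * c)) := Nat.le_mul_of_pos_left _ hn
      have h4 : n * (120 * (n * (n * c)) + n * 16 + 24 + 8) =
        120 * (n * (n * (n * c))) + 16 * (n * n) + 32 * n := by ring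
      have h5 : n * n ≤ n * (n * (n * c)) := Nat.mul_le_mul_left n h2
      omega
    · refine hI2.resolve_right fun h => ?_
      obtain ⟨y, hy, hty⟩ := A.exists_terminal X x
      exact h y y.2 hy hty

/-- Finds the greatest priority of the admitted transitions from the states in the array
`aComp`. -/
def topProg : Prog :=
  .assign vTop (.const 0) ;;
  .for xE vEdges (.when (.get aComp (.get aSrc (.var xE))) (.when (.get aOk (.var xE))
    (.when (.sub (.get aPrio (.var xE)) (.var vTop)) (.assign vTop (.get aPrio (.var xE)))))) ;;
  .write aTop (.var vNode) (.var vTop)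

theorem wp_topProg {A : ParityAutomaton (Fin n) (Fin c)} {s : Store}
    (hG : HoldsGraph A s) {X : Set (Fin c)} (hX : X.Nonempty)
    (hok : ∀ (q : Fin n) (a : Fin c), s.arr aOk (q * c + a) ≠ 0 ↔ a ∈ X) {x : Fin n}
    (hx : ∀ y : Fin n, s.arr aComp y ≠ 0 ↔ A.ReachIn X x y) :
    wp topProg s fun t s' => t ≤ 40 * (n * c) ∧
      (∀ u, u ≠ s.var vNode → s'.arr aTop u = s.arr aTop u) ∧
      s'.arr aTop (s.var vNode) = s'.var vTop ∧
      IsGreatest (A.prio '' A.edgesIn X x) (s'.var vTop) := by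
  have hc : 0 < c := hX.some.pos
  have hn : 0 < n := x.pos
  rw [topProg, wp_seq, wp_assign, wp_seq]
  simp only [Expr.eval, Expr.cost]
  refine wp_for 17 (fun e s' =>
    (∀ (q : Fin n) (a : Fin c), (q : ℕ) * c + a < e → (q, a) ∈ A.edgesIn X x →
      (A.δ q a).2 ≤ s'.var vTop) ∧
    (s'.var vTop = 0 ∨ s'.var vTop ∈ A.prio '' A.edgesIn X x)) (by decide) (by decide)
    (m := n * c) (by rw [Store.setVar_var, if_neg (by decide)]; exact hG.edges)
    (by simp [Store.setVar_var]) ?_ ?_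
  · rintro e s1 he hxe hag ⟨hI1, hI2⟩
    obtain ⟨q, a, rfl⟩ := exists_edge he
    have h1 : s1.arr aSrc (q * c + a) = q := by
      rw [hag.arr _ (by decide), Store.setVar_arr, hG.src]
    have h2 : s1.arr aComp q ≠ 0 ↔ A.ReachIn X x q := by
      rw [hag.arr _ (by decide), Store.setVar_arr, hx]
    have h3 : s1.arr aOk (q * c + a) ≠ 0 ↔ a ∈ X := by
      rw [hag.arr _ (by decide), Store.setVar_arr, hok]
    have h4 : s1.arr aPrio (q * c + a) = (A.δ q a).2 := by
      rw [hag.arr _ (by decide), Store.setVar_arr, hG.prio]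
    have key : ∀ k, s1.var vTop ≤ k → ((q, a) ∈ A.edgesIn X x → (A.δ q a).2 ≤ k) →
        ∀ (q' : Fin n) (a' : Fin c), (q' : ℕ) * c + a' < (q : ℕ) * c + a + 1 →
        (q', a') ∈ A.edgesIn X x → (A.δ q' a').2 ≤ k := by
      intro k hk hk' q' a' hlt hm
      rcases Nat.lt_succ_iff_lt_or_eq.1 hlt with hlt | heq
      · exact (hI1 q' a' hlt hm).trans hk
      · obtain ⟨rfl, rfl⟩ := edge_inj.1 heq
        exact hk' hm
    simp only [wp_when, wp_assign, Expr.eval, Expr.cost, hxe, h1, h4, Store.setVar_var,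
      Nat.reduceEqDiff, if_false, if_true]
    refine ⟨fun k1 => ⟨fun k2 => ⟨fun k3 => ⟨by omega, key _ (by omega) fun _ => le_rfl, ?_⟩,
      fun k3 => ⟨by omega, key _ le_rfl fun _ => Nat.sub_eq_zero_iff_le.1 k3, hI2⟩⟩,
      fun k2 => ⟨by omega, key _ le_rfl fun hm => ?_, hI2⟩⟩,
      fun k1 => ⟨by omega, key _ le_rfl fun hm => ?_, hI2⟩⟩
    · exact Or.inr ⟨(q, a), ⟨h3.1 k2, h2.1 k1⟩, rfl⟩
    · exact absurd k2 (h3.2 hm.1)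
    · exact absurd k1 (h2.2 hm.2)
  · rintro t s1 ht hag ⟨hI1, hI2⟩
    have h1 : s1.var vNode = s.var vNode := by
      rw [hag.var _ (by decide), Store.setVar_var, if_neg (by decide)]
    have h2 : s1.arr aTop = s.arr aTop := hag.arr _ (by decide)
    simp only [wp_write, Expr.eval, Expr.cost, Store.setArr_arr, Store.setArr_var, h1, h2]
    have h3 : 1 ≤ n * c := Nat.mul_pos hn hc
    have hub : ∀ e ∈ A.edgesIn X x, A.prio e ≤ s1.var vTop := fun e he =>
      hI1 e.1 e.2 (edge_lt _ _) he
    refine ⟨by omega, fun u hu => by simp [hu], by simp, ?_, ?_⟩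
    · rcases hI2 with h0 | h0
      · obtain ⟨a, ha⟩ := hX
        have he : (x, a) ∈ A.edgesIn X x := ⟨ha, Reach.refl _⟩
        have := hub _ he
        exact ⟨(x, a), he, by omega⟩
      · exact h0
    · rintro _ ⟨e, he, rfl⟩
      exact hub e he

/-- Finds the component of the current node: the search for a terminal state starts in the state of
the parent. -/
def nodeProg : Prog :=
  lettersProg ;;
  .assign vStart (.get aState (.get aPar (.var vNode))) ;;
  searchProg aSrc aTgt aComp ;;
  terminalProg ;;
  .assign vStart (.get aState (.var vNode)) ;;
  searchProg aSrc aTgt aComp ;;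
  topProg

theorem wp_nodeProg {A : ParityAutomaton (Fin n) (Fin c)} {s : Store}
    (hG : HoldsGraph A s) {v : ℕ} (hv : s.var vNode = v) (hr : s.var vRow = v * c)
    (hX : (s.label c v).Nonempty) {x : Fin n} (hx : s.arr aState (s.arr aPar v) = x) :
    wp nodeProg s fun t s' => t ≤ 400 * (n * (n * (n * c))) ∧
      (∀ u, u ≠ v → s'.arr aState u = s.arr aState u) ∧
      (∀ u, u ≠ v → s'.arr aTop u = s.arr aTop u) ∧
      s'.arr aTop v = s'.var vTop ∧
      ∃ y : Fin n, s'.arr aState v = y ∧ A.ReachIn (s.label c v) x y ∧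
        A.Terminal (s.label c v) y ∧
        (∀ z : Fin n, s'.arr aComp z ≠ 0 ↔ A.ReachIn (s.label c v) y z) ∧
        IsGreatest (A.prio '' A.edgesIn (s.label c v) y) (s'.var vTop) := by
  have hc : 0 < c := hX.some.pos
  have hn : 0 < n := x.pos
  rw [nodeProg, wp_seq]
  refine wp_mono (wp_agree (wp_lettersProg hG hr)) ?_
  rintro t1 s1 ⟨⟨ht1, hok1⟩, hag1⟩
  have hG1 : HoldsGraph A s1 := hG.of_agree hag1 (by decide) (by decide)
  have hx1 : s1.arr aState (s1.arr aPar (s1.var vNode)) = x := by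
    rw [hag1.arr _ (by decide), hag1.arr _ (by decide), hag1.var _ (by decide), hv, hx]
  rw [wp_seq, wp_assign, wp_seq]
  simp only [Expr.eval, Expr.cost, hx1]
  have hags : Agree nodeProg.vars [] s1 (s1.setVar vStart x) :=
    (Agree.refl _ [] s1).setVar (by decide) _
  refine wp_mono (wp_agree (wp_search_fwd hc (hG1.of_agree hags (by decide) (by decide)) hok1
    (x := x) (by simp [Store.setVar_var]) (o := aComp) (by decide))) ?_
  rintro t2 s2 ⟨⟨ht2, hcomp2⟩, hag2⟩
  have hag2' : Agree nodeProg.vars [aOk, aComp] s s2 :=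
    ((hag1.mono (by decide) (by decide)).trans (hags.mono (by decide) (by decide))).trans
      (hag2.mono (by decide) (by decide))
  have hok2 : ∀ (q : Fin n) (a : Fin c), s2.arr aOk (q * c + a) ≠ 0 ↔ a ∈ s.label c v := by
    rw [hag2.arr _ (by decide)]; exact hok1
  have hG2 : HoldsGraph A s2 := hG.of_agree hag2' (by decide) (by decide)
  have hv2 : s2.var vNode = v := (hag2'.var _ (by decide)).trans hv
  rw [wp_seq]
  refine wp_mono (wp_agree (wp_terminalProg hc hG2 hok2 hcomp2)) ?_
  rintro t3 s3 ⟨⟨ht3, hst3, y, hy3, hxy, hty⟩, hag3⟩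
  rw [hv2] at hst3 hy3
  have hG3 : HoldsGraph A s3 := hG2.of_agree hag3 (by decide) (by decide)
  have hv3 : s3.var vNode = v := (hag3.var _ (by decide)).trans hv2
  rw [wp_seq, wp_assign, wp_seq]
  simp only [Expr.eval, Expr.cost, hv3, hy3]
  have hags' : Agree nodeProg.vars [] s3 (s3.setVar vStart y) :=
    (Agree.refl _ [] s3).setVar (by decide) _
  refine wp_mono (wp_agree (wp_search_fwd hc (hG3.of_agree hags' (by decide) (by decide))
    (ok := fun _ a => a ∈ s.label c v)
    (by rw [Store.setVar_arr, hag3.arr _ (by decide)]; exact hok2)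
    (x := y) (by simp [Store.setVar_var]) (o := aComp) (by decide))) ?_
  rintro t4 s4 ⟨⟨ht4, hcomp4⟩, hag4⟩
  have hag4' : Agree nodeProg.vars [aComp] s3 s4 :=
    (hags'.mono (by simp) (by simp)).trans (hag4.mono (by decide) (by decide))
  have hG4 : HoldsGraph A s4 := hG3.of_agree hag4' (by decide) (by decide)
  refine wp_mono (wp_agree (wp_topProg hG4 hX (by
    rw [hag4'.arr _ (by decide), hag3.arr _ (by decide)]; exact hok2) hcomp4)) ?_
  rintro t5 s5 ⟨⟨ht5, htop, htop', hgr⟩, hag5⟩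
  have hv4 : s4.var vNode = v := by
    rw [hag4.var _ (by decide), Store.setVar_var, if_neg (by decide), hv3]
  rw [hv4] at htop htop'
  have hst5 : s5.arr aState = s3.arr aState := by
    rw [hag5.arr _ (by decide), hag4'.arr _ (by decide)]
  refine ⟨?_, fun u hu => ?_, fun u hu => ?_, htop', y, ?_, hxy, hty, ?_, hgr⟩
  · have h1 : 1 ≤ n * c := Nat.mul_pos hn hc
    have h2 : n * c ≤ n * (n * c) := Nat.le_mul_of_pos_left _ hn
    have h3 : n * (n * c) ≤ n * (n * (n * c)) := Nat.le_mul_of_pos_left _ hn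
    omega
  · rw [hst5, hst3 u hu, hag2'.arr _ (by decide)]
  · rw [htop u hu, hag4'.arr _ (by decide), hag3.arr _ (by decide), hag2'.arr _ (by decide)]
  · rw [hst5, hy3]
  · rw [hag5.arr _ (by decide)]
    exact hcomp4

/-! ### Candidates for the children of a node -/

/-- Computes the set of letters of the component of the state in `xS`, tests in `vFlagAux` whether
the component has a transition of priority `vPrio`, and stores in `vSize` the number of letters
plus `xK`. -/
def candProg : Prog :=
  sccProg ;;
  .for xA vLetters (.write aSet (.var xA) (.const 0)) ;;
  .assign vFlagAux (.const 0) ;;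
  .for xE vEdges (.when (.get aOk (.var xE)) (.when (.get aFwd (.get aSrc (.var xE)))
    (.when (.get aBwd (.get aTgt (.var xE))) (
      .write aSet (.get aLet (.var xE)) (.const 1) ;;
      .ite (.sub (.var vPrio) (.get aPrio (.var xE))) .skip (.assign vFlagAux (.const 1)))))) ;;
  .assign vSize (.var xK) ;;
  .for xA vLetters (.assign vSize (.add (.var vSize) (.get aSet (.var xA))))

theorem wp_candProg {A : ParityAutomaton (Fin n) (Fin c)} {s : Store}
    (hG : HoldsGraph A s) {X : Set (Fin c)} {q : ℕ} (hq : s.var vPrio = q)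
    (hok : ∀ (q' : Fin n) (a : Fin c), s.arr aOk (q' * c + a) ≠ 0 ↔ A.okUpTo X q q' a)
    {x : Fin n} (hx : s.var xS = x) (hc : 0 < c) :
    wp candProg s fun t s' => t ≤ 250 * (n * (n * c)) ∧
      (∀ a : Fin c, s'.arr aSet a ≤ 1 ∧ (s'.arr aSet a ≠ 0 ↔ a ∈ A.sccLetters X q x)) ∧
      (s'.var vFlagAux ≠ 0 ↔ q ∈ A.prio '' A.sccEdges (A.okUpTo X q) x) ∧
      s'.var vSize = s.var xK + (A.sccLetters X q x).ncard := by
  classical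
  have hn : 0 < n := x.pos
  rw [candProg, wp_seq]
  refine wp_mono (wp_agree (wp_sccProg hc hG hok hx)) ?_
  rintro t1 s1 ⟨⟨ht1, hfwd, hbwd⟩, hag1⟩
  have hG1 := hG.of_agree hag1 (by decide) (by decide)
  rw [wp_seq]
  refine wp_for 3 (fun i s' => ∀ a < i, s'.arr aSet a = 0) (by decide) (by decide)
    hG1.letters (by simp) ?_ ?_
  · intro i s2 hi hxi _ hI
    simp only [wp_write, Expr.eval, Expr.cost, hxi, Store.setVar_arr, Store.setArr_arr]
    refine ⟨le_rfl, fun a ha => ?_⟩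
    split_ifs with h
    · rfl
    · exact hI a (by simp at h; omega)
  intro t2 s2 ht2 hag2 hz
  have hG2 := hG1.of_agree hag2 (by decide) (by decide)
  rw [wp_seq, wp_assign, wp_seq]
  simp only [Expr.eval, Expr.cost]
  refine wp_for 25 (fun e s' =>
    (∀ a : Fin c, s'.arr aSet a ≤ 1 ∧ (s'.arr aSet a ≠ 0 ↔ ∃ q' : Fin n, (q' : ℕ) * c + a < e ∧
      (q', a) ∈ A.sccEdges (A.okUpTo X q) x)) ∧
    (s'.var vFlagAux ≠ 0 ↔ ∃ (q' : Fin n) (a : Fin c), (q' : ℕ) * c + a < e ∧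
      (q', a) ∈ A.sccEdges (A.okUpTo X q) x ∧ (A.δ q' a).2 = q))
    (by decide) (by decide) (m := n * c)
    (by rw [Store.setVar_var, if_neg (by decide), hG2.edges]) ?_ ?_ ?_
  · simp [Store.setVar_arr, Store.setVar_var]
    exact fun a => ⟨(hz a a.2).trans_le zero_le_one, hz a a.2⟩
  · rintro e s3 he hxe hag3 ⟨hI1, hI2⟩
    obtain ⟨q', a, rfl⟩ := exists_edge he
    have ha3 : ∀ b, b ≠ aSet → s3.arr b = s1.arr b := fun b hb => by
      rw [hag3.arr _ (by simpa [Prog.arrs, Prog.when] using hb), Store.setVar_arr,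
        hag2.arr _ (by simpa [Prog.arrs] using hb)]
    have h1 : s3.arr aSrc (q' * c + a) = q' := by rw [ha3 _ (by decide), hG1.src]
    have h2 : s3.arr aTgt (q' * c + a) = (A.δ q' a).1 := by rw [ha3 _ (by decide), hG1.tgt]
    have h3 : s3.arr aPrio (q' * c + a) = (A.δ q' a).2 := by rw [ha3 _ (by decide), hG1.prio]
    have h4 : s3.arr aLet (q' * c + a) = a := by rw [ha3 _ (by decide), hG1.letter]
    have h5 : s3.arr aOk (q' * c + a) ≠ 0 ↔ A.okUpTo X q q' a := by
      rw [ha3 _ (by decide), hag1.arr _ (by decide), hok]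
    have h6 : s3.arr aFwd q' ≠ 0 ↔ A.Reach (A.okUpTo X q) x q' := by
      rw [ha3 _ (by decide), hfwd]
    have h7 : s3.arr aBwd (A.δ q' a).1 ≠ 0 ↔ A.Reach (A.okUpTo X q) (A.δ q' a).1 x := by
      rw [ha3 _ (by decide), hbwd]
    have h8 : s3.var vPrio = q := by
      rw [hag3.var _ (by decide), Store.setVar_var, if_neg (by decide), hag2.var _ (by decide),
        hag1.var _ (by decide), hq]
    -- the effect of one more transition on the two invariants
    have hsplit1 : ∀ b : Fin c, (∃ p : Fin n, (p : ℕ) * c + b < (q' : ℕ) * c + a + 1 ∧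
        (p, b) ∈ A.sccEdges (A.okUpTo X q) x) ↔
        (∃ p : Fin n, (p : ℕ) * c + b < (q' : ℕ) * c + a ∧
          (p, b) ∈ A.sccEdges (A.okUpTo X q) x) ∨
        (b = a ∧ (q', a) ∈ A.sccEdges (A.okUpTo X q) x) := by
      intro b
      constructor
      · rintro ⟨p, hlt, hp⟩
        rcases Nat.lt_succ_iff_lt_or_eq.1 hlt with hlt | heq
        · exact Or.inl ⟨p, hlt, hp⟩
        · obtain ⟨rfl, rfl⟩ := edge_inj.1 heq
          exact Or.inr ⟨rfl, hp⟩
      · rintro (⟨p, hlt, hp⟩ | ⟨rfl, hp⟩)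
        · exact ⟨p, by omega, hp⟩
        · exact ⟨q', by omega, hp⟩
    have hsplit2 : (∃ (p : Fin n) (b : Fin c), (p : ℕ) * c + b < (q' : ℕ) * c + a + 1 ∧
        (p, b) ∈ A.sccEdges (A.okUpTo X q) x ∧ (A.δ p b).2 = q) ↔
        (∃ (p : Fin n) (b : Fin c), (p : ℕ) * c + b < (q' : ℕ) * c + a ∧
          (p, b) ∈ A.sccEdges (A.okUpTo X q) x ∧ (A.δ p b).2 = q) ∨
        ((q', a) ∈ A.sccEdges (A.okUpTo X q) x ∧ (A.δ q' a).2 = q) := by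
      constructor
      · rintro ⟨p, b, hlt, hp⟩
        rcases Nat.lt_succ_iff_lt_or_eq.1 hlt with hlt | heq
        · exact Or.inl ⟨p, b, hlt, hp⟩
        · obtain ⟨rfl, rfl⟩ := edge_inj.1 heq
          exact Or.inr hp
      · rintro (⟨p, b, hlt, hp⟩ | hp)
        · exact ⟨p, b, by omega, hp⟩
        · exact ⟨q', a, by omega, hp⟩
    simp only [hsplit1, hsplit2, ← hI2, ← (hI1 _).2]
    have hskip : (q', a) ∉ A.sccEdges (A.okUpTo X q) x →
        (∀ b : Fin c, s3.arr aSet b ≤ 1 ∧ (s3.arr aSet b ≠ 0 ↔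
          s3.arr aSet b ≠ 0 ∨ (b = a ∧ (q', a) ∈ A.sccEdges (A.okUpTo X q) x))) ∧
        (s3.var vFlagAux ≠ 0 ↔ s3.var vFlagAux ≠ 0 ∨
          ((q', a) ∈ A.sccEdges (A.okUpTo X q) x ∧ (A.δ q' a).2 = q)) := by
      intro hno
      exact ⟨fun b => ⟨(hI1 b).1, Or.inl, fun h => h.resolve_right fun h' => hno h'.2⟩,
        Or.inl, fun h => h.resolve_right fun h' => hno h'.1⟩
    have hset : (q', a) ∈ A.sccEdges (A.okUpTo X q) x → ∀ b : Fin c,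
        (if (b : ℕ) = a then 1 else s3.arr aSet b) ≤ 1 ∧
        ((if (b : ℕ) = a then 1 else s3.arr aSet b) ≠ 0 ↔
          s3.arr aSet b ≠ 0 ∨ (b = a ∧ (q', a) ∈ A.sccEdges (A.okUpTo X q) x)) := by
      intro hm b
      by_cases hb : b = a
      · simp [hb, hm]
      · have : (b : ℕ) ≠ a := fun h => hb (Fin.ext h)
        simp [hb, this, (hI1 b).1]
    simp only [wp_when, wp_seq, wp_write, wp_ite, wp_skip, wp_assign, Expr.eval, Expr.cost, hxe,
      h1, h2, h3, h4, Store.setArr_var, Store.setVar_var, Store.setVar_arr, Store.setArr_arr,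
      Nat.reduceEqDiff, if_false, if_true, true_and, false_and, h8]
    refine ⟨fun k1 => ⟨fun k2 => ⟨fun k3 => ?_, fun k3 => ⟨by omega, hskip fun hm => ?_⟩⟩,
      fun k2 => ⟨by omega, hskip fun hm => ?_⟩⟩, fun k1 => ⟨by omega, hskip fun hm => ?_⟩⟩
    · have hm : (q', a) ∈ A.sccEdges (A.okUpTo X q) x := ⟨h5.1 k1, h6.1 k2, h7.1 k3⟩
      have hle : (A.δ q' a).2 ≤ q := hm.1.2
      refine ⟨fun k4 => ⟨by omega, hset hm, ?_⟩, fun k4 => ⟨by omega, hset hm, ?_⟩⟩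
      · constructor
        · exact Or.inl
        · rintro (h | h)
          · exact h
          · exact absurd h.2 (by omega)
      · exact iff_of_true (by simp) (Or.inr ⟨hm, by omega⟩)
    · exact h7.2 hm.2.2 k3
    · exact h6.2 hm.2.1 k2
    · exact h5.2 hm.1 k1
  rintro t3 s3 ht3 hag3 ⟨hI1, hI2⟩
  have hC : ∀ a : Fin c, s3.arr aSet a ≤ 1 ∧
      (s3.arr aSet a ≠ 0 ↔ a ∈ A.sccLetters X q x) := by
    refine fun a => ⟨(hI1 a).1, (hI1 a).2.trans ⟨?_, ?_⟩⟩
    · rintro ⟨p, -, hp⟩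
      exact ⟨_, hp, rfl⟩
    · rintro ⟨⟨p, b⟩, hp, rfl⟩
      exact ⟨p, edge_lt p b, hp⟩
  have hflag : s3.var vFlagAux ≠ 0 ↔ q ∈ A.prio '' A.sccEdges (A.okUpTo X q) x := by
    rw [hI2]
    constructor
    · rintro ⟨p, b, -, hp, h⟩
      exact ⟨_, hp, h⟩
    · rintro ⟨⟨p, b⟩, hp, h⟩
      exact ⟨p, b, edge_lt p b, hp, h⟩
  have hk3 : s3.var xK = s.var xK := by
    rw [hag3.var _ (by decide), Store.setVar_var, if_neg (by decide), hag2.var _ (by decide),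
      hag1.var _ (by decide)]
  rw [wp_seq, wp_assign]
  simp only [Expr.eval, Expr.cost, hk3]
  refine wp_for 5 (fun i s' => s'.var vSize = s.var xK + ∑ a ∈ Finset.range i, s3.arr aSet a)
    (by decide) (by decide) (m := c) ?_ (by simp [Store.setVar_var]) ?_ ?_
  · rw [Store.setVar_var, if_neg (by decide), hag3.var _ (by decide), Store.setVar_var,
      if_neg (by decide), hG2.letters]
  · intro i s4 hi hxi hag4 hI
    have : s4.arr aSet = s3.arr aSet := hag4.arr _ (by decide)
    simp only [wp_assign, Expr.eval, Expr.cost, hxi, hI, this, Store.setVar_var,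
      Nat.reduceEqDiff, if_false, if_true, Finset.sum_range_succ]
    exact ⟨le_rfl, by omega⟩
  intro t4 s4 ht4 hag4 hI
  have hset4 : s4.arr aSet = s3.arr aSet := hag4.arr _ (by decide)
  have hflag4 : s4.var vFlagAux = s3.var vFlagAux := by
    rw [hag4.var _ (by decide), Store.setVar_var, if_neg (by decide)]
  rw [hset4, hflag4, hI]
  refine ⟨?_, hC, hflag, ?_⟩
  · have h1 : 1 ≤ c := hc
    have h2 : c ≤ n * c := Nat.le_mul_of_pos_left _ hn
    have h3 : n * c ≤ n * (n * c) := Nat.le_mul_of_pos_left _ hn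
    omega
  · congr 1
    rw [Finset.sum_range, Set.ncard_eq_toFinset_card', Finset.card_eq_sum_ones,
      ← Finset.sum_subset (Finset.subset_univ (A.sccLetters X q x).toFinset)]
    · refine Finset.sum_congr rfl fun a ha => ?_
      have := (hC a).2.2 (Set.mem_toFinset.1 ha)
      have := (hC a).1
      omega
    · intro a _ ha
      by_contra hne
      exact ha (Set.mem_toFinset.2 ((hC a).2.1 hne))

/-- Tests whether the set in the array `aSet` is contained in the label of none of the children
found so far. -/
def newProg : Prog :=
  .assign vFlag (.const 1) ;;
  .assign vTestRow (.var vChildRow) ;;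
  .assign vCount (.sub (.var vNodes) (.var vChild)) ;;
  .for xT vCount (
    .assign vFlagAux (.const 1) ;;
    .for xA vLetters (.when (.get aSet (.var xA))
      (.ite (.get aLab (.add (.var vTestRow) (.var xA))) .skip (.assign vFlagAux (.const 0)))) ;;
    .assign vTestRow (.add (.var vTestRow) (.var vLetters)) ;;
    .when (.var vFlagAux) (.assign vFlag (.const 0)))

theorem wp_newProg {s : Store} {C : Set (Fin c)}
    (hC : ∀ a : Fin c, s.arr aSet a ≠ 0 ↔ a ∈ C) (hc : s.var vLetters = c)
    (hrow : s.var vChildRow = s.var vChild * c) (hle : s.var vChild ≤ s.var vNodes) :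
    wp newProg s fun t s' => t ≤ (s.var vNodes - s.var vChild) * (c * 20 + 40) + 20 ∧
      (s'.var vFlag ≠ 0 ↔ ∀ w, s.var vChild ≤ w → w < s.var vNodes → ¬ C ⊆ s.label c w) := by
  set w₀ := s.var vChild with hw₀
  simp only [newProg, wp_seq, wp_assign, Expr.eval, Expr.cost, Store.setVar_var, Nat.reduceEqDiff,
    if_false, hrow]
  refine wp_for (c * 20 + 30) (fun i s' => s'.var vTestRow = (w₀ + i) * c ∧
    (s'.var vFlag ≠ 0 ↔ ∀ j < i, ¬ C ⊆ s.label c (w₀ + j))) (by decide) (by decide)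
    (m := s.var vNodes - w₀) (by simp [Store.setVar_var, hw₀]) (by simp [Store.setVar_var]) ?_ ?_
  · rintro i s1 hi hxi hag1 ⟨hI1, hI2⟩
    have hset1 : s1.arr aSet = s.arr aSet := hag1.arr _ (by decide)
    have hlab1 : s1.arr aLab = s.arr aLab := hag1.arr _ (by decide)
    have hc1 : s1.var vLetters = c := by
      rw [hag1.var _ (by decide)]; simp [Store.setVar_var, hc]
    rw [wp_seq, wp_assign, wp_seq]
    simp only [Expr.eval, Expr.cost]
    refine wp_for 10 (fun k s' => s'.var vFlagAux ≠ 0 ↔ ∀ a : Fin c, (a : ℕ) < k → a ∈ C →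
      a ∈ s.label c (w₀ + i)) (by decide) (by decide) (m := c)
      (by simp [Store.setVar_var, hc1]) (by simp [Store.setVar_var]) ?_ ?_
    · intro k s2 hk hxk hag2 hJ
      have h1 : s2.arr aSet k ≠ 0 ↔ (⟨k, hk⟩ : Fin c) ∈ C := by
        rw [hag2.arr _ (by decide), Store.setVar_arr, hset1]; exact hC ⟨k, hk⟩
      have h2 : s2.arr aLab ((w₀ + i) * c + k) ≠ 0 ↔ (⟨k, hk⟩ : Fin c) ∈ s.label c (w₀ + i) := by
        rw [hag2.arr _ (by decide), Store.setVar_arr, hlab1]; exact Iff.rfl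
      have h3 : s2.var vTestRow = (w₀ + i) * c := by
        rw [hag2.var _ (by decide), Store.setVar_var, if_neg (by decide), hI1]
      have hsplit : (∀ a : Fin c, (a : ℕ) < k + 1 → a ∈ C → a ∈ s.label c (w₀ + i)) ↔
          s2.var vFlagAux ≠ 0 ∧ ((⟨k, hk⟩ : Fin c) ∈ C →
            (⟨k, hk⟩ : Fin c) ∈ s.label c (w₀ + i)) := by
        rw [hJ]
        constructor
        · exact fun h => ⟨fun a ha => h a (by omega), h ⟨k, hk⟩ (by simp)⟩
        · rintro ⟨h, h'⟩ a ha
          rcases Nat.lt_succ_iff_lt_or_eq.1 ha with hlt | rfl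
          · exact h a hlt
          · exact h'
      simp only [wp_when, wp_ite, wp_skip, wp_assign, Expr.eval, Expr.cost, hxk, h3,
        Store.setVar_var, hsplit, Nat.reduceEqDiff, if_false, if_true]
      refine ⟨fun k1 => ⟨fun k2 => ⟨by omega, ?_⟩, fun k2 => ⟨by omega, ?_⟩⟩,
        fun k1 => ⟨by omega, ?_⟩⟩
      · exact ⟨fun h => ⟨h, fun _ => h2.1 k2⟩, fun h => h.1⟩
      · exact ⟨fun h => absurd rfl h, fun h => absurd k2 (h2.2 (h.2 (h1.1 k1)))⟩
      · exact ⟨fun h => ⟨h, fun hm => absurd k1 (h1.2 hm)⟩, fun h => h.1⟩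
    · intro t s2 ht hag2 hJ
      have h3 : s2.var vTestRow = (w₀ + i) * c := by
        rw [hag2.var _ (by decide), Store.setVar_var, if_neg (by decide), hI1]
      have h4 : s2.var vLetters = c := by
        rw [hag2.var _ (by decide), Store.setVar_var, if_neg (by decide), hc1]
      have h5 : s2.var vFlag = s1.var vFlag := by
        rw [hag2.var _ (by decide), Store.setVar_var, if_neg (by decide)]
      have hJ' : s2.var vFlagAux ≠ 0 ↔ C ⊆ s.label c (w₀ + i) := by
        rw [hJ]
        exact ⟨fun h a ha => h a a.2 ha, fun h a _ ha => h ha⟩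
      have hsplit : (∀ j < i + 1, ¬ C ⊆ s.label c (w₀ + j)) ↔
          s1.var vFlag ≠ 0 ∧ ¬ C ⊆ s.label c (w₀ + i) := by
        rw [hI2]
        exact Nat.forall_lt_succ_right
      have hmul : (w₀ + i) * c + c = (w₀ + (i + 1)) * c := by ring
      simp only [wp_seq, wp_when, wp_assign, Expr.eval, Expr.cost, h3, h4, h5, Store.setVar_var,
        hsplit, Nat.reduceEqDiff, if_false, if_true, hmul, true_and]
      refine ⟨fun k1 => ⟨by omega, ?_⟩, fun k1 => ⟨by omega, ?_⟩⟩
      · exact ⟨fun h => absurd rfl h, fun h => absurd (hJ'.1 k1) h.2⟩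
      · exact ⟨fun h => ⟨h, fun hs => hJ'.2 hs k1⟩, fun h => h.1⟩
  · rintro t s1 ht _ ⟨_, hI⟩
    refine ⟨?_, hI.trans ⟨fun h w h1 h2 => ?_, fun h j hj => h _ (by omega) (by omega)⟩⟩
    · have : c * 20 + 30 + 8 ≤ c * 20 + 40 := by omega
      have := Nat.mul_le_mul_left (s.var vNodes - w₀) this
      omega
    · have := h (w - w₀) (by omega)
      rwa [Nat.add_sub_cancel' h1] at this

/-- Appends a child of the current node, with the label in the array `aSet`. -/
def appendProg : Prog :=
  .write aPar (.var vNodes) (.var vNode) ;;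
  .for xA vLetters (.write aLab (.add (.var vNewRow) (.var xA)) (.get aSet (.var xA))) ;;
  .assign vNodes (.add (.var vNodes) (.const 1)) ;;
  .assign vNewRow (.add (.var vNewRow) (.var vLetters))

theorem wp_appendProg {s : Store} {N : ℕ} (hN : s.var vNodes = N) (hc : s.var vLetters = c)
    (hrow : s.var vNewRow = N * c) :
    wp appendProg s fun t s' => t ≤ c * 14 + 20 ∧
      s'.var vNodes = N + 1 ∧ s'.var vNewRow = (N + 1) * c ∧
      (∀ w, w ≠ N → s'.arr aPar w = s.arr aPar w) ∧ s'.arr aPar N = s.var vNode ∧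
      (∀ w < N, ∀ a < c, s'.arr aLab (w * c + a) = s.arr aLab (w * c + a)) ∧
      ∀ a < c, s'.arr aLab (N * c + a) = s.arr aSet a := by
  rw [appendProg, wp_seq, wp_write, wp_seq]
  simp only [Expr.eval, Expr.cost, hN]
  refine wp_for 6 (fun i s' =>
    (∀ w < N, ∀ a < c, s'.arr aLab (w * c + a) = s.arr aLab (w * c + a)) ∧
      ∀ a < i, s'.arr aLab (N * c + a) = s.arr aSet a) (by decide) (by decide)
    (m := c) hc ?_ ?_ ?_
  · refine ⟨fun w _ a _ => ?_, by simp⟩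
    rw [Store.setVar_arr, Store.setArr_arr_of_ne _ _ _ (by decide)]
  · rintro i s1 hi hxi hag ⟨hI1, hI2⟩
    have h1 : s1.arr aSet = s.arr aSet := by
      rw [hag.arr _ (by decide), Store.setArr_arr_of_ne _ _ _ (by decide)]
    have h2 : s1.var vNewRow = N * c := by rw [hag.var _ (by decide), Store.setArr_var, hrow]
    simp only [wp_write, Expr.eval, Expr.cost, hxi, h1, h2, Store.setVar_arr, Store.setArr_arr,
      true_and]
    refine ⟨le_rfl, fun w hw a ha => ?_, fun a ha => ?_⟩
    · rw [if_neg, hI1 w hw a ha]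
      rw [row_inj ha hi]
      omega
    · by_cases hai : a = i
      · rw [if_pos (by rw [hai]), hai]
      · rw [if_neg (by omega), hI2 a (by omega)]
  · rintro t s1 ht hag ⟨hI1, hI2⟩
    have h2 : s1.var vNewRow = N * c := by rw [hag.var _ (by decide), Store.setArr_var, hrow]
    have h3 : s1.var vNodes = N := by rw [hag.var _ (by decide), Store.setArr_var, hN]
    have h4 : s1.var vLetters = c := by rw [hag.var _ (by decide), Store.setArr_var, hc]
    have h5 : s1.arr aPar = (s.setArr aPar N (s.var vNode)).arr aPar := hag.arr _ (by decide)
    simp only [wp_seq, wp_assign, Expr.eval, Expr.cost, h2, h3, h4, h5, Store.setVar_var,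
      Store.setVar_arr, Nat.reduceEqDiff, if_false, if_true, Store.setArr_arr, true_and, and_true]
    exact ⟨by omega, by ring, fun w hw => by simp [hw], hI1, hI2⟩

/-! ### Growing the tree -/

theorem IsUpperTree.snoc {S : Type*} {F : Set (Set S)} {N : ℕ} {par par' : ℕ → ℕ}
    {lab lab' : ℕ → Set S} (h : IsUpperTree F N par lab) (hp : ∀ w < N, par' w = par w)
    (hl : ∀ w < N, lab' w = lab w) (hpN : par' N < N)
    (hmem : lab' N ∈ maxAlternating F (lab (par' N)))
    (hnew : ∀ w, 0 < w → w < N → par w = par' N → lab w ≠ lab' N) :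
    IsUpperTree F (N + 1) par' lab' where
  pos := Nat.succ_pos N
  par_zero := by rw [hp 0 h.pos, h.par_zero]
  par_lt w h0 hw := by
    rcases Nat.lt_succ_iff_lt_or_eq.1 hw with hw | rfl
    · rw [hp w hw]; exact h.par_lt w h0 hw
    · exact hpN
  root := by rw [hl 0 h.pos, h.root]
  inj v w hv0 hv hw0 hw he hle := by
    rcases Nat.lt_succ_iff_lt_or_eq.1 hv with hv | rfl <;>
      rcases Nat.lt_succ_iff_lt_or_eq.1 hw with hw | rfl
    · rw [hp v hv, hp w hw] at he
      rw [hl v hv, hl w hw] at hle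
      exact h.inj v w hv0 hv hw0 hw he hle
    · rw [hp v hv] at he
      rw [hl v hv] at hle
      exact absurd hle (hnew v hv0 hv he)
    · rw [hp w hw] at he
      rw [hl w hw] at hle
      exact absurd hle.symm (hnew w hw0 hw he.symm)
    · rfl
  mem w h0 hw := by
    rcases Nat.lt_succ_iff_lt_or_eq.1 hw with hw | rfl
    · rw [hl w hw, hp w hw, hl _ ((h.par_lt w h0 hw).trans hw)]
      exact h.mem w h0 hw
    · rw [hl _ hpN]; exact hmem

theorem IsNested.congr {Q S : Type*} {A : ParityAutomaton Q S} {par par' : ℕ → ℕ}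
    {lab lab' : ℕ → Set S} {r : ℕ → Q} {i : ℕ} (h : IsNested A par lab r i)
    (hp : ∀ w < i, par' w = par w) (hl : ∀ w < i, lab' w = lab w)
    (hlt : ∀ w, 0 < w → w < i → par w < i) : IsNested A par' lab' r i where
  reach := h.reach
  terminal v hv := by rw [hl v hv]; exact h.terminal v hv
  nested v hv h0 := by rw [hp v hv, hl _ (hlt v h0 hv)]; exact h.nested v hv h0

/-! ### The search for the children of a node -/

/-- The memory during the search for the children of the node `v` with label `X = lab₀ v`, which
are numbered from `N₀` on; `par₀` and `lab₀` describe the tree before the search, and the component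
of `v` is that of the state `x`. -/
structure ChildSearch (A : ParityAutomaton (Fin n) (Fin c)) (F : Set (Set (Fin c)))
    (par₀ : ℕ → ℕ) (lab₀ : ℕ → Set (Fin c)) (v N₀ p : ℕ) (x : Fin n) (s : Store) : Prop where
  graph : HoldsGraph A s
  node : s.var vNode = v
  row : s.var vRow = v * c
  top : s.var vTop = p
  child : s.var vChild = N₀
  childRow : s.var vChildRow = N₀ * c
  newRow : s.var vNewRow = s.var vNodes * c
  le : N₀ ≤ s.var vNodes
  comp : ∀ z : Fin n, s.arr aComp z ≠ 0 ↔ A.ReachIn (lab₀ v) x z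
  tree : IsUpperTree F (s.var vNodes) (s.arr aPar) (s.label c)
  par_lt : ∀ w, 0 < w → w < N₀ → par₀ w < v
  old_par : ∀ w < N₀, s.arr aPar w = par₀ w
  old_lab : ∀ w < N₀, s.label c w = lab₀ w
  new : ∀ w, N₀ ≤ w → w < s.var vNodes → s.arr aPar w = v
  bit : ∀ w < s.var vNodes, ∀ a < c, s.arr aLab (w * c + a) ≤ 1

/-- The set `C` is contained in the label of a node from number `N₀` on. -/
def Covered (c N₀ : ℕ) (s : Store) (C : Set (Fin c)) : Prop :=
  ∃ w, N₀ ≤ w ∧ w < s.var vNodes ∧ C ⊆ s.label c w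

/-- The component of `y` for the priorities up to `q` yields an alternating subset of the label `X`
of a node whose component is that of `x` and has greatest priority `p`. -/
def IsCandidate (A : ParityAutomaton (Fin n) (Fin c)) (X : Set (Fin c)) (p : ℕ) (x : Fin n)
    (q : ℕ) (y : Fin n) : Prop :=
  A.ReachIn X x y ∧ (Even q ↔ ¬ Even p) ∧ q ∈ A.prio '' A.sccEdges (A.okUpTo X q) y

/-- The candidate given by `q` and `y`, if it is one and has at least `k` letters, is covered. -/
def Handled (A : ParityAutomaton (Fin n) (Fin c)) (X : Set (Fin c)) (N₀ p : ℕ) (x : Fin n)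
    (k : ℕ) (s : Store) (q : ℕ) (y : Fin n) : Prop :=
  IsCandidate A X p x q y → k ≤ (A.sccLetters X q y).ncard → Covered c N₀ s (A.sccLetters X q y)

section ChildSearch

variable {A : ParityAutomaton (Fin n) (Fin c)} {F : Set (Set (Fin c))} {par₀ : ℕ → ℕ}
  {lab₀ : ℕ → Set (Fin c)} {v N₀ p : ℕ} {x : Fin n} {s : Store}

theorem Store.label_congr {s s' : Store} (h : s'.arr aLab = s.arr aLab) :
    s'.label c = s.label c := by
  funext w
  simp only [Store.label, h]

theorem Covered.of_agree {s' : Store} {V U : List ℕ} (hs : Agree V U s s') (hV : vNodes ∉ V)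
    (hU : aLab ∉ U) {C : Set (Fin c)} (h : Covered c N₀ s C) : Covered c N₀ s' C := by
  obtain ⟨w, h1, h2, h3⟩ := h
  exact ⟨w, h1, by rwa [hs.var _ hV], by rwa [Store.label_congr (hs.arr _ hU)]⟩

theorem ChildSearch.of_agree (h : ChildSearch A F par₀ lab₀ v N₀ p x s) {s' : Store}
    {V U : List ℕ} (hs : Agree V U s s')
    (hV : ∀ x ∈ [vStates, vLetters, vEdges, vPrios, vNode, vRow, vTop, vChild, vChildRow, vNewRow,
      vNodes], x ∉ V)
    (hU : ∀ a ∈ [aTgt, aPrio, aSrc, aLet, aList, aComp, aPar, aLab], a ∉ U) :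
    ChildSearch A F par₀ lab₀ v N₀ p x s' := by
  have hg : HoldsGraph A s' := h.graph.of_agree hs
    (fun x hx => hV x (by simp only [List.mem_cons, List.not_mem_nil, or_false] at hx ⊢; tauto))
    (fun a ha => hU a (by simp only [List.mem_cons, List.not_mem_nil, or_false] at ha ⊢; tauto))
  simp only [List.mem_cons, List.not_mem_nil, or_false, forall_eq_or_imp, forall_eq] at hV hU
  obtain ⟨-, -, -, -, h6, h7, h21, h24, h25, h8, h3⟩ := hV
  obtain ⟨-, -, -, -, -, k7, k2, k3⟩ := hU
  have hl := Store.label_congr (c := c) (hs.arr _ k3)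
  constructor
  · exact hg
  · rw [hs.var _ h6, h.node]
  · rw [hs.var _ h7, h.row]
  · rw [hs.var _ h21, h.top]
  · rw [hs.var _ h24, h.child]
  · rw [hs.var _ h25, h.childRow]
  · rw [hs.var _ h8, hs.var _ h3, h.newRow]
  · rw [hs.var _ h3]; exact h.le
  · rw [hs.arr _ k7]; exact h.comp
  · rw [hs.var _ h3, hs.arr _ k2, hl]; exact h.tree
  · exact h.par_lt
  · rw [hs.arr _ k2]; exact h.old_par
  · rw [hl]; exact h.old_lab
  · rw [hs.var _ h3, hs.arr _ k2]; exact h.new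
  · rw [hs.var _ h3, hs.arr _ k3]; exact h.bit

/-- A node has at most as many children as there are states, their components being disjoint. -/
theorem ChildSearch.count_le (hF : A.language = mullerLanguage F)
    (h : ChildSearch A F par₀ lab₀ v N₀ p x s) (hv : v < N₀) : s.var vNodes - N₀ ≤ n := by
  have h1 := card_maxAlternating_le hF (lab₀ v)
  rw [Fintype.card_fin] at h1
  refine le_trans ?_ h1
  rw [← Nat.card_Ico N₀ (s.var vNodes), ← Set.ncard_coe_finset]
  refine Set.ncard_le_ncard_of_injOn (s.label c) ?_ ?_ (Set.toFinite _)
  · intro w hw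
    rw [Finset.coe_Ico, Set.mem_Ico] at hw
    have h2 := h.tree.mem w (by omega) hw.2
    rwa [h.new w hw.1 hw.2, h.old_lab v hv] at h2
  · intro u hu w hw he
    rw [Finset.coe_Ico, Set.mem_Ico] at hu hw
    exact h.tree.inj u w (by omega) hu.2 (by omega) hw.2
      (by rw [h.new u hu.1 hu.2, h.new w hw.1 hw.2]) he

/-- If the candidates with more letters are covered, a candidate that is not covered is a maximal
alternating set. -/
theorem mem_maxAlternating_of_handled (hF : A.language = mullerLanguage F) {X : Set (Fin c)}
    (hxr : A.Reach (fun _ _ => True) A.init x) (hxt : A.Terminal X x)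
    (hp : IsGreatest (A.prio '' A.edgesIn X x) p) {q : ℕ} {y : Fin n}
    (hcand : IsCandidate A X p x q y)
    (hall : ∀ q' y', Handled A X N₀ p x ((A.sccLetters X q y).ncard + 1) s q' y')
    (hnot : ¬ Covered c N₀ s (A.sccLetters X q y)) :
    A.sccLetters X q y ∈ maxAlternating F X := by
  have halt : (A.sccLetters X q y).Nonempty ∧ A.sccLetters X q y ⊆ X ∧
      (A.sccLetters X q y ∈ F ↔ X ∉ F) := by
    refine ⟨sccLetters_nonempty hcand.2.2, sccLetters_subset _ _ _, ?_⟩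
    rw [sccLetters_mem_iff hF (hxr.trans hcand.1.top) hcand.2.2, hxt.mem_iff_even hF hxr hp]
    exact hcand.2.1
  obtain ⟨B, hCB, hB⟩ := Finite.exists_le_maximal
    (p := fun Y : Set (Fin c) => Y.Nonempty ∧ Y ⊆ X ∧ (Y ∈ F ↔ X ∉ F)) halt
  obtain ⟨y', q', h1, h2, h3, h4⟩ := exists_sccLetters_eq hF hxr hxt hp hB
  by_cases heq : A.sccLetters X q y = B
  · rw [heq]; exact hB
  · exfalso
    have hlt := Set.ncard_lt_ncard (Set.ssubset_iff_subset_ne.2 ⟨hCB, heq⟩) (Set.toFinite _)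
    obtain ⟨w, hw1, hw2, hw3⟩ := hall q' y' ⟨h1, h2, h3⟩ (by rw [h4]; exact hlt)
    exact hnot ⟨w, hw1, hw2, hCB.trans (h4 ▸ hw3)⟩

/-- Appends the candidate given by `vPrio` and the state in `xS` if it is one, has `c - xK` letters,
and is not contained in the label of a child found before. -/
def tryProg : Prog :=
  .when (.get aComp (.var xS)) (
    candProg ;;
    .when (.var vFlagAux) (.ite (.dist (.var vSize) (.var vLetters)) .skip (
      newProg ;;
      .when (.var vFlag) appendProg)))

theorem wp_tryProg (hF : A.language = mullerLanguage F) (hc : 0 < c)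
    (h : ChildSearch A F par₀ lab₀ v N₀ p x s) (hv : v < N₀)
    (hxr : A.Reach (fun _ _ => True) A.init x) (hxt : A.Terminal (lab₀ v) x)
    (hp : IsGreatest (A.prio '' A.edgesIn (lab₀ v) x) p) {q : ℕ} (hq : s.var vPrio = q)
    (hqp : Even q ↔ ¬ Even p)
    (hok : ∀ (q' : Fin n) (a : Fin c), s.arr aOk (q' * c + a) ≠ 0 ↔ A.okUpTo (lab₀ v) q q' a)
    {y : Fin n} (hy : s.var xS = y) {i : ℕ} (hi : s.var xK = i) (hic : i < c)
    (hall : ∀ q' y', Handled A (lab₀ v) N₀ p x (c - i + 1) s q' y') :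
    wp tryProg s fun t s' => t ≤ 400 * (n * (n * c)) ∧ ChildSearch A F par₀ lab₀ v N₀ p x s' ∧
      (∀ C, Covered c N₀ s C → Covered c N₀ s' C) ∧
      Handled A (lab₀ v) N₀ p x (c - i) s' q y := by
  have hn : 0 < n := x.pos
  have hnc1 : 1 ≤ n * c := Nat.mul_pos hn hc
  have hnc2 : n * c ≤ n * (n * c) := Nat.le_mul_of_pos_left _ hn
  have hnc3 : c ≤ n * c := Nat.le_mul_of_pos_left _ hn
  have hnc4 : n ≤ n * c := Nat.le_mul_of_pos_right _ hc
  rw [tryProg, wp_when]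
  simp only [Expr.eval, Expr.cost, hy]
  refine ⟨fun k1 => ?_, fun k1 => ⟨by omega, h, fun _ hC => hC, fun hcand => ?_⟩⟩
  swap
  · exact absurd k1 ((h.comp y).2 hcand.1)
  rw [wp_seq]
  refine wp_mono (wp_agree (wp_candProg h.graph hq hok hy hc)) ?_
  rintro t1 s1 ⟨⟨ht1, hset, hflag, hsize⟩, hag1⟩
  have hs1 := h.of_agree hag1 (by decide) (by decide)
  have hcov1 : ∀ C, Covered c N₀ s C → Covered c N₀ s1 C := fun C hC =>
    hC.of_agree hag1 (by decide) (by decide)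
  have hhand1 : ∀ q' y', Handled A (lab₀ v) N₀ p x (c - i + 1) s1 q' y' :=
    fun q' y' h1 h2 => hcov1 _ (hall q' y' h1 h2)
  set C := A.sccLetters (lab₀ v) q y with hCdef
  rw [hi] at hsize
  simp only [wp_when, wp_ite, wp_skip, Expr.cost, Expr.cost_dist, ne_eq, Expr.eval_dist,
    Expr.eval, hs1.graph.letters, hsize]
  refine ⟨fun k2 => ⟨fun k3 => ⟨by omega, hs1, hcov1, fun hcand hk => ?_⟩, fun k3 => ?_⟩,
    fun k2 => ⟨by omega, hs1, hcov1, fun hcand => ?_⟩⟩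
  · have hk' : c - i ≤ C.ncard := hk
    exact hhand1 q y hcand (show c - i + 1 ≤ C.ncard by omega)
  swap
  · exact absurd k2 (hflag.2 hcand.2.2)
  rw [wp_seq]
  refine wp_mono (wp_agree (wp_newProg (fun a => (hset a).2) hs1.graph.letters
    (by rw [hs1.childRow, hs1.child]) (by rw [hs1.child]; exact hs1.le))) ?_
  rintro t2 s2 ⟨⟨ht2, hnew⟩, hag2⟩
  rw [hs1.child] at ht2 hnew
  have hs2 := hs1.of_agree hag2 (by decide) (by decide)
  have hcov2 : ∀ C, Covered c N₀ s1 C → Covered c N₀ s2 C := fun C hC =>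
    hC.of_agree hag2 (by decide) (by decide)
  have ht2' : t2 ≤ 80 * (n * c) := by
    refine ht2.trans ((Nat.add_le_add_right
      (Nat.mul_le_mul_right (c * 20 + 40) (hs1.count_le hF hv)) 20).trans ?_)
    have : n * (c * 20 + 40) = 20 * (n * c) + 40 * n := by ring
    omega
  have hnew' : s2.var vFlag ≠ 0 ↔ ¬ Covered c N₀ s1 C := by
    rw [hnew]
    exact ⟨fun h ⟨w, h1, h2, h3⟩ => h w h1 h2 h3, fun h w h1 h2 h3 => h ⟨w, h1, h2, h3⟩⟩
  simp only [wp_when, Expr.cost, Expr.eval]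
  refine ⟨fun k4 => ?_, fun k4 => ⟨by omega, hs2, fun D hD => hcov2 D (hcov1 D hD),
    fun hcand hk => hcov2 _ (not_not.1 fun hno => hnew'.2 hno k4)⟩⟩
  have hCcov := hnew'.1 k4
  refine wp_mono (wp_agree (wp_appendProg (N := s2.var vNodes) rfl hs2.graph.letters
    hs2.newRow)) ?_
  rintro t3 s3 ⟨⟨ht3, hN3, hrow3, hpar3, hparN, hlab3, hlabN⟩, hag3⟩
  set N := s2.var vNodes with hNdef
  have hset2 : s2.arr aSet = s1.arr aSet := hag2.arr _ (by decide)
  have hl3 : ∀ w < N, s3.label c w = s2.label c w := by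
    intro w hw
    ext a
    rw [Store.mem_label, Store.mem_label, hlab3 w hw a a.2]
  have hlN : s3.label c N = C := by
    ext a
    rw [Store.mem_label, hlabN a a.2, hset2]
    exact (hset a).2
  have hreach : A.ReachIn (lab₀ v) x y := (h.comp y).1 k1
  have hvN : v < N := hv.trans_le hs2.le
  have hmem : C ∈ maxAlternating F (lab₀ v) := by
    refine mem_maxAlternating_of_handled hF hxr hxt hp ⟨hreach, hqp, hflag.1 k2⟩
      (N₀ := N₀) (s := s1) ?_ hCcov
    have : C.ncard + 1 = c - i + 1 := by omega
    rw [← hCdef, this]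
    exact hhand1
  have hparN' : s3.arr aPar N = v := by rw [hparN, hs2.node]
  have htree : IsUpperTree F (N + 1) (s3.arr aPar) (s3.label c) := by
    refine hs2.tree.snoc (fun w hw => hpar3 w hw.ne) hl3 (by rw [hparN']; exact hvN) ?_ ?_
    · rw [hlN, hparN', hs2.old_lab v hv]; exact hmem
    · intro w hw0 hw hpw hlw
      rw [hparN'] at hpw
      have hw' : N₀ ≤ w := by
        by_contra hlt
        rw [hs2.old_par w (by omega)] at hpw
        exact (hs2.par_lt w hw0 (by omega)).ne hpw
      exact hCcov ⟨w, hw', by rwa [← hag2.var vNodes (by decide)], by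
        rw [← Store.label_congr (hag2.arr aLab (by decide)), hlw, hlN]⟩
  refine ⟨by omega, ?_, ?_, fun _ _ => ?_⟩
  · have hg3 : HoldsGraph A s3 := hs2.graph.of_agree hag3 (by decide) (by decide)
    constructor
    · exact hg3
    · rw [hag3.var _ (by decide), hs2.node]
    · rw [hag3.var _ (by decide), hs2.row]
    · rw [hag3.var _ (by decide), hs2.top]
    · rw [hag3.var _ (by decide), hs2.child]
    · rw [hag3.var _ (by decide), hs2.childRow]
    · rw [hrow3, hN3]
    · rw [hN3]; exact hs2.le.trans (Nat.le_succ _)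
    · rw [hag3.arr _ (by decide)]; exact hs2.comp
    · rw [hN3]; exact htree
    · exact hs2.par_lt
    · intro w hw
      rw [hpar3 w (hw.trans_le hs2.le).ne, hs2.old_par w hw]
    · intro w hw
      rw [hl3 w (hw.trans_le hs2.le), hs2.old_lab w hw]
    · intro w h1 h2
      rw [hN3] at h2
      rcases Nat.lt_succ_iff_lt_or_eq.1 h2 with h2 | rfl
      · rw [hpar3 w h2.ne, hs2.new w h1 h2]
      · exact hparN'
    · intro w hw a ha
      rw [hN3] at hw
      rcases Nat.lt_succ_iff_lt_or_eq.1 hw with hw | rfl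
      · rw [hlab3 w hw a ha]; exact hs2.bit w hw a ha
      · rw [hlabN a ha, hset2]; exact (hset ⟨a, ha⟩).1
  · intro D hD
    obtain ⟨w, h1, h2, h3⟩ := hcov2 D (hcov1 D hD)
    exact ⟨w, h1, by rw [hN3]; omega, by rw [hl3 w h2]; exact h3⟩
  · exact ⟨N, hs2.le, by rw [hN3]; omega, by rw [hlN]⟩

/-- Tries the priority `vPrio` with all states. -/
def prioProg : Prog := limitProg ;; .for xS vStates tryProg

theorem wp_prioProg (hF : A.language = mullerLanguage F) (hc : 0 < c)
    (h : ChildSearch A F par₀ lab₀ v N₀ p x s) (hv : v < N₀)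
    (hxr : A.Reach (fun _ _ => True) A.init x) (hxt : A.Terminal (lab₀ v) x)
    (hp : IsGreatest (A.prio '' A.edgesIn (lab₀ v) x) p) {q : ℕ} (hq : s.var vPrio = q)
    (hqp : Even q ↔ ¬ Even p) {i : ℕ} (hi : s.var xK = i) (hic : i < c)
    (hall : ∀ q' y', Handled A (lab₀ v) N₀ p x (c - i + 1) s q' y') :
    wp prioProg s fun t s' => t ≤ 450 * (n * (n * (n * c))) ∧
      ChildSearch A F par₀ lab₀ v N₀ p x s' ∧
      (∀ C, Covered c N₀ s C → Covered c N₀ s' C) ∧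
      ∀ y, Handled A (lab₀ v) N₀ p x (c - i) s' q y := by
  have hn : 0 < n := x.pos
  rw [prioProg, wp_seq]
  refine wp_mono (wp_agree (wp_limitProg h.graph h.row)) ?_
  rintro t1 s1 ⟨⟨ht1, hok⟩, hag1⟩
  rw [h.old_lab v hv, hq] at hok
  have hs1 := h.of_agree hag1 (by decide) (by decide)
  have hcov1 : ∀ C, Covered c N₀ s C → Covered c N₀ s1 C := fun C hC =>
    hC.of_agree hag1 (by decide) (by decide)
  refine wp_for (400 * (n * (n * c))) (fun j s' => ChildSearch A F par₀ lab₀ v N₀ p x s' ∧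
    (∀ C, Covered c N₀ s C → Covered c N₀ s' C) ∧
    ∀ y : Fin n, (y : ℕ) < j → Handled A (lab₀ v) N₀ p x (c - i) s' q y)
    (by decide) (by decide) hs1.graph.states ?_ ?_ ?_
  · refine ⟨hs1.of_agree ((Agree.refl [xS] [] s1).setVar (by simp) 0) (by decide) (by decide),
      hcov1, by simp⟩
  · rintro j s2 hj hxj hag2 ⟨hI1, hI2, hI3⟩
    refine wp_mono (wp_tryProg hF hc hI1 hv hxr hxt hp (q := q) ?_ hqp ?_ (y := ⟨j, hj⟩) hxj
      (i := i) ?_ hic ?_) ?_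
    · rw [hag2.var _ (by decide), hag1.var _ (by decide), hq]
    · rw [hag2.arr _ (by decide)]; exact hok
    · rw [hag2.var _ (by decide), hag1.var _ (by decide), hi]
    · exact fun q' y' h1 h2 => hI2 _ (hall q' y' h1 h2)
    · rintro t s3 ⟨ht, hs3, hcov3, hhand⟩
      have hag3 := (Agree.refl [xS] [] s3).setVar (x := xS) (by simp) (j + 1)
      refine ⟨ht, hs3.of_agree hag3 (by decide) (by decide), fun C hC => hcov3 C (hI2 C hC), ?_⟩
      intro y hy h1 h2
      rcases Nat.lt_succ_iff_lt_or_eq.1 hy with hlt | rfl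
      · exact hcov3 _ (hI3 y hlt h1 h2)
      · exact hhand h1 h2
  · rintro t s2 ht _ ⟨hI1, hI2, hI3⟩
    refine ⟨?_, hI1, hI2, fun y => hI3 y y.2⟩
    have h1 : 1 ≤ n * c := Nat.mul_pos hn hc
    have h2 : n * c ≤ n * (n * c) := Nat.le_mul_of_pos_left _ hn
    have h3 : n * (n * c) ≤ n * (n * (n * c)) := Nat.le_mul_of_pos_left _ hn
    have h4 : n ≤ n * c := Nat.le_mul_of_pos_right _ hc
    have h5 : n * (400 * (n * (n * c)) + 8) = 400 * (n * (n * (n * c))) + 8 * n := by ring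
    omega

/-- Tries all priorities whose parity is not that of the priority of the current node. -/
def sizeProg : Prog :=
  .for xJ vPrios (
    .assign vPrio (.get aList (.var xJ)) ;;
    .when (.parity (.add (.var vTop) (.var vPrio))) prioProg)

theorem wp_sizeProg (hF : A.language = mullerLanguage F) (hc : 0 < c)
    (h : ChildSearch A F par₀ lab₀ v N₀ p x s) (hv : v < N₀)
    (hxr : A.Reach (fun _ _ => True) A.init x) (hxt : A.Terminal (lab₀ v) x)
    (hp : IsGreatest (A.prio '' A.edgesIn (lab₀ v) x) p) {i : ℕ} (hi : s.var xK = i) (hic : i < c)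
    (hall : ∀ q' y', Handled A (lab₀ v) N₀ p x (c - i + 1) s q' y') :
    wp sizeProg s fun t s' => t ≤ 500 * (A.priorities.card * (n * (n * (n * c)))) ∧
      ChildSearch A F par₀ lab₀ v N₀ p x s' ∧
      ∀ q y, Handled A (lab₀ v) N₀ p x (c - i) s' q y := by
  have hn : 0 < n := x.pos
  have hd := card_priorities_pos A hc
  have h1 : 1 ≤ n * c := Nat.mul_pos hn hc
  have h2 : n * c ≤ n * (n * c) := Nat.le_mul_of_pos_left _ hn
  have h3 : n * (n * c) ≤ n * (n * (n * c)) := Nat.le_mul_of_pos_left _ hn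
  set d := A.priorities.card with hddef
  refine wp_for (450 * (n * (n * (n * c))) + 20) (fun j s' =>
    ChildSearch A F par₀ lab₀ v N₀ p x s' ∧
    (∀ C, Covered c N₀ s C → Covered c N₀ s' C) ∧
    ∀ j' < j, ∀ y, Handled A (lab₀ v) N₀ p x (c - i) s' (s.arr aList j') y)
    (by decide) (by decide) h.graph.prios ?_ ?_ ?_
  · exact ⟨h.of_agree ((Agree.refl [xJ] [] s).setVar (by simp) 0) (by decide) (by decide),
      fun _ hC => hC, by simp⟩
  · rintro j s1 hj hxj hag1 ⟨hI1, hI2, hI3⟩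
    have hlist : s1.arr aList = s.arr aList := hag1.arr _ (by decide)
    rw [wp_seq, wp_assign]
    simp only [Expr.eval, Expr.cost, hxj, hlist]
    set q := s.arr aList j with hqdef
    have hs2 := hI1.of_agree ((Agree.refl [vPrio] [] s1).setVar (x := vPrio) (by simp) q)
      (by decide) (by decide)
    have hpar : (Expr.parity (.add (.var vTop) (.var vPrio))).eval (s1.setVar vPrio q) = 0 ↔
        (Even p ↔ Even q) := by
      rw [Expr.eval_parity, ← Nat.even_add]
      simp only [Expr.eval, Store.setVar_var, hI1.top]
      simp
    have hsplit : ∀ s' : Store, (∀ j' < j, ∀ y, Handled A (lab₀ v) N₀ p x (c - i) s'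
        (s.arr aList j') y) → (∀ y, Handled A (lab₀ v) N₀ p x (c - i) s' q y) →
        ∀ j' < j + 1, ∀ y, Handled A (lab₀ v) N₀ p x (c - i) s' (s.arr aList j') y := by
      intro s' k1 k2 j' hj' y
      rcases Nat.lt_succ_iff_lt_or_eq.1 hj' with hlt | rfl
      · exact k1 j' hlt y
      · exact k2 y
    rw [wp_when]
    simp only [Expr.cost_parity, Expr.cost]
    refine ⟨fun k1 => ?_, fun k1 => ⟨by omega, ?_⟩⟩
    · have hqp : Even q ↔ ¬ Even p := by
        rw [ne_eq, hpar] at k1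
        exact (not_iff.1 k1).symm
      refine wp_mono (wp_prioProg hF hc hs2 hv hxr hxt hp (q := q) ?_ hqp
        (i := i) ?_ hic ?_) ?_
      · simp [Store.setVar_var]
      · rw [Store.setVar_var, if_neg (by decide), hag1.var _ (by decide), hi]
      · exact fun q' y' h1 h2 => hI2 _ (hall q' y' h1 h2)
      · rintro t s3 ⟨ht, hs3, hcov3, hhand⟩
        have hag3 := (Agree.refl [xJ] [] s3).setVar (x := xJ) (by simp) (j + 1)
        refine ⟨by omega, hs3.of_agree hag3 (by decide) (by decide),
          fun C hC => hcov3 C (hI2 C hC), ?_⟩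
        exact hsplit _ (fun j' hj' y h1 h2 => hcov3 _ (hI3 j' hj' y h1 h2)) hhand
    · have hag3 := (Agree.refl [xJ] [] (s1.setVar vPrio q)).setVar (x := xJ) (by simp) (j + 1)
      refine ⟨hs2.of_agree hag3 (by decide) (by decide), hI2, hsplit _ hI3 ?_⟩
      intro y hcand
      have h1 := hcand.2.1
      rw [hpar] at k1
      exact absurd (h1.symm.trans k1.symm) not_iff_self
  · rintro t s1 ht _ ⟨hI1, hI2, hI3⟩
    refine ⟨?_, hI1, fun q y hcand => ?_⟩
    · have h5 : d * (450 * (n * (n * (n * c))) + 20 + 8) =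
        450 * (d * (n * (n * (n * c)))) + 28 * d := by ring
      have h6 : d ≤ d * (n * (n * (n * c))) := Nat.le_mul_of_pos_right _ (by omega)
      have h7 : t ≤ d * (450 * (n * (n * (n * c))) + 20 + 8) + 6 := ht
      show t ≤ 500 * (d * (n * (n * (n * c))))
      omega
    · have hq : q ∈ A.priorities := by
        obtain ⟨e, -, rfl⟩ := hcand.2.2
        exact mem_priorities A e.1 e.2
      obtain ⟨j, hj, rfl⟩ := (h.graph.mem_list q).1 hq
      exact hI3 j hj y hcand

/-- Finds the children of the current node, the larger ones first. -/
def childProg : Prog :=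
  .assign vChild (.var vNodes) ;;
  .assign vChildRow (.var vNewRow) ;;
  .for xK vLetters sizeProg

theorem wp_childProg (hF : A.language = mullerLanguage F) (hc : 0 < c)
    (h : ChildSearch A F par₀ lab₀ v N₀ p x ((s.setVar vChild N₀).setVar vChildRow (N₀ * c)))
    (hN : s.var vNodes = N₀) (hrow : s.var vNewRow = N₀ * c) (hv : v < N₀)
    (hxr : A.Reach (fun _ _ => True) A.init x) (hxt : A.Terminal (lab₀ v) x)
    (hp : IsGreatest (A.prio '' A.edgesIn (lab₀ v) x) p) :
    wp childProg s fun t s' => t ≤ 550 * (c * (A.priorities.card * (n * (n * (n * c))))) ∧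
      ChildSearch A F par₀ lab₀ v N₀ p x s' ∧
      AllChildren F (s'.var vNodes) (s'.arr aPar) (s'.label c) v := by
  have hn : 0 < n := x.pos
  have hd := card_priorities_pos A hc
  set d := A.priorities.card with hddef
  simp only [childProg, wp_seq, wp_assign, Expr.eval, Expr.cost, hN, hrow, Store.setVar_var,
    Nat.reduceEqDiff, if_false]
  refine wp_for (500 * (d * (n * (n * (n * c))))) (fun i s' =>
    ChildSearch A F par₀ lab₀ v N₀ p x s' ∧
    ∀ q y, Handled A (lab₀ v) N₀ p x (c - i + 1) s' q y)
    (by decide) (by decide) h.graph.letters ?_ ?_ ?_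
  · refine ⟨h.of_agree ((Agree.refl [xK] [] _).setVar (by simp) 0) (by decide) (by decide), ?_⟩
    intro q y _ hk
    have := Set.ncard_le_ncard (Set.subset_univ (A.sccLetters (lab₀ v) q y)) (Set.toFinite _)
    rw [Set.ncard_univ, Nat.card_eq_fintype_card, Fintype.card_fin] at this
    omega
  · rintro i s1 hi hxi hag1 ⟨hI1, hI2⟩
    refine wp_mono (wp_sizeProg hF hc hI1 hv hxr hxt hp hxi hi hI2) ?_
    rintro t s2 ⟨ht, hs2, hhand⟩
    refine ⟨ht, hs2.of_agree ((Agree.refl [xK] [] _).setVar (by simp) _) (by decide)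
      (by decide), ?_⟩
    have : c - (i + 1) + 1 = c - i := by omega
    rw [this]
    exact hhand
  · rintro t s1 ht _ ⟨hI1, hI2⟩
    refine ⟨?_, hI1, fun B hB => ?_⟩
    · have h1 : 1 ≤ n * c := Nat.mul_pos hn hc
      have h2 : n * c ≤ n * (n * c) := Nat.le_mul_of_pos_left _ hn
      have h3 : n * (n * c) ≤ n * (n * (n * c)) := Nat.le_mul_of_pos_left _ hn
      have h4 : n * (n * (n * c)) ≤ d * (n * (n * (n * c))) := Nat.le_mul_of_pos_left _ hd
      have h5 : d * (n * (n * (n * c))) ≤ c * (d * (n * (n * (n * c)))) :=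
        Nat.le_mul_of_pos_left _ hc
      have h6 : c * (500 * (d * (n * (n * (n * c)))) + 8) =
        500 * (c * (d * (n * (n * (n * c))))) + 8 * c := by ring
      have h7 : c ≤ c * (d * (n * (n * (n * c)))) := Nat.le_mul_of_pos_right _ (by omega)
      omega
    · rw [hI1.old_lab v hv] at hB
      obtain ⟨y, q, h1, h2, h3, h4⟩ := exists_sccLetters_eq hF hxr hxt hp hB
      have hpos : c - c + 1 ≤ (A.sccLetters (lab₀ v) q y).ncard := by
        rw [Nat.sub_self, zero_add]
        exact (Set.ncard_pos (Set.toFinite _)).2 (sccLetters_nonempty h3)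
      obtain ⟨w, hw1, hw2, hw3⟩ := hI2 q y ⟨h1, h2, h3⟩ hpos
      rw [h4] at hw3
      have hpw := hI1.new w hw1 hw2
      have hmem := hI1.tree.mem w (by omega) hw2
      rw [hpw, hI1.old_lab v hv] at hmem
      exact ⟨w, by omega, hw2, hpw,
        ((maximal_of_mem hB).eq_of_subset (maximal_of_mem hmem).prop hw3).symm⟩

end ChildSearch

/-! ### Building the Zielonka tree -/

/-- The memory when the nodes below `i` of the Zielonka tree have been processed: they have got
their children, and a state that represents their component. -/
structure TreeSearch (A : ParityAutomaton (Fin n) (Fin c)) (F : Set (Set (Fin c))) (i : ℕ)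
    (s : Store) : Prop where
  graph : HoldsGraph A s
  node : s.var vNode = i
  row : s.var vRow = i * c
  newRow : s.var vNewRow = s.var vNodes * c
  le : i ≤ s.var vNodes
  tree : IsUpperTree F (s.var vNodes) (s.arr aPar) (s.label c)
  all : ∀ v < i, AllChildren F (s.var vNodes) (s.arr aPar) (s.label c) v
  par_lt : ∀ w, 0 < w → w < s.var vNodes → s.arr aPar w < i
  bit : ∀ w < s.var vNodes, ∀ a < c, s.arr aLab (w * c + a) ≤ 1
  init : i = 0 → s.arr aState 0 = A.init
  states : ∃ r : ℕ → Fin n, (∀ v < i, s.arr aState v = r v) ∧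
    IsNested A (s.arr aPar) (s.label c) r i ∧
    ∀ v < i, IsGreatest (A.prio '' A.edgesIn (s.label c v) (r v)) (s.arr aTop v)

/-- Processes the current node. -/
def bodyProg : Prog :=
  nodeProg ;;
  childProg ;;
  .assign vNode (.add (.var vNode) (.const 1)) ;;
  .assign vRow (.add (.var vRow) (.var vLetters))

theorem wp_bodyProg {A : ParityAutomaton (Fin n) (Fin c)} {F : Set (Set (Fin c))}
    (hF : A.language = mullerLanguage F) (hc : 0 < c) {i : ℕ} {s : Store}
    (h : TreeSearch A F i s) (hi : i < s.var vNodes) :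
    wp bodyProg s fun t s' => t ≤ 1000 * (c * (A.priorities.card * (n * (n * (n * c))))) ∧
      TreeSearch A F (i + 1) s' := by
  have : Nonempty (Fin c) := ⟨⟨0, hc⟩⟩
  obtain ⟨r, hr1, hr2, hr3⟩ := h.states
  have hn : 0 < n := A.init.pos
  have hd := card_priorities_pos A hc
  -- the state from which the component of the node `i` is searched
  obtain ⟨x, hx, hxr, hxp⟩ : ∃ x : Fin n, s.arr aState (s.arr aPar i) = x ∧
      A.Reach (fun _ _ => True) A.init x ∧ (0 < i → x = r (s.arr aPar i)) := by
    rcases Nat.eq_zero_or_pos i with rfl | h0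
    · refine ⟨A.init, ?_, Reach.refl _, fun h => absurd h (lt_irrefl 0)⟩
      rw [h.tree.par_zero]
      exact h.init rfl
    · have hlt := h.par_lt i h0 hi
      exact ⟨r (s.arr aPar i), hr1 _ hlt, hr2.reach _ hlt, fun _ => rfl⟩
  rw [bodyProg, wp_seq]
  refine wp_mono (wp_agree (wp_nodeProg h.graph h.node h.row (h.tree.lab_nonempty hi) hx)) ?_
  rintro t1 s1 ⟨⟨ht1, hst, htop, htopi, y, hyi, hxy, hty, hcomp, hgr⟩, hag1⟩
  have hlab1 : s1.label c = s.label c := Store.label_congr (hag1.arr _ (by decide))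
  have hpar1 : s1.arr aPar = s.arr aPar := hag1.arr _ (by decide)
  have hN1 : s1.var vNodes = s.var vNodes := hag1.var _ (by decide)
  have hag1' : Agree (vChildRow :: vChild :: nodeProg.vars) nodeProg.arrs s
      ((s1.setVar vChild (s.var vNodes)).setVar vChildRow (s.var vNodes * c)) :=
    ((hag1.mono (by decide) (by decide)).setVar (by decide) _).setVar (by decide) _
  have hyr : A.Reach (fun _ _ => True) A.init y := hxr.trans hxy.top
  have hcs : ChildSearch A F (s.arr aPar) (s.label c) i (s.var vNodes) (s1.var vTop) y
      ((s1.setVar vChild (s.var vNodes)).setVar vChildRow (s.var vNodes * c)) := by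
    constructor
    · exact h.graph.of_agree hag1' (by decide) (by decide)
    · rw [hag1'.var _ (by decide), h.node]
    · rw [hag1'.var _ (by decide), h.row]
    · simp [Store.setVar_var]
    · simp [Store.setVar_var]
    · simp [Store.setVar_var]
    · rw [hag1'.var _ (by decide), hag1'.var _ (by decide), h.newRow]
    · rw [hag1'.var _ (by decide)]
    · exact hcomp
    · rw [hag1'.var _ (by decide), hag1'.arr _ (by decide),
        Store.label_congr (hag1'.arr _ (by decide))]
      exact h.tree
    · exact h.par_lt
    · intro w _
      rw [hag1'.arr _ (by decide)]
    · intro w _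
      rw [Store.label_congr (hag1'.arr _ (by decide))]
    · intro w h1 h2
      rw [hag1'.var _ (by decide)] at h2
      omega
    · rw [hag1'.var _ (by decide), hag1'.arr _ (by decide)]
      exact h.bit
  rw [wp_seq]
  refine wp_mono (wp_agree (wp_childProg hF hc hcs hN1
    (by rw [hag1.var _ (by decide), h.newRow]) hi hyr hty hgr)) ?_
  rintro t2 s2 ⟨⟨ht2, hs2, hall⟩, hag2⟩
  simp only [wp_seq, wp_assign, Expr.eval, Expr.cost, Store.setVar_var, Nat.reduceEqDiff,
    if_false, hs2.node, hs2.row, hs2.graph.letters]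
  set s3 := (s2.setVar vNode (i + 1)).setVar vRow (i * c + c) with hs3
  have hag3 : Agree [vNode, vRow] [] s2 s3 :=
    ((Agree.refl _ _ s2).setVar (by simp) _).setVar (by simp) _
  have hN3 : s3.var vNodes = s2.var vNodes := hag3.var _ (by decide)
  have hlab3 : s3.label c = s2.label c := rfl
  have hpar3 : s3.arr aPar = s2.arr aPar := rfl
  have hst3 : s3.arr aState = s1.arr aState := hag2.arr _ (by decide)
  have htop3 : s3.arr aTop = s1.arr aTop := hag2.arr _ (by decide)
  refine ⟨?_, ?_⟩
  · set d := A.priorities.card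
    have h1 : 1 ≤ n * c := Nat.mul_pos hn hc
    have h2 : n * c ≤ n * (n * c) := Nat.le_mul_of_pos_left _ hn
    have h3 : n * (n * c) ≤ n * (n * (n * c)) := Nat.le_mul_of_pos_left _ hn
    have h4 : n * (n * (n * c)) ≤ d * (n * (n * (n * c))) := Nat.le_mul_of_pos_left _ hd
    have h5 : d * (n * (n * (n * c))) ≤ c * (d * (n * (n * (n * c)))) :=
      Nat.le_mul_of_pos_left _ hc
    omega
  constructor
  · exact hs2.graph.of_agree hag3 (by decide) (by decide)
  · simp [hs3, Store.setVar_var]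
  · simp [hs3, Store.setVar_var, Nat.add_mul]
  · rw [hag3.var _ (by decide), hN3, hs2.newRow]
  · rw [hN3]; exact hi.trans_le hs2.le
  · rw [hN3, hlab3, hpar3]; exact hs2.tree
  · intro v hv
    rw [hN3, hlab3, hpar3]
    rcases Nat.lt_succ_iff_lt_or_eq.1 hv with hv | rfl
    · intro B hB
      rw [hs2.old_lab v (hv.trans hi)] at hB
      obtain ⟨w, hw0, hwN, hpw, hlw⟩ := h.all v hv B hB
      exact ⟨w, hw0, hwN.trans_le hs2.le, by rw [hs2.old_par w hwN, hpw],
        by rw [hs2.old_lab w hwN, hlw]⟩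
    · exact hall
  · intro w hw0 hw
    rw [hN3] at hw
    rw [hpar3]
    by_cases hlt : w < s.var vNodes
    · rw [hs2.old_par w hlt]
      exact (h.par_lt w hw0 hlt).trans (Nat.lt_succ_self i)
    · rw [hs2.new w (by omega) hw]
      exact Nat.lt_succ_self i
  · intro w hw
    rw [hN3] at hw
    exact hs2.bit w hw
  · exact fun h0 => absurd h0 (Nat.succ_ne_zero i)
  · have hri : Function.update r i y i = y := Function.update_self _ _ _
    have hrv : ∀ v < i, Function.update r i y v = r v := fun v hv =>
      Function.update_of_ne hv.ne _ _
    refine ⟨Function.update r i y, fun v hv => ?_, ?_, fun v hv => ?_⟩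
    · rcases Nat.lt_succ_iff_lt_or_eq.1 hv with hv | rfl
      · rw [hrv v hv, hst3, hst v hv.ne, hr1 v hv]
      · rw [hri, hst3, hyi]
    · refine IsNested.congr (par := s.arr aPar) (lab := s.label c) ?_ ?_ ?_ ?_
      · refine ⟨fun v hv => ?_, fun v hv => ?_, fun v hv h0 => ?_⟩ <;>
          rcases Nat.lt_succ_iff_lt_or_eq.1 hv with hv | rfl
        · rw [hrv v hv]; exact hr2.reach v hv
        · rw [hri]; exact hyr
        · rw [hrv v hv]; exact hr2.terminal v hv
        · rw [hri]; exact hty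
        · rw [hrv v hv, hrv _ ((h.tree.par_lt v h0 (hv.trans hi)).trans hv)]
          exact hr2.nested v hv h0
        · rw [hri, hrv _ (h.par_lt v h0 hi), ← hxp h0]
          exact hxy.mono (h.tree.lab_subset hi)
      · exact fun w hw => hs2.old_par w (by omega)
      · exact fun w hw => hs2.old_lab w (by omega)
      · exact fun w h0 hw => (h.tree.par_lt w h0 (by omega)).trans hw
    · rw [hlab3, hs2.old_lab v (by omega)]
      rcases Nat.lt_succ_iff_lt_or_eq.1 hv with hv | rfl
      · rw [hrv v hv, htop3, htop v hv.ne]; exact hr3 v hv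
      · rw [hri, htop3, htopi]; exact hgr

/-- Builds the Zielonka tree. -/
def zielonkaProg : Prog := prepProg ;; .while (.sub (.var vNodes) (.var vNode)) bodyProg

/-- The memory holds the Zielonka tree of `F`, with at most `m` nodes and with priorities that
decrease from each node to its children and tell which labels are in `F`. -/
structure HoldsZielonka (F : Set (Set (Fin c))) (m : ℕ) (s : Store) : Prop where
  letters : s.var vLetters = c
  le : s.var vNodes ≤ m
  tree : IsUpperTree F (s.var vNodes) (s.arr aPar) (s.label c)
  all : ∀ v < s.var vNodes, AllChildren F (s.var vNodes) (s.arr aPar) (s.label c) v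
  bit : ∀ w < s.var vNodes, ∀ a < c, s.arr aLab (w * c + a) ≤ 1
  even : ∀ v < s.var vNodes, (Even (s.arr aTop v) ↔ s.label c v ∈ F)
  lt : ∀ w, 0 < w → w < s.var vNodes → s.arr aTop w < s.arr aTop (s.arr aPar w)

theorem wp_zielonkaProg {A : ParityAutomaton (Fin n) (Fin c)} {F : Set (Set (Fin c))}
    (hF : A.language = mullerLanguage F) (hc : 0 < c) :
    wp zielonkaProg (inputStore A) fun t s' =>
      t ≤ 2000 * (A.priorities.card ^ 2 * c ^ 2 * n ^ 4) ∧
      HoldsZielonka F (n * A.priorities.card) s' := by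
  have hn : 0 < n := A.init.pos
  have hd := card_priorities_pos A hc
  set d := A.priorities.card with hddef
  have hle : ∀ i s, TreeSearch A F i s → i ≤ n * d := by
    intro i s h
    obtain ⟨r, hr1, hr2, hr3⟩ := h.states
    have := hr2.le_card_mul hF h.tree h.le hr3
    rwa [Fintype.card_fin] at this
  rw [zielonkaProg, wp_seq]
  refine wp_mono (wp_prepProg A hc) ?_
  rintro t0 s0 ⟨ht0, hG, hnode, hrow, hN, hnew, hpar, hlab, hst⟩
  refine wp_while (I := TreeSearch A F) (n * d) (1000 * (c * (d * (n * (n * (n * c))))))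
    ?_ hle ?_ ?_
  · have h0 : s0.label c 0 = Set.univ := by
      ext a
      simp [Store.mem_label, hlab a a.2]
    constructor
    · exact hG
    · exact hnode
    · rw [hrow, Nat.zero_mul]
    · rw [hnew, hN, Nat.one_mul]
    · exact Nat.zero_le _
    · rw [hN]
      exact ⟨one_pos, hpar, by intro w; omega, h0, by intro v w; omega, by intro w; omega⟩
    · intro v hv; omega
    · intro w h1 h2; omega
    · intro w hw a ha
      have : w = 0 := by omega
      rw [this, Nat.zero_mul, Nat.zero_add, hlab a ha]
    · exact fun _ => hst
    · exact ⟨fun _ => A.init, by simp, ⟨by simp, by simp, by simp⟩, by simp⟩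
  · intro i s h hne
    simp only [Expr.eval, h.node] at hne
    exact wp_bodyProg hF hc h (by omega)
  · intro i s t h hz ht
    simp only [Expr.eval, Expr.cost, h.node] at hz ht
    have hi : i = s.var vNodes := le_antisymm h.le (by omega)
    refine ⟨?_, ?_⟩
    · have hi' := hle i s h
      set X := c * (d * (n * (n * (n * c)))) with hX
      have h1 : i * (1000 * X + (1 + 1 + 1) + 1) ≤ (n * d) * (1000 * X + 4) :=
        Nat.mul_le_mul_right _ hi'
      have h2 : d ^ 2 * c ^ 2 * n ^ 4 = (n * d) * X := by rw [hX]; ring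
      have h3 : 0 < X := by positivity
      have h4 : n * d ≤ n * d * X := Nat.le_mul_of_pos_right _ h3
      have h5 : n * d * (1000 * X + 4) = 1000 * (n * d * X) + 4 * (n * d) := by ring
      have h6 : d * (n * c) ≤ n * d * X := by
        rw [mul_left_comm, mul_assoc]
        refine Nat.mul_le_mul_left n (Nat.mul_le_mul_left d ?_)
        exact Nat.le_mul_of_pos_right _ (by positivity)
      have h7 : 1 ≤ n * d := Nat.mul_pos hn hd
      have h8 : t0 ≤ 200 * (d * (n * c)) := ht0
      rw [h2]
      omega
    · obtain ⟨r, hr1, hr2, hr3⟩ := h.states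
      have hi' := hle i s h
      subst hi
      exact ⟨h.graph.letters, hi', h.tree, h.all, h.bit,
        fun v hv => ((hr2.terminal v hv).mem_iff_even hF (hr2.reach v hv) (hr3 v hv)).symm,
        fun w h0 hw => hr2.top_lt hF h.tree le_rfl hr3 hw h0⟩

/-! ### The cyclic order of the siblings -/

/-- `z` is the least number with the property `P`, or `0` if there is none. -/
def IsFirst (P : ℕ → Prop) (z : ℕ) : Prop :=
  (z = 0 → ∀ w, ¬ P w) ∧ (z ≠ 0 → P z ∧ ∀ w, P w → z ≤ w)

theorem IsFirst.congr {P P' : ℕ → Prop} {z : ℕ} (h : IsFirst P z) (hP : ∀ w, P w ↔ P' w) :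
    IsFirst P' z := by
  rwa [funext fun w => propext (hP w)] at h

/-- For the tree of the nodes `0, …, N - 1` with parents `par`: `fst u` is the first child of `u`,
`nxt w` is the sibling that follows `w`, and `down u` is a leaf at or below `u`. The value `0`
stands for a missing child or sibling. -/
structure IsSiblingOrder (N : ℕ) (par fst nxt down : ℕ → ℕ) : Prop where
  first : ∀ u < N, IsFirst (fun w => 0 < w ∧ w < N ∧ par w = u) (fst u)
  next : ∀ w, 0 < w → w < N → IsFirst (fun z => w < z ∧ z < N ∧ par z = par w) (nxt w)
  leaf : ∀ u < N, IsLeaf N par (down u)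
  below : ∀ u < N, Below par (down u) u

/-- The sibling that follows `x` in the cyclic order. -/
def cyclicNext (par fst nxt : ℕ → ℕ) (x : ℕ) : ℕ := if nxt x = 0 then fst (par x) else nxt x

namespace IsSiblingOrder

variable {N : ℕ} {par fst nxt down : ℕ → ℕ}

theorem isLeaf_iff (h : IsSiblingOrder N par fst nxt down) {u : ℕ} (hu : u < N) :
    IsLeaf N par u ↔ fst u = 0 := by
  constructor
  · intro hl
    by_contra h0
    obtain ⟨⟨h1, h2, h3⟩, -⟩ := (h.first u hu).2 h0
    exact hl.2 _ h1 h2 h3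
  · exact fun h0 => ⟨hu, fun w h1 h2 h3 => (h.first u hu).1 h0 w ⟨h1, h2, h3⟩⟩

theorem first_spec (h : IsSiblingOrder N par fst nxt down) {x : ℕ} (hx0 : 0 < x) (hx : x < N)
    (hp : par x < N) : 0 < fst (par x) ∧ fst (par x) ≤ x ∧ par (fst (par x)) = par x := by
  have hf := h.first (par x) hp
  have h0 : fst (par x) ≠ 0 := fun h0 => hf.1 h0 x ⟨hx0, hx, rfl⟩
  exact ⟨(hf.2 h0).1.1, (hf.2 h0).2 x ⟨hx0, hx, rfl⟩, (hf.2 h0).1.2.2⟩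

theorem cyclicNext_spec (h : IsSiblingOrder N par fst nxt down) {x : ℕ} (hx0 : 0 < x) (hx : x < N)
    (hp : par x < N) : 0 < cyclicNext par fst nxt x ∧ cyclicNext par fst nxt x < N ∧
      par (cyclicNext par fst nxt x) = par x := by
  rw [cyclicNext]
  split_ifs with h0
  · obtain ⟨h1, h2, h3⟩ := h.first_spec hx0 hx hp
    exact ⟨h1, h2.trans_lt hx, h3⟩
  · obtain ⟨⟨h1, h2, h3⟩, -⟩ := (h.next x hx0 hx).2 h0
    exact ⟨hx0.trans h1, h2, h3⟩

theorem exists_iterate_of_le (h : IsSiblingOrder N par fst nxt down) {z : ℕ} (hz : z < N) :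
    ∀ k x, z = x + k → 0 < x → par x = par z → ∃ l, (cyclicNext par fst nxt)^[l] x = z := by
  intro k
  induction k using Nat.strong_induction_on with
  | _ k ih =>
    intro x hk hx0 hp
    rcases Nat.eq_zero_or_pos k with rfl | hk0
    · exact ⟨0, by simpa using hk.symm⟩
    have hn := h.next x hx0 (by omega)
    have h0 : nxt x ≠ 0 := fun h0 => hn.1 h0 z ⟨by omega, hz, hp.symm⟩
    obtain ⟨⟨h1, h2, h3⟩, h4⟩ := hn.2 h0
    have h5 := h4 z ⟨by omega, hz, hp.symm⟩
    obtain ⟨l, hl⟩ := ih (z - nxt x) (by omega) (nxt x) (by omega) (by omega) (h3.trans hp)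
    refine ⟨l + 1, ?_⟩
    rw [Function.iterate_succ_apply, cyclicNext, if_neg h0, hl]

theorem exists_iterate_eq_first (h : IsSiblingOrder N par fst nxt down) :
    ∀ k x, N = x + k → 0 < x → x < N →
      ∃ l, (cyclicNext par fst nxt)^[l] x = fst (par x) := by
  intro k
  induction k using Nat.strong_induction_on with
  | _ k ih =>
    intro x hk hx0 hx
    by_cases h0 : nxt x = 0
    · exact ⟨1, by rw [Function.iterate_one, cyclicNext, if_pos h0]⟩
    · obtain ⟨⟨h1, h2, h3⟩, -⟩ := (h.next x hx0 hx).2 h0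
      obtain ⟨l, hl⟩ := ih (N - nxt x) (by omega) (nxt x) (by omega) (by omega) h2
      refine ⟨l + 1, ?_⟩
      rw [Function.iterate_succ_apply, cyclicNext, if_neg h0, hl, h3]

theorem exists_iterate_eq (h : IsSiblingOrder N par fst nxt down) {x z : ℕ} (hx0 : 0 < x)
    (hx : x < N) (hz0 : 0 < z) (hz : z < N) (hpN : par z < N) (hp : par x = par z) :
    ∃ k, (cyclicNext par fst nxt)^[k] x = z := by
  obtain ⟨k, hk⟩ := h.exists_iterate_eq_first (N - x) x (by omega) hx0 hx
  obtain ⟨h1, h2, h3⟩ := h.first_spec hz0 hz hpN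
  obtain ⟨l, hl⟩ := h.exists_iterate_of_le hz (z - fst (par z)) (fst (par z)) (by omega) h1 h3
  exact ⟨l + k, by rw [Function.iterate_add_apply, hk, hp, hl]⟩

end IsSiblingOrder

/-! ### Computation of the order of the siblings and of the leaves

The arrays hold, for each node: its first child, its next sibling, a leaf at or below it, the index
of a leaf among the leaves, and its row in the array of labels; then the list of the leaves. -/

notation "aFst" => (20 : ℕ)
notation "aNxt" => (21 : ℕ)
notation "aDown" => (22 : ℕ)
notation "aIdx" => (23 : ℕ)
notation "aRow" => (24 : ℕ)
notation "aLeaves" => (25 : ℕ)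

/-! The registers hold the lowest node at or above the current leaf whose label contains the current
letter, the child of that node at or above the leaf, a node, and the current transition. -/

notation "vSupp" => (28 : ℕ)
notation "vSide" => (29 : ℕ)
notation "vCur" => (30 : ℕ)
notation "vEdge" => (31 : ℕ)

variable {F : Set (Set (Fin c))} {m : ℕ} {s : Store}

theorem HoldsZielonka.of_agree (h : HoldsZielonka F m s) {V U : List ℕ} {s' : Store}
    (hs : Agree V U s s') (hV : ∀ x ∈ [vLetters, vNodes], x ∉ V)
    (hU : ∀ a ∈ [aPar, aLab, aTop], a ∉ U) : HoldsZielonka F m s' := by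
  simp only [List.mem_cons, List.not_mem_nil, or_false, forall_eq_or_imp, forall_eq] at hV hU
  have h1 := hs.var _ hV.1
  have h2 := hs.var _ hV.2
  have h3 := hs.arr _ hU.1
  have h4 := hs.arr _ hU.2.1
  have h5 := hs.arr _ hU.2.2
  have h6 : s'.label c = s.label c := Store.label_congr h4
  obtain ⟨k1, k2, k3, k4, k5, k6, k7⟩ := h
  constructor <;> simp only [h1, h2, h3, h4, h5, h6] <;> assumption

/-- Initialises the arrays for the nodes, and computes the rows. -/
def rowsProg : Prog :=
  .assign vEdge (.const 0) ;;
  .for xI vNodes (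
    .write aFst (.var xI) (.const 0) ;;
    .write aDown (.var xI) (.var xI) ;;
    .write aRow (.var xI) (.var vEdge) ;;
    .assign vEdge (.add (.var vEdge) (.var vLetters)))

theorem wp_rowsProg {N : ℕ} (hN : s.var vNodes = N) (hc : s.var vLetters = c) :
    wp rowsProg s fun t s' => t ≤ 30 * N + 10 ∧ ∀ v < N,
      s'.arr aFst v = 0 ∧ s'.arr aDown v = v ∧ s'.arr aRow v = v * c := by
  rw [rowsProg, wp_seq, wp_assign]
  refine wp_for 20 (fun i s' => s'.var vEdge = i * c ∧ ∀ v < i,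
      s'.arr aFst v = 0 ∧ s'.arr aDown v = v ∧ s'.arr aRow v = v * c)
    (by decide) (by decide) (m := N) ?_ ?_ ?_ ?_
  · rw [Store.setVar_var, if_neg (by decide), hN]
  · simp [Store.setVar_var, Expr.eval]
  · rintro i s1 hi hxi hag ⟨h1, h2⟩
    have hc1 : s1.var vLetters = c := by
      rw [hag.var _ (by decide), Store.setVar_var, if_neg (by decide), hc]
    simp only [wp_seq, wp_write, wp_assign, Expr.eval, Expr.cost, Store.setArr_var, hxi, h1, hc1]
    refine ⟨by omega, by simp [Store.setVar_var, Nat.add_mul], fun v hv => ?_⟩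
    simp only [Store.setVar_arr, Store.setArr_arr]
    rcases Nat.lt_succ_iff_lt_or_eq.1 hv with hlt | rfl
    · have hne : v ≠ i := hlt.ne
      simpa [hne] using h2 v hlt
    · simp
  · rintro t s1 ht - ⟨-, h2⟩
    refine ⟨?_, h2⟩
    simp only [Expr.cost]
    omega

/-- Links the siblings, from the last node to the first. -/
def siblingsProg : Prog :=
  .for xI vNodes (
    .assign vCur (.sub (.var vNodes) (.add (.var xI) (.const 1))) ;;
    .when (.var vCur) (
      .write aNxt (.var vCur) (.get aFst (.get aPar (.var vCur))) ;;
      .write aFst (.get aPar (.var vCur)) (.var vCur) ;;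
      .write aDown (.get aPar (.var vCur)) (.get aDown (.var vCur))))

theorem wp_siblingsProg {N : ℕ} (hN : s.var vNodes = N)
    (hlt : ∀ w, 0 < w → w < N → s.arr aPar w < w)
    (hs : ∀ v < N, s.arr aFst v = 0 ∧ s.arr aDown v = v) :
    wp siblingsProg s fun t s' => t ≤ 60 * N + 10 ∧
      IsSiblingOrder N (s.arr aPar) (s'.arr aFst) (s'.arr aNxt) (s'.arr aDown) := by
  set par := s.arr aPar with hpar
  -- after `i` rounds, the nodes from `N - i` on are linked
  refine wp_for 40 (fun i s' =>
      (∀ u < N, IsFirst (fun w => 0 < w ∧ w < N ∧ par w = u ∧ N ≤ w + i) (s'.arr aFst u)) ∧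
      (∀ w, 0 < w → w < N → N ≤ w + i →
        IsFirst (fun z => w < z ∧ z < N ∧ par z = par w) (s'.arr aNxt w)) ∧
      (∀ u < N, (s'.arr aFst u = 0 ∧ s'.arr aDown u = u) ∨
        (IsLeaf N par (s'.arr aDown u) ∧ Below par (s'.arr aDown u) u)))
    (by decide) (by decide) hN ?_ ?_ ?_
  · refine ⟨fun u hu => ?_, fun w _ _ _ => by omega, fun u hu => Or.inl (hs u hu)⟩
    rw [Store.setVar_arr, (hs u hu).1]
    exact ⟨fun _ w hw => by omega, fun h => absurd rfl h⟩
  · rintro i s1 hi hxi hag ⟨h1, h2, h3⟩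
    have hp1 : s1.arr aPar = par := hag.arr _ (by decide)
    have hN1 : s1.var vNodes = N := by rw [hag.var _ (by decide), hN]
    obtain ⟨w, hw⟩ : ∃ w, w + (i + 1) = N := ⟨N - (i + 1), by omega⟩
    have hw' : N - (i + 1) = w := by omega
    have hwN : w < N := by omega
    simp only [wp_seq, wp_write, wp_assign, wp_when, Expr.eval, Expr.cost, Store.setArr_var, hxi,
      hN1, Store.setVar_var, Store.setVar_arr, hw', if_true, hp1]
    refine ⟨fun hw0 => ⟨by omega, ?_⟩, fun hw0 => ⟨by omega, ?_⟩⟩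
    · have hw0' : 0 < w := Nat.pos_of_ne_zero hw0
      have hpw := hlt w hw0' hwN
      have hpN := hpw.trans hwN
      simp only [Store.setArr_arr, Store.setVar_arr, hp1, Nat.reduceEqDiff, false_and, true_and,
        if_false]
      refine ⟨fun u hu => ?_, fun y hy0 hyN hy => ?_, fun u hu => ?_⟩
      · split_ifs with hup
        · refine ⟨fun h0 => absurd h0 hw0, fun _ => ⟨⟨hw0', hwN, hup.symm, by omega⟩, ?_⟩⟩
          rintro y ⟨-, -, -, hy⟩
          omega
        · refine (h1 u hu).congr fun y => ?_
          constructor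
          · rintro ⟨k1, k2, k3, k4⟩
            exact ⟨k1, k2, k3, by omega⟩
          · rintro ⟨k1, k2, k3, k4⟩
            refine ⟨k1, k2, k3, ?_⟩
            have : y ≠ w := by rintro rfl; exact hup k3.symm
            omega
      · split_ifs with hyw
        · subst hyw
          refine (h1 _ hpN).congr fun z => ?_
          constructor
          · rintro ⟨k1, k2, k3, k4⟩
            exact ⟨by omega, k2, k3⟩
          · rintro ⟨k1, k2, k3⟩
            exact ⟨by omega, k2, k3, by omega⟩
        · exact h2 y hy0 hyN (by omega)
      · by_cases hup : u = par w
        · subst hup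
          right
          rw [if_pos rfl]
          rcases h3 w hwN with ⟨k1, k2⟩ | ⟨k1, k2⟩
          · rw [k2]
            refine ⟨⟨hwN, fun y hy0 hyN hyp => ?_⟩, .parent w⟩
            have := hlt y hy0 hyN
            exact (h1 w hwN).1 k1 y ⟨hy0, hyN, hyp, by omega⟩
          · exact ⟨k1, k2.trans (.parent w)⟩
        · rw [if_neg hup, if_neg hup]
          exact h3 u hu
    · refine ⟨fun u hu => (h1 u hu).congr fun y => ?_, fun y hy0 hyN hy => h2 y hy0 hyN (by omega),
        h3⟩
      constructor
      · rintro ⟨k1, k2, k3, k4⟩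
        exact ⟨k1, k2, k3, by omega⟩
      · rintro ⟨k1, k2, k3, k4⟩
        exact ⟨k1, k2, k3, by omega⟩
  · rintro t s1 ht - ⟨h1, h2, h3⟩
    have hleaf : ∀ u < N, s1.arr aFst u = 0 → IsLeaf N par u := fun u hu h0 =>
      ⟨hu, fun w hw0 hwN hwp => (h1 u hu).1 h0 w ⟨hw0, hwN, hwp, by omega⟩⟩
    refine ⟨by omega, fun u hu => (h1 u hu).congr fun y => ?_, fun w h0 hw => h2 w h0 hw (by omega),
      fun u hu => ?_, fun u hu => ?_⟩
    · constructor
      · rintro ⟨k1, k2, k3, k4⟩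
        exact ⟨k1, k2, k3⟩
      · rintro ⟨k1, k2, k3⟩
        exact ⟨k1, k2, k3, by omega⟩
    · rcases h3 u hu with ⟨k1, k2⟩ | ⟨k1, k2⟩
      · rw [k2]; exact hleaf u hu k1
      · exact k1
    · rcases h3 u hu with ⟨k1, k2⟩ | ⟨k1, k2⟩
      · rw [k2]; exact .refl u
      · exact k2

/-- `list 0, …, list (m - 1)` are the leaves, without repetition, and `idx` is the inverse. -/
structure IsLeafList (N : ℕ) (par : ℕ → ℕ) (list idx : ℕ → ℕ) (m : ℕ) : Prop where
  leaf : ∀ j < m, IsLeaf N par (list j)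
  idx_list : ∀ j < m, idx (list j) = j
  idx_lt : ∀ v, IsLeaf N par v → idx v < m
  list_idx : ∀ v, IsLeaf N par v → list (idx v) = v

theorem IsLeafList.le_ncard {N m : ℕ} {par list idx : ℕ → ℕ} (h : IsLeafList N par list idx m) :
    m ≤ {v | IsLeaf N par v}.ncard := by
  have hfin : {v | IsLeaf N par v}.Finite := (Set.finite_Iio N).subset fun v hv => hv.1
  rw [← Set.ncard_Iio_nat m]
  refine Set.ncard_le_ncard_of_injOn list (fun j hj => h.leaf j hj) ?_ hfin
  intro j hj k hk he
  rw [← h.idx_list j hj, ← h.idx_list k hk, he]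

/-- Lists the leaves. -/
def leavesProg : Prog :=
  .assign vStates (.const 0) ;;
  .for xI vNodes (.ite (.get aFst (.var xI)) .skip (
    .write aIdx (.var xI) (.var vStates) ;;
    .write aLeaves (.var vStates) (.var xI) ;;
    .assign vStates (.add (.var vStates) (.const 1))))

theorem wp_leavesProg {N : ℕ} {par : ℕ → ℕ} (hN : s.var vNodes = N)
    (hleaf : ∀ u < N, IsLeaf N par u ↔ s.arr aFst u = 0) :
    wp leavesProg s fun t s' => t ≤ 40 * N + 10 ∧ s'.var vStates ≤ N ∧
      IsLeafList N par (s'.arr aLeaves) (s'.arr aIdx) (s'.var vStates) := by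
  rw [leavesProg, wp_seq, wp_assign]
  refine wp_for 20 (fun i s' => s'.var vStates ≤ i ∧
      (∀ j < s'.var vStates, IsLeaf N par (s'.arr aLeaves j) ∧ s'.arr aLeaves j < i ∧
        s'.arr aIdx (s'.arr aLeaves j) = j) ∧
      ∀ v < i, IsLeaf N par v → s'.arr aIdx v < s'.var vStates ∧
        s'.arr aLeaves (s'.arr aIdx v) = v)
    (by decide) (by decide) (m := N) ?_ ?_ ?_ ?_
  · rw [Store.setVar_var, if_neg (by decide), hN]
  · simp [Store.setVar_var, Expr.eval]
  · rintro i s1 hi hxi hag ⟨h1, h2, h3⟩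
    have hf1 : s1.arr aFst = s.arr aFst := hag.arr _ (by decide)
    simp only [wp_ite, wp_skip, wp_seq, wp_write, wp_assign, Expr.eval, Expr.cost, hxi, hf1,
      Store.setArr_var]
    refine ⟨fun h0 => ⟨by omega, ?_⟩, fun h0 => ⟨by omega, ?_⟩⟩
    · simp only [Store.setVar_var, Store.setVar_arr, Nat.reduceEqDiff, if_false]
      refine ⟨by omega, fun j hj => ⟨(h2 j hj).1, by have := (h2 j hj).2.1; omega, (h2 j hj).2.2⟩,
        fun v hv hl => ?_⟩
      rcases Nat.lt_succ_iff_lt_or_eq.1 hv with hlt | rfl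
      · exact h3 v hlt hl
      · exact absurd ((hleaf v hi).1 hl) h0
    · simp only [Store.setVar_var, Store.setVar_arr, Store.setArr_arr, Nat.reduceEqDiff, if_false,
        if_true, true_and, false_and]
      refine ⟨by omega, fun j hj => ?_, fun v hv hl => ?_⟩
      · rcases Nat.lt_succ_iff_lt_or_eq.1 hj with hlt | rfl
        · obtain ⟨k1, k2, k3⟩ := h2 j hlt
          rw [if_neg hlt.ne, if_neg k2.ne]
          exact ⟨k1, by omega, k3⟩
        · rw [if_pos rfl, if_pos rfl]
          exact ⟨(hleaf i hi).2 h0, Nat.lt_succ_self i, rfl⟩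
      · rcases Nat.lt_succ_iff_lt_or_eq.1 hv with hlt | rfl
        · obtain ⟨k1, k2⟩ := h3 v hlt hl
          rw [if_neg hlt.ne, if_neg k1.ne]
          exact ⟨by omega, k2⟩
        · simp
  · rintro t s1 ht - ⟨h1, h2, h3⟩
    simp only [Expr.cost]
    exact ⟨by omega, h1, fun j hj => (h2 j hj).1, fun j hj => (h2 j hj).2.2,
      fun v hv => (h3 v hv.1 hv).1, fun v hv => (h3 v hv.1 hv).2⟩

/-! ### Construction of the minimal automaton -/

/-- The memory holds the Zielonka tree of `F`, with the order of the siblings and the list of the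
leaves. -/
structure HoldsLeaves (F : Set (Set (Fin c))) (m : ℕ) (s : Store) : Prop where
  zielonka : HoldsZielonka F m s
  row : ∀ v < s.var vNodes, s.arr aRow v = v * c
  order : IsSiblingOrder (s.var vNodes) (s.arr aPar) (s.arr aFst) (s.arr aNxt) (s.arr aDown)
  leaves : IsLeafList (s.var vNodes) (s.arr aPar) (s.arr aLeaves) (s.arr aIdx) (s.var vStates)
  states_le : s.var vStates ≤ s.var vNodes

theorem HoldsLeaves.of_agree (h : HoldsLeaves F m s) {V U : List ℕ} {s' : Store}
    (hs : Agree V U s s') (hV : ∀ x ∈ [vLetters, vNodes, vStates], x ∉ V)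
    (hU : ∀ a ∈ [aPar, aLab, aTop, aRow, aFst, aNxt, aDown, aLeaves, aIdx], a ∉ U) :
    HoldsLeaves F m s' := by
  have hz := h.zielonka.of_agree hs (fun x hx => hV x (by simp at hx ⊢; omega))
    (fun a ha => hU a (by simp at ha ⊢; omega))
  simp only [List.mem_cons, List.not_mem_nil, or_false, forall_eq_or_imp, forall_eq] at hV hU
  obtain ⟨-, v1, v2⟩ := hV
  obtain ⟨u1, -, -, u2, u3, u4, u5, u6, u7⟩ := hU
  obtain ⟨-, k2, k3, k4, k5⟩ := h
  rw [← hs.var _ v1] at k2 k3 k4 k5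
  rw [← hs.var _ v2] at k4 k5
  rw [← hs.arr _ u1] at k3 k4
  rw [← hs.arr _ u2] at k2
  rw [← hs.arr _ u3, ← hs.arr _ u4, ← hs.arr _ u5] at k3
  rw [← hs.arr _ u6, ← hs.arr _ u7] at k4
  exact ⟨hz, k2, k3, k4, k5⟩

/-- The transition of the automaton of the Zielonka tree from the leaf number `j` under the letter
`a`, as stored in the memory `s`. -/
def StoredStep (s : Store) (j : ℕ) (a : Fin c) (j' q : ℕ) : Prop :=
  j' < s.var vStates ∧
    TreeStep (s.var vNodes) (s.arr aPar) (s.label c) (s.arr aTop)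
      (cyclicNext (s.arr aPar) (s.arr aFst) (s.arr aNxt)) (s.arr aLeaves j) a (s.arr aLeaves j') q

/-- Computes the transition number `vEdge`. -/
def stepProg : Prog :=
  .assign vSupp (.get aLeaves (.var xQ)) ;;
  .assign vSide (.const 0) ;;
  .for xI vNodes (
    .ite (.get aLab (.add (.get aRow (.var vSupp)) (.var xA))) .skip (
      .assign vSide (.var vSupp) ;;
      .assign vSupp (.get aPar (.var vSupp)))) ;;
  .write aPrio (.var vEdge) (.get aTop (.var vSupp)) ;;
  .ite (.var vSide) (
    .assign vCur (.get aNxt (.var vSide)) ;;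
    .ite (.var vCur) .skip (.assign vCur (.get aFst (.var vSupp))) ;;
    .write aTgt (.var vEdge) (.get aIdx (.get aDown (.var vCur))))
  (.write aTgt (.var vEdge) (.var xQ))

theorem wp_stepProg (h : HoldsLeaves F m s) {j e : ℕ} (a : Fin c) (hj : s.var xQ = j)
    (hjm : j < s.var vStates) (ha : s.var xA = a) (he : s.var vEdge = e) :
    wp stepProg s fun t s' => t ≤ 40 * s.var vNodes + 40 ∧
      s'.var vEdge = e ∧ Agree stepProg.vars stepProg.arrs s s' ∧
      (∀ e' ≠ e, s'.arr aTgt e' = s.arr aTgt e' ∧ s'.arr aPrio e' = s.arr aPrio e') ∧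
      StoredStep s j a (s'.arr aTgt e) (s'.arr aPrio e) := by
  have htree := h.zielonka.tree
  set N := s.var vNodes with hN
  set par := s.arr aPar with hpar
  have hl := h.leaves.leaf j hjm
  set l := s.arr aLeaves j with hldef
  refine wp_mono (wp_agree (R := fun t s' => t ≤ 40 * N + 40 ∧
      (∀ e' ≠ e, s'.arr aTgt e' = s.arr aTgt e' ∧ s'.arr aPrio e' = s.arr aPrio e') ∧
      StoredStep s j a (s'.arr aTgt e) (s'.arr aPrio e)) ?_) ?_
  swap
  · rintro t s' ⟨⟨h1, h2, h3⟩, h4⟩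
    exact ⟨h1, (h4.var _ (by decide)).trans he, h4, h2, h3⟩
  simp only [stepProg, wp_seq, wp_assign]
  refine wp_for 20 (fun i s' =>
      Below par l (s'.var vSupp) ∧
      (∀ v, Below par l v → a ∈ s.label c v → Below par (s'.var vSupp) v) ∧
      ((s'.var vSide = 0 ∧ s'.var vSupp = l) ∨ (0 < s'.var vSide ∧ s'.var vSide < N ∧
        par (s'.var vSide) = s'.var vSupp ∧ Below par l (s'.var vSide))) ∧
      (a ∈ s.label c (s'.var vSupp) ∨ s'.var vSupp + i ≤ l))
    (by decide) (by decide) (m := N) ?_ ?_ ?_ ?_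
  · simp only [Store.setVar_var, Nat.reduceEqDiff, if_false, hN]
  · simp only [Store.setVar_var, Nat.reduceEqDiff, if_false, if_true, Expr.eval, hj]
    exact ⟨.refl l, fun v hv _ => hv, Or.inl ⟨trivial, rfl⟩, Or.inr le_rfl⟩
  · rintro i s1 hi hxi hag ⟨h1, h2, h3, h4⟩
    have hlab1 : s1.arr aLab = s.arr aLab := hag.arr _ (by decide)
    have hrow1 : s1.arr aRow = s.arr aRow := hag.arr _ (by decide)
    have hpar1 : s1.arr aPar = par := hag.arr _ (by decide)
    have hxa1 : s1.var xA = a := by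
      rw [hag.var _ (by decide)]
      simp only [Store.setVar_var, Nat.reduceEqDiff, if_false, ha]
    have huN : s1.var vSupp < N := (htree.le_of_below hl.1 h1).trans_lt hl.1
    simp only [wp_ite, wp_skip, wp_seq, wp_assign, Expr.eval, Expr.cost, hlab1, hrow1, hxa1,
      h.row _ huN, Store.setVar_var, Store.setVar_arr, hpar1, Nat.reduceEqDiff, if_false, if_true]
    set u := s1.var vSupp with hu
    refine ⟨fun h0 => ⟨by omega, h1, h2, h3, Or.inl h0⟩, fun h0 => ⟨by omega, ?_⟩⟩
    have hau : a ∉ s.label c u := fun h => h h0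
    have hu0 : 0 < u := by
      refine Nat.pos_of_ne_zero fun hu0 => hau ?_
      rw [hu0, htree.root]
      exact Set.mem_univ a
    have hpu := htree.par_lt u hu0 huN
    refine ⟨h1.trans (.parent u), fun v hv hav => ?_, Or.inr ⟨hu0, huN, trivial, h1⟩, ?_⟩
    · obtain ⟨k, hk⟩ := h2 v hv hav
      cases k with
      | zero => exact absurd (by rw [show u = v from hk]; exact hav) hau
      | succ k => exact ⟨k, hk⟩
    · rcases h4 with h4 | h4
      · exact absurd h4 hau
      · right
        change par u < u at hpu
        omega
  · rintro t s1 ht hag ⟨h1, h2, h3, h4⟩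
    have hlN : l < N := hl.1
    have hau : a ∈ s.label c (s1.var vSupp) := by
      rcases h4 with h4 | h4
      · exact h4
      · omega
    have huN : s1.var vSupp < N := (htree.le_of_below hl.1 h1).trans_lt hl.1
    have htop1 : s1.arr aTop = s.arr aTop := hag.arr _ (by decide)
    have hnxt1 : s1.arr aNxt = s.arr aNxt := hag.arr _ (by decide)
    have hfst1 : s1.arr aFst = s.arr aFst := hag.arr _ (by decide)
    have hdown1 : s1.arr aDown = s.arr aDown := hag.arr _ (by decide)
    have hidx1 : s1.arr aIdx = s.arr aIdx := hag.arr _ (by decide)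
    have htgt1 : s1.arr aTgt = s.arr aTgt := hag.arr _ (by decide)
    have hprio1 : s1.arr aPrio = s.arr aPrio := hag.arr _ (by decide)
    have he1 : s1.var vEdge = e := by
      rw [hag.var _ (by decide)]
      simp only [Store.setVar_var, Nat.reduceEqDiff, if_false, he]
    have hj1 : s1.var xQ = j := by
      rw [hag.var _ (by decide)]
      simp only [Store.setVar_var, Nat.reduceEqDiff, if_false, hj]
    generalize hu : s1.var vSupp = u at *
    generalize hx : s1.var vSide = x at *
    -- the leaf that is reached when the node `z` is chosen
    have hgoal : ∀ z, 0 < x → x < N → par x = u → Below par l x →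
        z = cyclicNext par (s.arr aFst) (s.arr aNxt) x →
        StoredStep s j a (s.arr aIdx (s.arr aDown z)) (s.arr aTop u) := by
      rintro z hx0 hxN hxu hlx rfl
      obtain ⟨k1, k2, k3⟩ := h.order.cyclicNext_spec hx0 hxN (hxu.trans_lt huN)
      have hd := h.order.leaf _ k2
      refine ⟨h.leaves.idx_lt _ hd, u, h1, hau, h2, rfl, Or.inr ⟨x, hx0, hxN, hxu, hlx, k1, k2,
        k3.trans hxu, ?_⟩⟩
      rw [h.leaves.list_idx _ hd]
      exact h.order.below _ k2
    have hother : ∀ z q e' : ℕ, e' ≠ e → (if e' = e then z else s.arr aTgt e') = s.arr aTgt e' ∧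
        (if e' = e then q else s.arr aPrio e') = s.arr aPrio e' := by
      intro z q e' hne
      rw [if_neg hne, if_neg hne]
      exact ⟨rfl, rfl⟩
    simp only [wp_write, wp_ite, wp_seq, wp_skip, wp_assign, Expr.eval, Expr.cost,
      Store.setArr_var, Store.setVar_var, he1, hj1, Nat.reduceEqDiff, if_false, if_true,
      Store.setVar_arr, Store.setArr_arr, false_and, true_and, htop1, hnxt1, hfst1, hdown1, hidx1,
      htgt1, hprio1, hu, hx]
    rcases h3 with ⟨hx0, hul⟩ | ⟨hx0, hxN, hxu, hlx⟩
    · refine ⟨fun hx => absurd hx0 hx, fun _ => ⟨by omega, hother _ _, hjm, u, h1, hau, h2, rfl,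
        Or.inl ⟨hul.symm, rfl⟩⟩⟩
    · refine ⟨fun _ => ⟨fun hz => ⟨by omega, hother _ _, hgoal _ hx0 hxN hxu hlx ?_⟩, fun hz =>
        ⟨by omega, hother _ _, hgoal _ hx0 hxN hxu hlx ?_⟩⟩, fun h0 => absurd h0 hx0.ne'⟩
      · rw [cyclicNext, if_neg hz]
      · rw [cyclicNext, if_pos hz, hxu]

/-- Computes all transitions of the automaton of the Zielonka tree. -/
def stepsProg : Prog :=
  .assign vEdge (.const 0) ;;
  .for xQ vStates (.for xA vLetters (stepProg ;; .assign vEdge (.add (.var vEdge) (.const 1))))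

theorem StoredStep.of_agree {j j' q : ℕ} {a : Fin c} (h : StoredStep s j a j' q) {V U : List ℕ}
    {s' : Store} (hs : Agree V U s s') (hV : ∀ x ∈ [vNodes, vStates], x ∉ V)
    (hU : ∀ a ∈ [aPar, aLab, aTop, aFst, aNxt, aLeaves], a ∉ U) : StoredStep s' j a j' q := by
  simp only [List.mem_cons, List.not_mem_nil, or_false, forall_eq_or_imp, forall_eq] at hV hU
  have h6 : s'.label c = s.label c := Store.label_congr (hs.arr _ hU.2.1)
  rwa [StoredStep, hs.var _ hV.1, hs.var _ hV.2, hs.arr _ hU.1, h6, hs.arr _ hU.2.2.1,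
    hs.arr _ hU.2.2.2.1, hs.arr _ hU.2.2.2.2.1, hs.arr _ hU.2.2.2.2.2]

theorem wp_stepsProg (h : HoldsLeaves F m s) :
    wp stepsProg s fun t s' =>
      t ≤ s.var vNodes * (c * (40 * s.var vNodes + 52) + 14) + 10 ∧ HoldsLeaves F m s' ∧
      ∀ j < s'.var vStates, ∀ a : Fin c,
        StoredStep s' j a (s'.arr aTgt (j * c + a)) (s'.arr aPrio (j * c + a)) := by
  set N := s.var vNodes with hN
  rw [stepsProg, wp_seq, wp_assign]
  refine wp_for (c * (40 * N + 52) + 6) (fun i s' => HoldsLeaves F m s' ∧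
      s'.var vEdge = i * c ∧
      ∀ j < i, ∀ a : Fin c,
        StoredStep s' j a (s'.arr aTgt (j * c + a)) (s'.arr aPrio (j * c + a)))
    (by decide) (by decide) (m := s.var vStates) ?_ ?_ ?_ ?_
  · simp only [Store.setVar_var, Nat.reduceEqDiff, if_false]
  · refine ⟨h.of_agree (((Agree.refl [vEdge, xQ] [] s).setVar (x := vEdge) (by simp) 0).setVar
      (x := xQ) (by simp) 0) (by decide) (by decide), ?_, ?_⟩
    · simp [Store.setVar_var, Expr.eval]
    · intro j hj
      omega
  · rintro i s1 hi hxi hag1 ⟨h1, he1, hI1⟩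
    have hN1 : s1.var vNodes = N := by
      rw [hag1.var _ (by decide)]
      simp only [Store.setVar_var, Nat.reduceEqDiff, if_false, hN]
    have hm1 : s1.var vStates = s.var vStates := by
      rw [hag1.var _ (by decide)]
      simp only [Store.setVar_var, Nat.reduceEqDiff, if_false]
    refine wp_for (40 * N + 44) (fun k s' => HoldsLeaves F m s' ∧ s'.var vEdge = i * c + k ∧
        (∀ j < i, ∀ a : Fin c,
          StoredStep s' j a (s'.arr aTgt (j * c + a)) (s'.arr aPrio (j * c + a))) ∧
        ∀ a : Fin c, a < k →
          StoredStep s' i a (s'.arr aTgt (i * c + a)) (s'.arr aPrio (i * c + a)))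
      (by decide) (by decide) h1.zielonka.letters ?_ ?_ ?_
    · have hag := (Agree.refl [xA] [] s1).setVar (x := xA) (by simp) 0
      refine ⟨h1.of_agree hag (by decide) (by decide), ?_, fun j hj a => ?_, fun a ha => ?_⟩
      · simpa [Store.setVar_var] using he1
      · exact (hI1 j hj a).of_agree hag (by decide) (by decide)
      · omega
    · rintro k s2 hk hxk hag2 ⟨h2, he2, hI2, hJ2⟩
      have hN2 : s2.var vNodes = N := by rw [hag2.var _ (by decide), hN1]
      have hm2 : s2.var vStates = s.var vStates := by rw [hag2.var _ (by decide), hm1]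
      have hxi2 : s2.var xQ = i := by rw [hag2.var _ (by decide), hxi]
      rw [wp_seq]
      refine wp_mono (wp_stepProg h2 ⟨k, hk⟩ hxi2 (by rw [hm2]; exact hi) hxk he2) ?_
      rintro t s3 ⟨ht, he3, hag3, hold, hnew⟩
      rw [wp_assign]
      simp only [Expr.eval, Expr.cost, he3]
      have hag : Agree (xA :: vEdge :: stepProg.vars) stepProg.arrs s2
          ((s3.setVar vEdge (i * c + k + 1)).setVar xA (k + 1)) :=
        ((hag3.mono (by simp) (by simp)).setVar (x := vEdge) (by simp) _).setVar (x := xA)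
          (by simp) _
      refine ⟨by rw [hN2] at ht; omega, h2.of_agree hag (by decide) (by decide), ?_,
        fun j hj a => ?_, fun a ha => ?_⟩
      · simp [Store.setVar_var, Nat.add_assoc]
      · have hne : j * c + a ≠ i * c + k := fun he => by
          have := ((row_inj a.2 hk).1 he).1
          omega
        simp only [Store.setVar_arr]
        rw [(hold _ hne).1, (hold _ hne).2]
        exact (hI2 j hj a).of_agree hag (by decide) (by decide)
      · simp only [Store.setVar_arr]
        rcases Nat.lt_succ_iff_lt_or_eq.1 ha with hlt | rfl
        · have hne : i * c + a ≠ i * c + k := by omega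
          rw [(hold _ hne).1, (hold _ hne).2]
          exact (hJ2 a hlt).of_agree hag (by decide) (by decide)
        · exact hnew.of_agree hag (by decide) (by decide)
    · rintro t s2 ht - ⟨h2, he2, hI2, hJ2⟩
      have hag := (Agree.refl [xQ] [] s2).setVar (x := xQ) (by simp) (i + 1)
      refine ⟨ht, h2.of_agree hag (by decide) (by decide), ?_, fun j hj a => ?_⟩
      · simp [Store.setVar_var, he2, Nat.add_mul]
      · rcases Nat.lt_succ_iff_lt_or_eq.1 hj with hlt | rfl
        · exact (hI2 j hlt a).of_agree hag (by decide) (by decide)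
        · exact (hJ2 a a.2).of_agree hag (by decide) (by decide)
  · rintro t s1 ht hag1 ⟨h1, -, hI1⟩
    have hm1 : s1.var vStates = s.var vStates := by
      rw [hag1.var _ (by decide)]
      simp only [Store.setVar_var, Nat.reduceEqDiff, if_false]
    have hle : s.var vStates * (c * (40 * N + 52) + 6 + 8) ≤ N * (c * (40 * N + 52) + 14) :=
      Nat.mul_le_mul_right _ h.states_le
    simp only [Expr.cost]
    refine ⟨by omega, h1, ?_⟩
    rw [hm1]
    exact hI1

/-- Builds the automaton of the Zielonka tree. -/
def minimalProg : Prog :=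
  rowsProg ;; siblingsProg ;; leavesProg ;; stepsProg ;;
  .assign vInit (.get aIdx (.get aDown (.const 0)))

theorem wp_minimalProg (h : HoldsZielonka F m s) :
    wp minimalProg s fun t s' =>
      t ≤ m * (c * (40 * m + 52) + 200) + 100 ∧
      ∃ (l : ℕ) (B : ParityAutomaton (Fin l) (Fin c)),
        B.IsMinimalFor (mullerLanguage F) ∧ HoldsAutomaton s' B := by
  obtain ⟨N, hN⟩ : ∃ N, s.var vNodes = N := ⟨_, rfl⟩
  have hNm : N ≤ m := hN ▸ h.le
  simp only [minimalProg, wp_seq]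
  refine wp_mono (wp_agree (wp_rowsProg hN h.letters)) ?_
  rintro t1 s1 ⟨⟨ht1, hs1⟩, hag1⟩
  have h1 := h.of_agree hag1 (by decide) (by decide)
  have hN1 : s1.var vNodes = N := by rw [hag1.var _ (by decide), hN]
  have htree1 := h1.tree
  rw [hN1] at htree1
  refine wp_mono (wp_agree (wp_siblingsProg hN1 htree1.par_lt
    fun v hv => ⟨(hs1 v hv).1, (hs1 v hv).2.1⟩)) ?_
  rintro t2 s2 ⟨⟨ht2, hs2⟩, hag2⟩
  have h2 := h1.of_agree hag2 (by decide) (by decide)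
  have hN2 : s2.var vNodes = N := by rw [hag2.var _ (by decide), hN1]
  have hpar2 : s2.arr aPar = s1.arr aPar := hag2.arr _ (by decide)
  rw [← hpar2] at hs2
  refine wp_mono (wp_agree (wp_leavesProg hN2 fun u hu => hs2.isLeaf_iff hu)) ?_
  rintro t3 s3 ⟨⟨ht3, hle3, hs3⟩, hag3⟩
  have h3 := h2.of_agree hag3 (by decide) (by decide)
  have hN3 : s3.var vNodes = N := by rw [hag3.var _ (by decide), hN2]
  have hl3 : HoldsLeaves F m s3 := by
    refine ⟨h3, fun v hv => ?_, ?_, ?_, ?_⟩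
    · rw [hag3.arr aRow (by decide), hag2.arr aRow (by decide)]
      exact (hs1 v (hN3 ▸ hv)).2.2
    · rw [hN3, hag3.arr aPar (by decide), hag3.arr aFst (by decide), hag3.arr aNxt (by decide),
        hag3.arr aDown (by decide)]
      exact hs2
    · rw [hN3, hag3.arr aPar (by decide)]
      exact hs3
    · rw [hN3]
      exact hle3
  refine wp_mono (wp_agree (wp_stepsProg hl3)) ?_
  rintro t4 s4 ⟨⟨ht4, hl4, hs4⟩, hag4⟩
  have hN4 : s4.var vNodes = N := by rw [hag4.var _ (by decide), hN3]
  rw [wp_assign]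
  simp only [Expr.eval, Expr.cost]
  have htree := hl4.zielonka.tree
  have hroot := hl4.order.leaf 0 htree.pos
  refine ⟨?_, s4.var vStates, ⟨⟨s4.arr aIdx (s4.arr aDown 0), hl4.leaves.idx_lt _ hroot⟩,
    fun q a => (⟨s4.arr aTgt (q * c + a), (hs4 q q.2 a).1⟩, s4.arr aPrio (q * c + a))⟩,
    ⟨?_, ?_⟩, ?_⟩
  · rw [hN3] at ht4
    have hle : N * (c * (40 * N + 52) + 14) ≤ m * (c * (40 * m + 52) + 14) := by gcongr
    have hm : m * (c * (40 * m + 52) + 200) = m * (c * (40 * m + 52) + 14) + 186 * m := by ring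
    omega
  · refine language_eq_of_treeStep htree hl4.zielonka.all hl4.zielonka.even hl4.zielonka.lt
      (fun x z hx0 hx hz0 hz hp => hl4.order.exists_iterate_eq hx0 hx hz0 hz
        ((htree.par_lt z hz0 hz).trans hz) hp)
      (leaf := fun q => s4.arr aLeaves q) (fun q => hl4.leaves.leaf q q.2) ?_
    exact fun q a => (hs4 q q.2 a).2
  · intro Q' _ B hB
    rw [Fintype.card_fin]
    exact hl4.leaves.le_ncard.trans (card_leaves_le hB htree)
  · refine ⟨?_, ?_, ?_, fun q a => ⟨rfl, rfl⟩⟩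
    · simp only [Store.setVar_var, Nat.reduceEqDiff, if_false]
    · simpa [Store.setVar_var] using hl4.zielonka.letters
    · simp only [Store.setVar_var, if_true]

end MullerParity

open MullerParity

/-- There is a program `Z` that, from any parity automaton `A` with `n` states over `c` letters that
recognises a Muller language `L_F`, builds the Zielonka tree of `F` in `O(d ^ 2 * c ^ 2 * n ^ 4)`
steps, where `d` is the number of priorities of `A`, and a program `M` that continues from there and
builds a minimal parity automaton for `L_F`, in a total time that is polynomial in the number
`n * c` of transitions of `A`. -/
theorem proposition2p7 :
    ∃ (Z M : MullerParity.Prog) (K : ℕ) (p : Polynomial ℕ),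
      ∀ (n c : ℕ), 0 < c →
        ∀ (A : MullerParity.ParityAutomaton (Fin n) (Fin c)) (F : Set (Set (Fin c))),
          A.language = MullerParity.mullerLanguage F →
            ∃ (t₁ t₂ : ℕ) (s₁ s₂ : MullerParity.Store),
              MullerParity.Exec Z (MullerParity.inputStore A) t₁ s₁ ∧
              t₁ ≤ K * (A.priorities.card ^ 2 * c ^ 2 * n ^ 4) ∧
              (∃ T : MullerParity.LabelledTree (Fin c),
                MullerParity.IsZielonkaTree F T ∧ MullerParity.HoldsTree s₁ T) ∧
              MullerParity.Exec M s₁ t₂ s₂ ∧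
              t₁ + t₂ ≤ p.eval (n * c) ∧
              ∃ (m : ℕ) (B : MullerParity.ParityAutomaton (Fin m) (Fin c)),
                B.IsMinimalFor (MullerParity.mullerLanguage F) ∧
                MullerParity.HoldsAutomaton s₂ B := by
  classical
  refine ⟨zielonkaProg, minimalProg, 2000, .C 2400 * .X ^ 8, fun n c hc A F hF => ?_⟩
  obtain ⟨t₁, s₁, hE₁, ht₁, hs₁⟩ := wp_zielonkaProg hF hc
  obtain ⟨t₂, s₂, hE₂, ht₂, hs₂⟩ := wp_minimalProg hs₁
  refine ⟨t₁, t₂, s₁, s₂, hE₁, ht₁, ?_, hE₂, ?_, hs₂⟩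
  · refine exists_isZielonkaTree hs₁.tree hs₁.all fun v hv a => ?_
    by_cases ha : s₁.arr 3 (v * c + a) = 0
    · rw [Set.indicator_of_notMem (by rw [Store.mem_label]; exact not_not.2 ha), ha]
    · rw [Set.indicator_of_mem (by rwa [Store.mem_label])]
      have := hs₁.bit v hv a a.2
      omega
  · have hn : 1 ≤ n := A.init.pos
    have hd : A.priorities.card ≤ n * c := by
      refine Finset.card_image_le.trans ?_
      simp
    rw [Polynomial.eval_mul, Polynomial.eval_C, Polynomial.eval_pow, Polynomial.eval_X]
    generalize A.priorities.card = d at *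
    have hx : 1 ≤ n * c := Nat.mul_pos hn hc
    have hnx : n ≤ n * c := Nat.le_mul_of_pos_right n hc
    have hcx : c ≤ n * c := Nat.le_mul_of_pos_left c hn
    generalize n * c = x at *
    have h1 : d ^ 2 * c ^ 2 * n ^ 4 ≤ x ^ 2 * x ^ 2 * x ^ 4 := by gcongr
    have h2 : n * d * (c * (40 * (n * d) + 52) + 200) ≤
        x * x * (x * (40 * (x * x) + 52) + 200) := by gcongr
    have h3 : x * x * (x * (40 * (x * x) + 52) + 200) = 40 * x ^ 5 + 52 * x ^ 3 + 200 * x ^ 2 := by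
      ring
    have h4 : x ^ 2 * x ^ 2 * x ^ 4 = x ^ 8 := by ring
    have h5 : x ^ 5 ≤ x ^ 8 := Nat.pow_le_pow_right hx (by norm_num)
    have h6 : x ^ 3 ≤ x ^ 8 := Nat.pow_le_pow_right hx (by norm_num)
    have h7 : x ^ 2 ≤ x ^ 8 := Nat.pow_le_pow_right hx (by norm_num)
    have h8 : 1 ≤ x ^ 8 := Nat.one_le_pow _ _ hx
    omega
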